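/- **Definitions.** A *workflow net* $N=(P,T,F,i,o)$ consists of disjoint finite sets of places $P$ and transitions $T$, arcs $F\subseteq (P\times T)\cup(T\times P)$, and places $i,o$ such that $i$ has no incoming arc, $o$ has no outgoing arc, and $(P\cup T,F\cup\{(o,i)\})$ is strongly connected; ${}^\bullet x$ and $x^\bullet$ denote presets and postsets, and for a set $C$ of transitions ${}^\bullet C=\bigcup_{t\in C}{}^\bullet t$. Markings, enabledness and firing are as usual for Petri nets; the initial marking $\mathbf i$ (final marking $\mathbf o$) has one token on $i$ (on $o$) and none elsewhere. The net is *sound* if $\mathbf o$ is reachable from every reachable marking, and *1-safe* if reachable markings put at most one token on each place; 1-safe markings are identified with sets of places. For $t$ enabled at $M$, the conflict set $C(t,M)$ is the set of transitions $u$ enabled at $M$ with ${}^\bullet t\cap{}^\bullet u\neq\emptyset$, and $\mathcal C(M)$ is the set of all conflict sets of $M$. A 1-safe net is *confusion-free* if for all reachable $M$ and all $t,u$ enabled at $M$ with ${}^\bullet t\cap{}^\bullet u=\emptyset$ one has $C(u,M)=C(u,M\setminus{}^\bullet t)=C(u,(M\setminus{}^\bullet t)\cup t^\bullet)$. A *timed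 probabilistic workflow net* (TPWN) $W=(N,w,\tau)$ is a 1-safe confusion-free workflow net $N$ with weights $w:T\to\mathbb Q_{>0}$ and durations $\tau:T\to\mathbb N$. We write $w(C)=\sum_{t\in C}w(t)$. *Timestamps.* Let $\mathbb N_\bot=\mathbb N\cup\{\bot\}$ with $\bot\le x$ and $\bot+x=\bot$. For $x\in\mathbb N_\bot^P$ let $upd(x,t)_p=\max_{q\in{}^\bullet t}x_q+\tau(t)$ if $p\in t^\bullet$, $\bot$ if $p\in{}^\bullet t\setminus t^\bullet$, and $x_p$ otherwise. Put $\mu(\epsilon)_i=0$, $\mu(\epsilon)_p=\bot$ for $p\ne i$, $\mu(\sigma t)=upd(\mu(\sigma),t)$, and $time(\sigma)=\max_p\mu(\sigma)_p$. Let $\mathrm{supp}(x)=\{p: x_p\neq\bot\}$. *Semantics.* $MDP_W$ is the Markov decision process whose states are the sets $M\subseteq P$ (1-safe markings) and the pairs $(M,t)$ with $M$ enabling $t$, with initial state $\mathbf i$. At $M$ a scheduler chooses, depending on the finite path so far, a conflict set $C\in\mathcal C(M)$, and the next state is $(M,t)$, $t\in C$, with probability $w(t)/w(C)$; a marking enabling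 no transition is followed by itself; $(M,t)$ is followed by $(M\setminus{}^\bullet t)\cup t^\bullet$. For an infinite path $\pi$, $time(\mathbf o,\pi)$ is $time(\sigma)$ for the transition sequence $\sigma$ of the shortest prefix of $\pi$ ending at $\mathbf o$, and $\infty$ if $\pi$ does not visit $\mathbf o$. The expected time $ET_W^S\in[0,\infty]$ under a scheduler $S$ is the expectation of $time(\mathbf o,\pi)$ under the path measure of $S$. *Finite abstraction.* For $x\in\mathbb N_\bot^P$ let $f(x,t)$ be obtained from $upd(x,t)$ by replacing each entry $k\ne\bot$ by $\max(k-\max_{q\in{}^\bullet t}x_q,0)$, and let $r(x)=\min_{C\in\mathcal C(\mathrm{supp}(x))}\max_{p\in{}^\bullet C}x_p$. An *earliest-first choice* assigns to each $x$ a conflict set $C_x\in\mathcal C(\mathrm{supp}(x))$ minimising $\max_{p\in{}^\bullet C}x_p$ (and $C_x=\emptyset$ if $\mathcal C(\mathrm{supp}(x))=\emptyset$). Its *abstraction states* are the elements of the smallest set containing $\mu(\epsilon)$ and, with each $x$, all $f(x,t)$ for $t\in C_x$. **Theorem.** Let $W$ be a TPWN. There is a value $ET_W\in\mathbb Q_{\ge0}\cup\{\infty\}$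 with $ET_W^S=ET_W$ for every scheduler $S$, and $ET_W=\infty$ if and only if $W$ is unsound. If $W$ is sound, then for every earliest-first choice all abstraction states lie in $\{\bot,0,\dots,H\}^P$, where $H=\max_{t\in T}\tau(t)$ ($H=0$ if $T=\emptyset$), and the finite linear equation system with one variable $X_x$ per abstraction state $x$, $$X_x=r(x)+\sum_{t\in C_x}\frac{w(t)}{w(C_x)}X_{f(x,t)}\ \text{ if }\mathrm{supp}(x)\ne\mathbf o,\qquad X_x=\max_{p\in P}x_p\ \text{ if }\mathrm{supp}(x)=\mathbf o,$$ has a unique real solution $X$, and $ET_W=X_{\mu(\epsilon)}$. Moreover, $ET_W$ can be computed in single exponential time: there are an algorithm and a polynomial $p$ such that for every TPWN $W$, given by the list of its transitions with presets, postsets, weights (numerator and denominator) and durations, together with the places $i,o$, all numbers in binary, the algorithm outputs $ET_W$ (either $\infty$ or a fraction of two naturals in binary) after at most $2^{p(n)}$ steps, where $n$ is the size of the input. Here algorithms are while programs over binary trees with unit cost per elementary operation, a model polynomially equivalent to Turing machines. -/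

import Mathlib

open MeasureTheory ProbabilityTheory
open scoped ENNReal NNReal

noncomputable section

/-! ## Workflow nets -/

/-- The edges of the graph of a net (with presets `pre` and postsets `post` of the transitions),
together with the additional edge `(o, i)`. -/
def flowEdge {P T : Type*} (pre post : T → Finset P) (i o : P) : P ⊕ T → P ⊕ T → Prop
  | Sum.inl p, Sum.inr t => p ∈ pre t
  | Sum.inr t, Sum.inl p => p ∈ post t
  | Sum.inl p, Sum.inl q => p = o ∧ q = i
  | Sum.inr _, Sum.inr _ => False

/-- A workflow net with places `P` and transitions `T`: the arcs are given by the presets and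
postsets of the transitions, no arc enters `i`, no arc leaves `o`, and the graph with the
additional edge `(o, i)` is strongly connected. -/
structure WorkflowNet (P T : Type*) where
  /-- the preset of a transition -/
  pre : T → Finset P
  /-- the postset of a transition -/
  post : T → Finset P
  /-- the initial place -/
  i : P
  /-- the final place -/
  o : P
  i_no_incoming : ∀ t, i ∉ post t
  o_no_outgoing : ∀ t, o ∉ pre t
  strongly_connected : ∀ x y : P ⊕ T,
    Relation.ReflTransGen (flowEdge pre post i o) x y

namespace WorkflowNet

variable {P T : Type*} [DecidableEq P]

/-- A transition is enabled at a marking if all places of its preset carry a token. -/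
def Enabled (N : WorkflowNet P T) (M : P → ℕ) (t : T) : Prop := ∀ p ∈ N.pre t, 1 ≤ M p

/-- The marking after the occurrence of an enabled transition. -/
def fire (N : WorkflowNet P T) (M : P → ℕ) (t : T) : P → ℕ := fun p =>
  M p - (if p ∈ N.pre t then 1 else 0) + (if p ∈ N.post t then 1 else 0)

/-- `N.Fires M σ M'`: `σ` is a firing sequence leading from `M` to `M'`. -/
def Fires (N : WorkflowNet P T) : (P → ℕ) → List T → (P → ℕ) → Prop
  | M, [], M' => M = M'
  | M, t :: σ, M' => N.Enabled M t ∧ N.Fires (N.fire M t) σ M'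

/-- The marking identified with a set of places. -/
def ofSet (M : Finset P) : P → ℕ := fun p => if p ∈ M then 1 else 0

/-- Reachability from the initial marking. -/
def Reachable (N : WorkflowNet P T) (M : P → ℕ) : Prop := ∃ σ, N.Fires (ofSet {N.i}) σ M

/-- A workflow net is sound if the final marking is reachable from every reachable marking. -/
def Sound (N : WorkflowNet P T) : Prop :=
  ∀ M, N.Reachable M → ∃ σ, N.Fires M σ (ofSet {N.o})

/-- A workflow net is 1-safe if no reachable marking puts more than one token on a place. -/
def OneSafe (N : WorkflowNet P T) : Prop := ∀ M, N.Reachable M → ∀ p, M p ≤ 1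

variable [Fintype T]

/-- The conflict set `C(t, M)` at a 1-safe marking `M`, identified with a set of places: the
transitions `u` such that `t` and `u` are both enabled at `M` and are dependent, i.e. their
presets intersect. -/
def conflictSet (N : WorkflowNet P T) (t : T) (M : Finset P) : Finset T :=
  Finset.univ.filter fun u => N.pre t ⊆ M ∧ N.pre u ⊆ M ∧ ¬ Disjoint (N.pre t) (N.pre u)

/-- The conflict sets of a marking. -/
def conflictSets (N : WorkflowNet P T) (M : Finset P) : Set (Finset T) :=
  {C | ∃ t, N.pre t ⊆ M ∧ C = N.conflictSet t M}

/-- Confusion-freeness: at a reachable marking, the occurrence of a transition does not change the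
conflict set of a concurrent (enabled and independent) transition. -/
def ConfusionFree (N : WorkflowNet P T) : Prop :=
  ∀ M : Finset P, N.Reachable (ofSet M) → ∀ t u, N.pre t ⊆ M → N.pre u ⊆ M →
    Disjoint (N.pre t) (N.pre u) →
      N.conflictSet u M = N.conflictSet u (M \ N.pre t) ∧
      N.conflictSet u M = N.conflictSet u ((M \ N.pre t) ∪ N.post t)

end WorkflowNet

/-- A timed probabilistic workflow net. -/
structure TPWN (P T : Type*) [DecidableEq P] [Fintype T] extends WorkflowNet P T where
  one_safe : toWorkflowNet.OneSafe
  confusion_free : toWorkflowNet.ConfusionFree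
  /-- the weight function -/
  w : T → ℚ
  w_pos : ∀ t, 0 < w t
  /-- the time function -/
  dur : T → ℕ

/-! ## Markov decision processes -/

/-- A Markov decision process with state space `Q`. -/
structure MDP (Q : Type*) where
  /-- the initial state -/
  init : Q
  /-- the probability transition function -/
  steps : Q → Set (PMF Q)

namespace MDP

variable {Q : Type*}

/-- A scheduler maps every finite path `q₀ q₁ … qₙ` to one of the distributions of `Steps(qₙ)`. -/
structure Scheduler (D : MDP Q) where
  /-- the distribution chosen after a finite path -/
  choice : (n : ℕ) → (Finset.Iic n → Q) → PMF Q
  choice_mem : ∀ n h, choice n h ∈ D.steps (h ⟨n, Finset.mem_Iic.2 le_rfl⟩)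

variable [Finite Q] [MeasurableSpace Q] [DiscreteMeasurableSpace Q]

/-- The one-step kernels of the process induced by a scheduler. -/
def Scheduler.kernel {D : MDP Q} (S : D.Scheduler) (n : ℕ) : Kernel (Finset.Iic n → Q) Q :=
  Kernel.ofFunOfCountable fun h => (S.choice n h).toMeasure

instance {D : MDP Q} (S : D.Scheduler) (n : ℕ) : IsMarkovKernel (S.kernel n) :=
  ⟨fun h => by
    change IsProbabilityMeasure (S.choice n h).toMeasure
    infer_instance⟩

/-- The probability measure `Prob^S` on infinite paths starting in the initial state. -/
def Scheduler.prob {D : MDP Q} (S : D.Scheduler) : Measure (ℕ → Q) :=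
  Kernel.traj (X := fun _ => Q) S.kernel 0 (fun _ => D.init)

end MDP

namespace TPWN

variable {P T : Type*} [Fintype P] [DecidableEq P] [Fintype T]

/-! ## Timestamps -/

/-- The update function on timestamps; `⊥` marks the places without a token. -/
def upd (W : TPWN P T) (x : P → WithBot ℕ) (t : T) : P → WithBot ℕ := fun p =>
  if p ∈ W.post t then (W.pre t).sup x + (W.dur t : WithBot ℕ)
  else if p ∈ W.pre t then ⊥ else x p

/-- The timestamp of the empty sequence. -/
def timestampInit (W : TPWN P T) : P → WithBot ℕ := fun p => if p = W.i then 0 else ⊥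

/-- The timestamp function `μ`. -/
def timestamp (W : TPWN P T) (σ : List T) : P → WithBot ℕ := σ.foldl W.upd W.timestampInit

/-- The maximal entry of a timestamp (`0` if all entries are `⊥`). -/
def maxEntry (x : P → WithBot ℕ) : ℕ := (Finset.univ.sup x).unbotD 0

/-- The time needed to fire a transition sequence. -/
def time (W : TPWN P T) (σ : List T) : ℕ := maxEntry (W.timestamp σ)

/-- The marking represented by a timestamp. -/
def supp (x : P → WithBot ℕ) : Finset P := by
  classical exact Finset.univ.filter fun p => x p ≠ ⊥

/-! ## The Markov decision process of a TPWN -/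

/-- The states of the MDP: 1-safe markings `M`, and pairs `(M, t)` such that `M` enables `t`. -/
def State (W : TPWN P T) : Type _ := Finset P ⊕ {x : Finset P × T // W.pre x.2 ⊆ x.1}

instance (W : TPWN P T) : Finite W.State := by unfold State; infer_instance
instance (W : TPWN P T) : MeasurableSpace W.State := ⊤
instance (W : TPWN P T) : DiscreteMeasurableSpace W.State := ⟨fun _ => trivial⟩

/-- The marking `M`, as a state. -/
def State.marking {W : TPWN P T} (M : Finset P) : W.State := Sum.inl M

/-- The total weight `w(C)` of a set of transitions. -/
def weight (W : TPWN P T) (C : Finset T) : ℚ := ∑ t ∈ C, W.w t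

/-- The distribution on states belonging to a conflict set `C` of the marking `M`: the state
`(M, t)` has probability `w(t) / w(C)` for `t ∈ C`, all other states have probability `0`. -/
def conflictProb (W : TPWN P T) (M : Finset P) (C : Finset T) : W.State → ℝ≥0∞ := by
  classical exact fun
  | Sum.inl _ => 0
  | Sum.inr ⟨(M', t), _⟩ =>
      if M' = M ∧ t ∈ C then ENNReal.ofReal ((W.w t / W.weight C : ℚ) : ℝ) else 0

/-- The Markov decision process of a TPWN. -/
def mdp (W : TPWN P T) : MDP W.State where
  init := State.marking {W.i}
  steps
    | Sum.inl M => {l | ((∀ t, ¬ W.pre t ⊆ M) ∧ l = PMF.pure (State.marking M)) ∨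
        ∃ C ∈ W.conflictSets M, ⇑l = W.conflictProb M C}
    | Sum.inr ⟨(M, t), _⟩ => {PMF.pure (State.marking ((M \ W.pre t) ∪ W.post t))}

/-- Presets are nonempty. -/
theorem pre_nonempty {P T : Type*} [DecidableEq P] [Fintype T] (W : TPWN P T) (t : T) : (W.pre t).Nonempty := by
  rcases Relation.ReflTransGen.cases_tail (W.strongly_connected (Sum.inl W.i) (Sum.inr t)) with
    h | ⟨c, _, hc⟩
  · cases h
  · rcases c with p | u
    · exact ⟨p, hc⟩
    · exact hc.elim

/-- Every state of the MDP of a TPWN offers a distribution. -/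
theorem steps_nonempty (W : TPWN P T) (s : W.State) : (W.mdp.steps s).Nonempty := by
  classical
  rcases s with M | ⟨⟨M, t⟩, ht⟩
  · by_cases h : ∀ t, ¬ W.pre t ⊆ M
    · exact ⟨_, Or.inl ⟨h, rfl⟩⟩
    · push Not at h
      obtain ⟨t, ht⟩ := h
      set C := W.conflictSet t M with hC
      have hen : ∀ u ∈ C, W.pre u ⊆ M := fun u hu => by
        simp only [hC, WorkflowNet.conflictSet, Finset.mem_filter] at hu
        exact hu.2.2.1
      have htC : t ∈ C := by
        simp only [hC, WorkflowNet.conflictSet, Finset.mem_filter, Finset.mem_univ, true_and]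
        exact ⟨ht, ht, by simpa using (W.pre_nonempty t).ne_empty⟩
      have hw : 0 < W.weight C := Finset.sum_pos (fun u _ => W.w_pos u) ⟨t, htC⟩
      let F : C → W.State := fun u => Sum.inr ⟨(M, u.1), hen u.1 u.2⟩
      have hF : Function.Injective F := fun u v huv => by
        have := congrArg (fun y => y.1.2) (Sum.inr_injective huv)
        exact Subtype.ext this
      have hsum : HasSum (W.conflictProb M C) 1 := by
        have h0 : ∀ y, y ∉ Set.range F → W.conflictProb M C y = 0 := by
          intro y hy
          rcases y with M' | ⟨⟨M', u⟩, hu⟩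
          · rfl
          · simp only [conflictProb]
            rw [if_neg]
            rintro ⟨rfl, huC⟩
            exact hy ⟨⟨u, huC⟩, rfl⟩
        rw [← hF.hasSum_iff h0]
        have h1 : W.conflictProb M C ∘ F =
            fun u : C => ENNReal.ofReal ((W.w u.1 / W.weight C : ℚ) : ℝ) := by
          funext u
          exact if_pos ⟨rfl, u.2⟩
        rw [h1]
        have h2 : ∑ u : C, ENNReal.ofReal ((W.w u.1 / W.weight C : ℚ) : ℝ) = 1 := by
          rw [← ENNReal.ofReal_sum_of_nonneg]
          · rw [← Rat.cast_sum, Finset.sum_coe_sort C (fun u => W.w u / W.weight C),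
              ← Finset.sum_div]
            change ENNReal.ofReal ((W.weight C / W.weight C : ℚ) : ℝ) = 1
            rw [div_self hw.ne']
            simp
          · intro u _
            exact_mod_cast (div_pos (W.w_pos u.1) hw).le
        rw [← h2]
        exact hasSum_fintype _
      exact ⟨⟨W.conflictProb M C, hsum⟩, Or.inr ⟨C, ⟨t, ht, rfl⟩, rfl⟩⟩
  · exact ⟨_, rfl⟩

/-- Every TPWN has a scheduler. -/
instance (W : TPWN P T) : Nonempty W.mdp.Scheduler :=
  ⟨⟨fun _ _ => (W.steps_nonempty _).choose, fun _ _ => (W.steps_nonempty _).choose_spec⟩⟩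

/-- The transition sequence of the first `n` states of a path. -/
def transitions {W : TPWN P T} (π : ℕ → W.State) (n : ℕ) : List T :=
  (List.range n).filterMap fun k => match π k with
    | Sum.inl _ => none
    | Sum.inr x => some x.1.2

open Classical in
/-- The time needed to reach a marking along an infinite path: the time of the transition sequence
of the shortest prefix ending at the marking, and `∞` if the marking is not visited. -/
def timeTo (W : TPWN P T) (M : Finset P) (π : ℕ → W.State) : ℝ≥0∞ :=
  if h : ∃ n, π n = State.marking M then (W.time (transitions π (Nat.find h)) : ℝ≥0∞) else ⊤

/-- The expected time under a scheduler: the expected time until reaching the final marking. -/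
def expectedTime (W : TPWN P T) (S : W.mdp.Scheduler) : ℝ≥0∞ :=
  ∫⁻ π, W.timeTo {W.o} π ∂S.prob

/-! ## The finite abstraction of the earliest-first scheduler -/

/-- The local starting time `max_{p ∈ •C} x_p` of a set of transitions. -/
def startTime (W : TPWN P T) (x : P → WithBot ℕ) (C : Finset T) : ℕ :=
  ((C.biUnion W.pre).sup x).unbotD 0

/-- The reward `r(x)`: the minimal local starting time of a conflict set of `supp x`. -/
def reward (W : TPWN P T) (x : P → WithBot ℕ) : ℕ :=
  sInf (W.startTime x '' W.conflictSets (supp x))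

/-- The abstract successor `f(x, t)`: after the update, the starting time of `t` is subtracted
from all entries different from `⊥` (truncating at `0`). -/
def absStep (W : TPWN P T) (x : P → WithBot ℕ) (t : T) : P → WithBot ℕ := fun p =>
  (W.upd x t p).map fun k => k - ((W.pre t).sup x).unbotD 0

/-- `γ` is an earliest-first choice: it assigns to every abstract state a conflict set with the
earliest local starting time (ties are broken arbitrarily), and `∅` if there is no conflict set. -/
def EarliestFirst (W : TPWN P T) (γ : (P → WithBot ℕ) → Finset T) : Prop :=
  ∀ x, (W.conflictSets (supp x) = ∅ ∧ γ x = ∅) ∨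
    (γ x ∈ W.conflictSets (supp x) ∧
      ∀ C ∈ W.conflictSets (supp x), W.startTime x (γ x) ≤ W.startTime x C)

/-- The states of the finite Markov chain induced by `γ`. -/
inductive AbsReachable (W : TPWN P T) (γ : (P → WithBot ℕ) → Finset T) : (P → WithBot ℕ) → Prop
  | init : AbsReachable W γ W.timestampInit
  | step (x : P → WithBot ℕ) (t : T) : AbsReachable W γ x → t ∈ γ x →
      AbsReachable W γ (W.absStep x t)

/-- `X` solves the linear equation system with one variable for each state of the finite chain. -/
def SolvesSystem (W : TPWN P T) (γ : (P → WithBot ℕ) → Finset T) (X : (P → WithBot ℕ) → ℝ) :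
    Prop :=
  ∀ x, W.AbsReachable γ x →
    (supp x ≠ {W.o} → X x = (W.reward x : ℝ) +
      ∑ t ∈ γ x, ((W.w t / W.weight (γ x) : ℚ) : ℝ) * X (W.absStep x t)) ∧
    (supp x = {W.o} → X x = (maxEntry x : ℝ))

/-- The maximal duration `H` of a transition. -/
def maxDur (W : TPWN P T) : ℕ := Finset.univ.sup W.dur

end TPWN

/-! ## Programs with a step count

The machine model is the usual language of while programs over binary trees with a single
variable: every constructor application, selector, test and composition takes one step. It
simulates, and is simulated by, multi-tape Turing machines with polynomial overhead. -/

/-- Binary trees. -/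
inductive Data : Type
  | nil : Data
  | cons : Data → Data → Data

/-- Programs; each of them transforms a tree into a tree. -/
inductive Prog : Type
  /-- the input itself -/
  | id : Prog
  /-- the tree `nil` -/
  | nil : Prog
  /-- the left subtree -/
  | hd : Prog
  /-- the right subtree -/
  | tl : Prog
  /-- run both programs on the input and combine the results -/
  | cons : Prog → Prog → Prog
  /-- run the first program, then the second on its result -/
  | seq : Prog → Prog → Prog
  /-- run the second program if the first yields a tree other than `nil`, else the third -/
  | ite : Prog → Prog → Prog → Prog
  /-- as long as the first program yields a tree other than `nil`, replace the current tree by the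
  result of the second program -/
  | loop : Prog → Prog → Prog

/-- The left subtree (`nil` for `nil`). -/
def Data.hd : Data → Data
  | nil => nil
  | cons a _ => a

/-- The right subtree (`nil` for `nil`). -/
def Data.tl : Data → Data
  | nil => nil
  | cons _ b => b

/-- `Runs c x y n`: on input `x` the program `c` halts with output `y` after exactly `n` steps. -/
inductive Runs : Prog → Data → Data → ℕ → Prop
  | id (x : Data) : Runs Prog.id x x 1
  | nil (x : Data) : Runs Prog.nil x Data.nil 1
  | hd (x : Data) : Runs Prog.hd x x.hd 1
  | tl (x : Data) : Runs Prog.tl x x.tl 1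
  | cons {c d : Prog} {x y z : Data} {m n : ℕ} :
      Runs c x y m → Runs d x z n → Runs (Prog.cons c d) x (Data.cons y z) (m + n + 1)
  | seq {c d : Prog} {x y z : Data} {m n : ℕ} :
      Runs c x y m → Runs d y z n → Runs (Prog.seq c d) x z (m + n + 1)
  | ite_true {b c d : Prog} {x u v y : Data} {m n : ℕ} :
      Runs b x (Data.cons u v) m → Runs c x y n → Runs (Prog.ite b c d) x y (m + n + 1)
  | ite_false {b c d : Prog} {x y : Data} {m n : ℕ} :
      Runs b x Data.nil m → Runs d x y n → Runs (Prog.ite b c d) x y (m + n + 1)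
  | loop_stop {b c : Prog} {x : Data} {m : ℕ} :
      Runs b x Data.nil m → Runs (Prog.loop b c) x x (m + 1)
  | loop_step {b c : Prog} {x u v y z : Data} {m n k : ℕ} :
      Runs b x (Data.cons u v) m → Runs c x y n → Runs (Prog.loop b c) y z k →
        Runs (Prog.loop b c) x z (m + n + k + 1)

namespace Data

/-- The number of nodes and leaves of a tree. -/
def size : Data → ℕ
  | nil => 1
  | cons a b => size a + size b + 1

/-- The tree representing a list. -/
def ofList : List Data → Data
  | [] => nil
  | a :: l => cons a (ofList l)

/-- The tree representing a truth value. -/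
def ofBool : Bool → Data
  | false => nil
  | true => cons nil nil

/-- The binary representation of a natural number, least significant bit first. -/
def ofNat (n : ℕ) : Data := ofList (n.bits.map ofBool)

end Data

namespace TPWN

variable {P T : Type*} [DecidableEq P] [Fintype T]

/-- The list of places, each with a mark for the members of a given set. -/
def encodeSet {a : ℕ} (eP : Fin a ≃ P) (A : Finset P) : Data :=
  Data.ofList (List.ofFn fun k => Data.ofBool (decide (eP k ∈ A)))

/-- A transition: preset, postset, weight (numerator and denominator) and duration, with all
numbers in binary. -/
def encodeTransition (W : TPWN P T) {a : ℕ} (eP : Fin a ≃ P) (t : T) : Data :=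
  Data.ofList [encodeSet eP (W.pre t), encodeSet eP (W.post t),
    Data.ofNat (W.w t).num.toNat, Data.ofNat (W.w t).den, Data.ofNat (W.dur t)]

/-- A TPWN as an input of a program, relative to enumerations of its places and transitions: the
sets `{i}` and `{o}`, and the list of transitions. -/
def encode (W : TPWN P T) {a b : ℕ} (eP : Fin a ≃ P) (eT : Fin b ≃ T) : Data :=
  Data.ofList [encodeSet eP {W.i}, encodeSet eP {W.o},
    Data.ofList (List.ofFn fun k => W.encodeTransition eP (eT k))]

end TPWN

/-- Nonnegative rationals extended by `∞`, in the extended nonnegative reals. -/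
def extRatToENNReal : WithTop ℚ≥0 → ℝ≥0∞
  | none => ⊤
  | some q => ((q : ℝ≥0) : ℝ≥0∞)

/-- The tree `d` is an output representing `e`: it is `nil` for `∞`, and a fraction with numerator
and denominator in binary for a rational number. -/
def IsOutput (d : Data) (e : WithTop ℚ≥0) : Prop :=
  (e = ⊤ ∧ d = Data.nil) ∨
    ∃ a b : ℕ, b ≠ 0 ∧ e = (((a : ℚ≥0) / (b : ℚ≥0) : ℚ≥0) : WithTop ℚ≥0) ∧
      d = Data.cons (Data.ofNat a) (Data.ofNat b)

end

/-!
The proof is organised around the expected terminal reward within `n` steps (`val`), defined by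
recursion on `n` for one arbitrary conflict set at each marking. In a confusion-free net, the
conflict sets of a marking partition its enabled transitions, a conflict set persists until one of
its transitions occurs, and transitions with disjoint presets commute, even for the timestamps
(`upd_comm`). A diamond argument therefore shows that this expectation does not depend on the
conflict sets chosen (`val_succ_aux`). Consequently it is harmonic for the Markov decision process
whatever the scheduler does, and it is the expectation of the reward collected within `n` steps
under the path measure of every scheduler (`lintegral_termReward`).

With the constant reward `1`, this concerns the probability of reaching the final marking. If the
net is sound, then the least such probability over all reachable markings is inherited by
successors, down to the final marking, so that it is `1` (`hitLim_eq_one`). If the net is unsound,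
then some reachable marking has probability `0`, and the probability at the initial marking is
less than `1` (`hitLim_init_lt_one`), so that the expected time is infinite
(`expectedTime_of_not_sound`). In a sound net, the expected time is the limit of the expected
timestamps within `n` steps.

This limit is computed in the finite abstraction. Transitions in conflict have the same starting
time (`sup_pre_eq`): otherwise the firing sequence could be reordered such that one of them is
enabled before an independent transition adds the other one to its conflict set, which is a
confusion. If the conflict set with the earliest starting time is always chosen, then no later
transition starts before it, so that subtracting the starting time from all timestamps, with
truncation at zero, loses nothing; an abstraction state together with the sum of the rewards `r`
collected so far gives the correct values (`Abstracts.val_eq`). These values converge to a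
solution of the linear system, which is unique by a minimum principle, because the final marking
is reached almost surely (`nonneg_of_superharmonic`, `SolvesSystem.unique`, `expectedTime_eq`).
Uniqueness also yields a rational solution, since the system is square with rational coefficients.

For the algorithm, the functions on encoded data computed by programs in polynomial time (`PT`)
are shown to be closed under iteration over lists with intermediate results of polynomial size
(`PT.exists_runs_foldl`, `PT.foldl`). Exponential time comes in only by the computation of a list
of exponential length, followed by a program running in time polynomial in that length
(`exists_prog`). The list drives the exploration of the abstraction states: every step adds a new
state unless all states have been found (`exists_represents`). The weights are made integral, and
the linear system is solved by a version of the Faddeev-LeVerrier iteration, scaled by factorials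
so that it needs only additions, subtractions and multiplications of integers of polynomial
length; its last step yields multiples of the determinant and of the inverse matrix
(`faddeev_mul`, `trace_faddeev_mul`). The determinant vanishes exactly for unsound nets
(`det_eq_zero_of_not_sound`, `det_ne_zero_of_sound`), so that it also decides between the two
forms of the output (`isOutput_result`).
-/

noncomputable section

/-! ### Firing in 1-safe confusion-free nets -/

namespace TPWN

variable {P T : Type*} [Fintype P] [DecidableEq P] [Fintype T]

omit [Fintype P] in
theorem post_nonempty (W : TPWN P T) (t : T) : (W.post t).Nonempty := by
  rcases Relation.ReflTransGen.cases_head (W.strongly_connected (Sum.inr t) (Sum.inl W.i)) with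
    h | ⟨c, hc, _⟩
  · cases h
  · rcases c with p | u
    · exact ⟨p, hc⟩
    · exact hc.elim

/-- The marking reached from the set of places `M` by the occurrence of `t`. -/
def fireSet (W : TPWN P T) (M : Finset P) (t : T) : Finset P := (M \ W.pre t) ∪ W.post t

/-- Reachability of a 1-safe marking, given as a set of places. -/
def SReach (W : TPWN P T) (M : Finset P) : Prop := W.Reachable (WorkflowNet.ofSet M)

omit [Fintype P] [Fintype T] in
theorem _root_.WorkflowNet.Fires.append {N : WorkflowNet P T} {σ ρ : List T} {M M' M'' : P → ℕ}
    (h : N.Fires M σ M') (h' : N.Fires M' ρ M'') : N.Fires M (σ ++ ρ) M'' := by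
  induction σ generalizing M with
  | nil => cases h; exact h'
  | cons t σ ih => exact ⟨h.1, ih h.2⟩

omit [Fintype P] [Fintype T] in
theorem _root_.WorkflowNet.enabled_ofSet {N : WorkflowNet P T} {M : Finset P} {t : T} :
    N.Enabled (WorkflowNet.ofSet M) t ↔ N.pre t ⊆ M := by
  unfold WorkflowNet.Enabled WorkflowNet.ofSet
  refine forall₂_congr fun p _ => ?_
  split_ifs <;> simp_all

omit [Fintype P] in
theorem sReach_init (W : TPWN P T) : W.SReach {W.i} := ⟨[], rfl⟩

omit [Fintype P] in
/-- In a 1-safe net a transition never puts a token on a place that keeps one. -/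
theorem disjoint_post {W : TPWN P T} {M : Finset P} (hM : W.SReach M) {t : T} (ht : W.pre t ⊆ M) :
    Disjoint (M \ W.pre t) (W.post t) := by
  rw [Finset.disjoint_left]
  intro p hp hp'
  obtain ⟨σ, hσ⟩ := hM
  have := W.one_safe (W.fire (WorkflowNet.ofSet M) t)
    ⟨σ ++ [t], hσ.append ⟨WorkflowNet.enabled_ofSet.2 ht, rfl⟩⟩ p
  rw [Finset.mem_sdiff] at hp
  simp [WorkflowNet.fire, WorkflowNet.ofSet, hp.1, hp.2, hp'] at this

omit [Fintype P] in
theorem fire_ofSet {W : TPWN P T} {M : Finset P} (hM : W.SReach M) {t : T} (ht : W.pre t ⊆ M) :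
    W.fire (WorkflowNet.ofSet M) t = WorkflowNet.ofSet (W.fireSet M t) := by
  have hd := disjoint_post hM ht
  rw [Finset.disjoint_left] at hd
  funext p
  have h1 := @hd p
  have h2 := @ht p
  simp only [WorkflowNet.fire, WorkflowNet.ofSet, fireSet, Finset.mem_union, Finset.mem_sdiff] at *
  by_cases a : p ∈ M <;> by_cases b : p ∈ W.pre t <;> by_cases c : p ∈ W.post t <;> simp_all

omit [Fintype P] in
theorem SReach.fire {W : TPWN P T} {M : Finset P} (hM : W.SReach M) {t : T} (ht : W.pre t ⊆ M) :
    W.SReach (W.fireSet M t) := by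
  have h := fire_ofSet hM ht
  obtain ⟨σ, hσ⟩ := hM
  exact ⟨σ ++ [t], hσ.append ⟨WorkflowNet.enabled_ofSet.2 ht, h⟩⟩

omit [Fintype P] in
/-- Every firing sequence from a reachable marking stays among the sets of places. -/
theorem SReach.induction {W : TPWN P T} {M : Finset P} (hM : W.SReach M) {σ : List T} {m : P → ℕ}
    (h : W.Fires (WorkflowNet.ofSet M) σ m) {p : Finset P → Prop} (hp : p M)
    (step : ∀ M t, W.SReach M → p M → W.pre t ⊆ M → p (W.fireSet M t)) :
    ∃ M', W.SReach M' ∧ p M' ∧ m = WorkflowNet.ofSet M' := by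
  induction σ generalizing M with
  | nil => exact ⟨M, hM, hp, h.symm⟩
  | cons t σ ih =>
    obtain ⟨h1, h2⟩ := h
    have ht := WorkflowNet.enabled_ofSet.1 h1
    rw [fire_ofSet hM ht] at h2
    exact ih (hM.fire ht) h2 (step _ _ hM hp ht)

theorem ofSet_injective {P : Type*} [DecidableEq P] {M M' : Finset P}
    (h : (WorkflowNet.ofSet M : P → ℕ) = WorkflowNet.ofSet M') : M = M' := by
  ext p
  have := congrFun h p
  simp only [WorkflowNet.ofSet] at this
  by_cases a : p ∈ M <;> by_cases b : p ∈ M' <;> simp_all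

omit [Fintype P] in
theorem mem_conflictSet {W : TPWN P T} {M : Finset P} {t u : T} : u ∈ W.conflictSet t M ↔
    W.pre t ⊆ M ∧ W.pre u ⊆ M ∧ ¬ Disjoint (W.pre t) (W.pre u) := by
  simp [WorkflowNet.conflictSet]

omit [Fintype P] in
theorem self_mem_conflictSet {W : TPWN P T} {M : Finset P} {t : T} (ht : W.pre t ⊆ M) :
    t ∈ W.conflictSet t M :=
  mem_conflictSet.2 ⟨ht, ht, by simpa using (W.pre_nonempty t).ne_empty⟩

omit [Fintype P] in
/-- In a confusion-free net the dependency of enabled transitions is transitive. -/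
theorem conflictSet_eq {W : TPWN P T} {M : Finset P} (hM : W.SReach M) {t u : T}
    (hu : u ∈ W.conflictSet t M) : W.conflictSet u M = W.conflictSet t M := by
  have key : ∀ t u v, W.pre t ⊆ M → W.pre u ⊆ M → W.pre v ⊆ M → ¬ Disjoint (W.pre t) (W.pre v) →
      ¬ Disjoint (W.pre u) (W.pre v) → ¬ Disjoint (W.pre t) (W.pre u) := by
    intro t u v ht hu hv htv huv htu
    have h := (W.confusion_free M hM t u ht hu htu).1
    have hvm : v ∈ W.conflictSet u M := mem_conflictSet.2 ⟨hu, hv, huv⟩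
    rw [h] at hvm
    have := (mem_conflictSet.1 hvm).2.1
    exact htv (Finset.disjoint_of_subset_right this Finset.disjoint_sdiff)
  obtain ⟨ht, hu, htu⟩ := mem_conflictSet.1 hu
  ext v
  rw [mem_conflictSet, mem_conflictSet]
  refine ⟨fun h => ⟨ht, h.2.1, ?_⟩, fun h => ⟨hu, h.2.1, ?_⟩⟩
  · exact key _ _ u ht h.2.1 hu htu fun h' => h.2.2 h'.symm
  · exact key _ _ t hu h.2.1 ht (fun h' => htu h'.symm) fun h' => h.2.2 h'.symm

omit [Fintype P] in
/-- Members of different conflict sets are independent. -/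
theorem disjoint_of_ne {W : TPWN P T} {M : Finset P} (hM : W.SReach M) {C D : Finset T}
    (hC : C ∈ W.conflictSets M) (hD : D ∈ W.conflictSets M) (hne : C ≠ D) {t u : T} (ht : t ∈ C)
    (hu : u ∈ D) : Disjoint (W.pre t) (W.pre u) := by
  obtain ⟨t', -, rfl⟩ := hC
  obtain ⟨u', -, rfl⟩ := hD
  by_contra h
  apply hne
  rw [← conflictSet_eq hM ht, ← conflictSet_eq hM hu]
  exact (conflictSet_eq hM (mem_conflictSet.2
    ⟨(mem_conflictSet.1 ht).2.1, (mem_conflictSet.1 hu).2.1, h⟩)).symm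

omit [Fintype P] in
theorem pre_subset_of_mem {W : TPWN P T} {M : Finset P} {C : Finset T}
    (hC : C ∈ W.conflictSets M) {t : T} (ht : t ∈ C) : W.pre t ⊆ M := by
  obtain ⟨t', -, rfl⟩ := hC
  exact (mem_conflictSet.1 ht).2.1

omit [Fintype P] in
theorem nonempty_of_mem_conflictSets {W : TPWN P T} {M : Finset P} {C : Finset T}
    (hC : C ∈ W.conflictSets M) : C.Nonempty := by
  obtain ⟨t', h, rfl⟩ := hC
  exact ⟨_, self_mem_conflictSet h⟩

omit [Fintype P] in
theorem eq_conflictSet {W : TPWN P T} {M : Finset P} (hM : W.SReach M) {C : Finset T}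
    (hC : C ∈ W.conflictSets M) {t : T} (ht : t ∈ C) : C = W.conflictSet t M := by
  obtain ⟨t', -, rfl⟩ := hC
  exact (conflictSet_eq hM ht).symm

omit [Fintype P] in
theorem conflictSet_fire {W : TPWN P T} {M : Finset P} (hM : W.SReach M) {t u : T}
    (ht : W.pre t ⊆ M) (hu : W.pre u ⊆ M) (h : Disjoint (W.pre t) (W.pre u)) :
    W.conflictSet u (W.fireSet M t) = W.conflictSet u M :=
  ((W.confusion_free M hM t u ht hu h).2).symm

omit [Fintype P] in
theorem pre_subset_fire {W : TPWN P T} {M : Finset P} {t u : T} (hu : W.pre u ⊆ M)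
    (h : Disjoint (W.pre t) (W.pre u)) : W.pre u ⊆ W.fireSet M t := fun _ hp =>
  Finset.mem_union_left _ (Finset.mem_sdiff.2 ⟨hu hp, Finset.disjoint_right.1 h hp⟩)

omit [Fintype P] in
theorem mem_conflictSets_fire {W : TPWN P T} {M : Finset P} (hM : W.SReach M) {C D : Finset T}
    (hC : C ∈ W.conflictSets M) (hD : D ∈ W.conflictSets M) (hne : C ≠ D) {t : T} (ht : t ∈ C) :
    D ∈ W.conflictSets (W.fireSet M t) := by
  obtain ⟨u, hu⟩ := nonempty_of_mem_conflictSets hD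
  have hd := disjoint_of_ne hM hC hD hne ht hu
  have h1 := pre_subset_of_mem hC ht
  have h2 := pre_subset_of_mem hD hu
  refine ⟨u, pre_subset_fire h2 hd, ?_⟩
  rw [conflictSet_fire hM h1 h2 hd]
  exact eq_conflictSet hM hD hu

omit [Fintype P] in
theorem disjoint_post_pre {W : TPWN P T} {M : Finset P} (hM : W.SReach M) {t u : T}
    (ht : W.pre t ⊆ M) (hu : W.pre u ⊆ M) (h : Disjoint (W.pre t) (W.pre u)) :
    Disjoint (W.post t) (W.pre u) :=
  (Finset.disjoint_of_subset_left (Finset.subset_sdiff.2 ⟨hu, h.symm⟩) (disjoint_post hM ht)).symm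

omit [Fintype P] in
theorem disjoint_post_post {W : TPWN P T} {M : Finset P} (hM : W.SReach M) {t u : T}
    (ht : W.pre t ⊆ M) (hu : W.pre u ⊆ M) (h : Disjoint (W.pre t) (W.pre u)) :
    Disjoint (W.post t) (W.post u) := by
  refine Finset.disjoint_of_subset_left ?_
    (disjoint_post (hM.fire ht) (pre_subset_fire hu h))
  refine Finset.subset_sdiff.2 ⟨Finset.subset_union_right, disjoint_post_pre hM ht hu h⟩

omit [Fintype P] in
theorem fireSet_comm {W : TPWN P T} {M : Finset P} (hM : W.SReach M) {t u : T}
    (ht : W.pre t ⊆ M) (hu : W.pre u ⊆ M) (h : Disjoint (W.pre t) (W.pre u)) :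
    W.fireSet (W.fireSet M t) u = W.fireSet (W.fireSet M u) t := by
  have h1 := disjoint_post_pre hM ht hu h
  have h2 := disjoint_post_pre hM hu ht h.symm
  rw [Finset.disjoint_left] at h1 h2
  ext p
  have h1 := @h1 p
  have h2 := @h2 p
  simp only [fireSet, Finset.mem_union, Finset.mem_sdiff]
  tauto

omit [Fintype P] [Fintype T] [DecidableEq P] in
theorem sup_pre_ne_bot (s : Finset P) (hs : s.Nonempty) (x : P → WithBot ℕ)
    (h : ∀ p ∈ s, x p ≠ ⊥) : s.sup x ≠ ⊥ := by
  obtain ⟨p, hp⟩ := hs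
  exact fun h' => h p hp (le_bot_iff.1 (h' ▸ Finset.le_sup hp))

omit [DecidableEq P] in
theorem mem_supp {x : P → WithBot ℕ} {p : P} : p ∈ supp x ↔ x p ≠ ⊥ := by
  simp [supp]

theorem sup_pre_ne_bot' {W : TPWN P T} {x : P → WithBot ℕ} {t : T} (ht : W.pre t ⊆ supp x) :
    (W.pre t).sup x ≠ ⊥ :=
  sup_pre_ne_bot _ (W.pre_nonempty t) _ fun _ hp => mem_supp.1 (ht hp)

theorem supp_upd {W : TPWN P T} {x : P → WithBot ℕ} {t : T} (ht : W.pre t ⊆ supp x) :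
    supp (W.upd x t) = W.fireSet (supp x) t := by
  have h := sup_pre_ne_bot' ht
  obtain ⟨k, hk⟩ := WithBot.ne_bot_iff_exists.1 h
  ext p
  rw [mem_supp, fireSet, Finset.mem_union, Finset.mem_sdiff, mem_supp, upd]
  split_ifs with h1 h2
  · rw [← hk]
    simp [h1, ← WithBot.coe_natCast, ← WithBot.coe_add]
  · simp [h1, h2]
  · simp [h1, h2]

omit [Fintype P] in
theorem upd_of_notMem {W : TPWN P T} {x : P → WithBot ℕ} {t : T} {p : P} (h : p ∉ W.post t)
    (h' : p ∉ W.pre t) : W.upd x t p = x p := by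
  rw [upd, if_neg h, if_neg h']

theorem upd_comm {W : TPWN P T} {x : P → WithBot ℕ} (hM : W.SReach (supp x)) {t u : T}
    (ht : W.pre t ⊆ supp x) (hu : W.pre u ⊆ supp x) (h : Disjoint (W.pre t) (W.pre u)) :
    W.upd (W.upd x t) u = W.upd (W.upd x u) t := by
  have h1 := disjoint_post_pre hM ht hu h
  have h2 := disjoint_post_pre hM hu ht h.symm
  have h3 := disjoint_post_post hM ht hu h
  have e1 : (W.pre u).sup (W.upd x t) = (W.pre u).sup x := Finset.sup_congr rfl fun p hp =>
    upd_of_notMem (Finset.disjoint_right.1 h1 hp) (Finset.disjoint_right.1 h hp)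
  have e2 : (W.pre t).sup (W.upd x u) = (W.pre t).sup x := Finset.sup_congr rfl fun p hp =>
    upd_of_notMem (Finset.disjoint_right.1 h2 hp) (Finset.disjoint_left.1 h hp)
  funext p
  rw [upd, upd.eq_1 W (W.upd x u), e1, e2, upd, upd]
  rw [Finset.disjoint_left] at h1 h2 h3
  have h1 := @h1 p
  have h2 := @h2 p
  have h3 := @h3 p
  split_ifs <;> simp_all

/-- The timestamps of the firing sequences. -/
inductive TReach (W : TPWN P T) : (P → WithBot ℕ) → Prop
  | init : TReach W W.timestampInit
  | step (x : P → WithBot ℕ) (t : T) : TReach W x → W.pre t ⊆ supp x → TReach W (W.upd x t)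

theorem supp_timestampInit (W : TPWN P T) : supp W.timestampInit = {W.i} := by
  ext p
  rw [mem_supp, timestampInit]
  split_ifs with h <;> simp [h]

theorem TReach.sReach {W : TPWN P T} {x : P → WithBot ℕ} (h : W.TReach x) :
    W.SReach (supp x) := by
  induction h with
  | init => rw [supp_timestampInit]; exact W.sReach_init
  | step x t _ ht ih => rw [supp_upd ht]; exact ih.fire ht

end TPWN

/-! ### Expected rewards do not depend on the scheduler -/

namespace TPWN

variable {P T : Type*} [Fintype P] [DecidableEq P] [Fintype T]

/-- The probability `w(t) / w(C)` of `t` in the conflict set `C`. -/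
def pr (W : TPWN P T) (C : Finset T) (t : T) : ℝ := ((W.w t / W.weight C : ℚ) : ℝ)

omit [Fintype P] in
theorem weight_pos (W : TPWN P T) {C : Finset T} (hC : C.Nonempty) : 0 < W.weight C :=
  Finset.sum_pos (fun u _ => W.w_pos u) hC

omit [Fintype P] in
theorem pr_nonneg (W : TPWN P T) (C : Finset T) (t : T) : 0 ≤ W.pr C t := by
  have h1 : 0 ≤ W.weight C := Finset.sum_nonneg fun u _ => (W.w_pos u).le
  have h2 := (W.w_pos t).le
  unfold pr
  exact_mod_cast div_nonneg h2 h1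

omit [Fintype P] in
theorem pr_pos (W : TPWN P T) {C : Finset T} (hC : C.Nonempty) (t : T) : 0 < W.pr C t := by
  unfold pr
  exact_mod_cast div_pos (W.w_pos t) (W.weight_pos hC)

omit [Fintype P] in
theorem sum_pr (W : TPWN P T) {C : Finset T} (hC : C.Nonempty) : ∑ t ∈ C, W.pr C t = 1 := by
  unfold pr
  rw [← Rat.cast_sum, ← Finset.sum_div]
  change ((W.weight C / W.weight C : ℚ) : ℝ) = 1
  rw [div_self (W.weight_pos hC).ne', Rat.cast_one]

/-- A transition system over the markings of `W`: the states `x` carry a marking `sp x`, the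
successor function `step` moves it as the net does, and independent transitions commute. The
instances of interest are the markings themselves and the timestamps. -/
structure IsUnfolding (W : TPWN P T) {S : Type*} (sp : S → Finset P) (step : S → T → S) :
    Prop where
  sp_step : ∀ x t, W.pre t ⊆ sp x → sp (step x t) = W.fireSet (sp x) t
  comm : ∀ x t u, W.SReach (sp x) → W.pre t ⊆ sp x → W.pre u ⊆ sp x →
    Disjoint (W.pre t) (W.pre u) → step (step x t) u = step (step x u) t

omit [Fintype P] in
theorem isUnfolding_marking (W : TPWN P T) : W.IsUnfolding id W.fireSet :=
  ⟨fun _ _ _ => rfl, fun _ _ _ hM ht hu h => fireSet_comm hM ht hu h⟩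

theorem isUnfolding_timestamp (W : TPWN P T) : W.IsUnfolding supp W.upd :=
  ⟨fun _ _ ht => supp_upd ht, fun _ _ _ hM ht hu h => upd_comm hM ht hu h⟩

open Classical in
/-- Some conflict set of the marking, and `∅` if there is none. -/
def someConflictSet (W : TPWN P T) (M : Finset P) : Finset T :=
  if h : ∃ t, W.pre t ⊆ M then W.conflictSet h.choose M else ∅

omit [Fintype P] in
theorem someConflictSet_mem {W : TPWN P T} {M : Finset P} (h : ∃ t, W.pre t ⊆ M) :
    W.someConflictSet M ∈ W.conflictSets M := by
  rw [someConflictSet, dif_pos h]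
  exact ⟨_, h.choose_spec, rfl⟩

omit [Fintype P] in
theorem someConflictSet_eq_empty {W : TPWN P T} {M : Finset P} (h : ¬ ∃ t, W.pre t ⊆ M) :
    W.someConflictSet M = ∅ := by
  rw [someConflictSet, dif_neg h]

/-- The expected terminal reward `g`, collected when the final marking is reached within `n`
transitions, for a scheduler choosing an arbitrary conflict set in each state. -/
def val (W : TPWN P T) {S : Type*} (sp : S → Finset P) (step : S → T → S) (g : S → ℝ) :
    ℕ → S → ℝ
  | 0, x => if sp x = {W.o} then g x else 0
  | n + 1, x => if sp x = {W.o} then g x else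
      ∑ t ∈ W.someConflictSet (sp x), W.pr (W.someConflictSet (sp x)) t * val W sp step g n (step x t)

omit [Fintype P] in
theorem not_enabled_final (W : TPWN P T) (t : T) : ¬ W.pre t ⊆ {W.o} := fun h => by
  obtain ⟨p, hp⟩ := W.pre_nonempty t
  have := Finset.mem_singleton.1 (h hp)
  exact W.o_no_outgoing t (this ▸ hp)

omit [Fintype P] in
theorem ne_final_of_enabled {W : TPWN P T} {M : Finset P} {t : T} (ht : W.pre t ⊆ M) :
    M ≠ {W.o} := fun h => W.not_enabled_final t (h ▸ ht)

omit [Fintype P] in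
theorem ne_final_of_mem {W : TPWN P T} {M : Finset P} {D : Finset T} (hD : D ∈ W.conflictSets M) :
    M ≠ {W.o} := by
  obtain ⟨t, ht, -⟩ := hD
  exact ne_final_of_enabled ht

variable {S : Type*} {sp : S → Finset P} {step : S → T → S} {g : S → ℝ}

omit [Fintype P] in
theorem val_final {W : TPWN P T} {x : S} (h : sp x = {W.o}) (n : ℕ) : W.val sp step g n x = g x := by
  cases n <;> rw [val, if_pos h]

omit [Fintype P] in
theorem val_dead {W : TPWN P T} {x : S} (h : sp x ≠ {W.o}) (h' : ¬ ∃ t, W.pre t ⊆ sp x) (n : ℕ) :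
    W.val sp step g n x = 0 := by
  cases n <;> rw [val, if_neg h]
  rw [someConflictSet_eq_empty h', Finset.sum_empty]

omit [Fintype P] in
/-- The expected reward within `n` steps does not depend on the conflict set chosen first: by
induction both choices may be continued with the respective other one, and independent
transitions commute. -/
theorem val_succ_aux {W : TPWN P T} (hU : W.IsUnfolding sp step) (n : ℕ) :
    ∀ x, W.SReach (sp x) → ∀ C ∈ W.conflictSets (sp x), ∀ D ∈ W.conflictSets (sp x),
      ∑ t ∈ C, W.pr C t * W.val sp step g n (step x t) =
        ∑ t ∈ D, W.pr D t * W.val sp step g n (step x t) := by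
  induction n with
  | zero =>
    have key : ∀ x, W.SReach (sp x) → ∀ C ∈ W.conflictSets (sp x), ∀ D ∈ W.conflictSets (sp x),
        C ≠ D → ∑ t ∈ C, W.pr C t * W.val sp step g 0 (step x t) = 0 := by
      intro x hx C hC D hD hne
      refine Finset.sum_eq_zero fun t ht => ?_
      have := ne_final_of_mem (mem_conflictSets_fire hx hC hD hne ht)
      rw [← hU.sp_step x t (pre_subset_of_mem hC ht)] at this
      rw [val, if_neg this, mul_zero]
    intro x hx C hC D hD
    by_cases hne : C = D
    · rw [hne]
    · rw [key x hx C hC D hD hne, key x hx D hD C hC (Ne.symm hne)]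
  | succ n ih =>
    have expand : ∀ x, W.SReach (sp x) → ∀ D ∈ W.conflictSets (sp x),
        W.val sp step g (n + 1) x = ∑ t ∈ D, W.pr D t * W.val sp step g n (step x t) := by
      intro x hx D hD
      rw [val, if_neg (ne_final_of_mem hD)]
      refine ih x hx _ (someConflictSet_mem ?_) D hD
      obtain ⟨t, ht, -⟩ := hD
      exact ⟨t, ht⟩
    have key : ∀ x, W.SReach (sp x) → ∀ C ∈ W.conflictSets (sp x), ∀ D ∈ W.conflictSets (sp x),
        C ≠ D → ∑ t ∈ C, W.pr C t * W.val sp step g (n + 1) (step x t) =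
          ∑ t ∈ C, ∑ u ∈ D, W.pr C t * (W.pr D u * W.val sp step g n (step (step x t) u)) := by
      intro x hx C hC D hD hne
      refine Finset.sum_congr rfl fun t ht => ?_
      have htm := pre_subset_of_mem hC ht
      rw [expand (step x t) _ D, Finset.mul_sum]
      · rw [hU.sp_step x t htm]
        exact mem_conflictSets_fire hx hC hD hne ht
      · rw [hU.sp_step x t htm]
        exact hx.fire htm
    intro x hx C hC D hD
    by_cases hne : C = D
    · rw [hne]
    rw [key x hx C hC D hD hne, key x hx D hD C hC (Ne.symm hne), Finset.sum_comm]
    refine Finset.sum_congr rfl fun u hu => Finset.sum_congr rfl fun t ht => ?_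
    rw [hU.comm x t u hx (pre_subset_of_mem hC ht) (pre_subset_of_mem hD hu)
      (disjoint_of_ne hx hC hD hne ht hu)]
    ring

omit [Fintype P] in
theorem val_succ {W : TPWN P T} (hU : W.IsUnfolding sp step) (n : ℕ) {x : S}
    (hx : W.SReach (sp x)) {D : Finset T} (hD : D ∈ W.conflictSets (sp x)) :
    W.val sp step g (n + 1) x = ∑ t ∈ D, W.pr D t * W.val sp step g n (step x t) := by
  rw [val, if_neg (ne_final_of_mem hD)]
  refine val_succ_aux hU n x hx _ (someConflictSet_mem ?_) D hD
  obtain ⟨t, ht, -⟩ := hD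
  exact ⟨t, ht⟩

omit [Fintype P] in
theorem val_nonneg {W : TPWN P T} (hg : ∀ x, 0 ≤ g x) (n : ℕ) (x : S) :
    0 ≤ W.val sp step g n x := by
  induction n generalizing x with
  | zero => rw [val]; split_ifs; exacts [hg x, le_rfl]
  | succ n ih =>
    rw [val]
    split_ifs
    exacts [hg x, Finset.sum_nonneg fun t _ => mul_nonneg (W.pr_nonneg _ t) (ih _)]

omit [Fintype P] in
theorem val_mono {W : TPWN P T} (hg : ∀ x, 0 ≤ g x) (x : S) :
    Monotone fun n => W.val sp step g n x := by
  refine monotone_nat_of_le_succ fun n => ?_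
  induction n generalizing x with
  | zero =>
    by_cases h : sp x = {W.o}
    · rw [val_final h, val_final h]
    · rw [val, if_neg h]; exact val_nonneg hg _ _
  | succ n ih =>
    rw [val, val]
    split_ifs
    · exact le_rfl
    · exact Finset.sum_le_sum fun t _ => mul_le_mul_of_nonneg_left (ih _) (W.pr_nonneg _ t)

/-- The probability of reaching the final marking from `M` within `n` transitions. -/
def hit (W : TPWN P T) (n : ℕ) (M : Finset P) : ℝ := W.val id W.fireSet (fun _ => 1) n M

omit [Fintype P] in
theorem hit_final (W : TPWN P T) (n : ℕ) : W.hit n {W.o} = 1 :=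
  val_final (sp := id) rfl n

omit [Fintype P] in
theorem hit_succ {W : TPWN P T} {M : Finset P} (hM : W.SReach M) {D : Finset T}
    (hD : D ∈ W.conflictSets M) (n : ℕ) :
    W.hit (n + 1) M = ∑ t ∈ D, W.pr D t * W.hit n (W.fireSet M t) :=
  val_succ W.isUnfolding_marking n (x := M) hM hD

omit [Fintype P] in
theorem hit_nonneg (W : TPWN P T) (n : ℕ) (M : Finset P) : 0 ≤ W.hit n M :=
  val_nonneg (fun _ => zero_le_one) n M

omit [Fintype P] in
theorem hit_mono (W : TPWN P T) (M : Finset P) : Monotone fun n => W.hit n M :=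
  val_mono (fun _ => zero_le_one) M

omit [Fintype P] in
theorem hit_le_one (W : TPWN P T) (n : ℕ) (M : Finset P) : W.hit n M ≤ 1 := by
  unfold hit
  induction n generalizing M with
  | zero => rw [val]; split_ifs <;> norm_num
  | succ n ih =>
    rw [val]
    split_ifs
    · exact le_rfl
    rcases (W.someConflictSet (id M)).eq_empty_or_nonempty with h | h
    · rw [h, Finset.sum_empty]; exact zero_le_one
    · refine le_trans ?_ (W.sum_pr h).le
      exact Finset.sum_le_sum fun t _ => mul_le_of_le_one_right (W.pr_nonneg _ t) (ih _)

/-- The probability of reaching the final marking from `M`. -/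
def hitLim (W : TPWN P T) (M : Finset P) : ℝ := ⨆ n, W.hit n M

omit [Fintype P] in
theorem bddAbove_hit (W : TPWN P T) (M : Finset P) : BddAbove (Set.range fun n => W.hit n M) :=
  ⟨1, by rintro _ ⟨n, rfl⟩; exact W.hit_le_one n M⟩

open Filter Topology in
omit [Fintype P] in
theorem tendsto_hit (W : TPWN P T) (M : Finset P) :
    Tendsto (fun n => W.hit n M) atTop (𝓝 (W.hitLim M)) :=
  tendsto_atTop_ciSup (W.hit_mono M) (W.bddAbove_hit M)

omit [Fintype P] in
theorem hit_le_hitLim (W : TPWN P T) (n : ℕ) (M : Finset P) : W.hit n M ≤ W.hitLim M :=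
  le_ciSup (W.bddAbove_hit M) n

omit [Fintype P] in
theorem hitLim_le_one (W : TPWN P T) (M : Finset P) : W.hitLim M ≤ 1 :=
  ciSup_le fun n => W.hit_le_one n M

omit [Fintype P] in
theorem hitLim_final (W : TPWN P T) : W.hitLim {W.o} = 1 :=
  le_antisymm (W.hitLim_le_one _) ((W.hit_final 0).symm.le.trans (W.hit_le_hitLim 0 _))

omit [Fintype P] in
theorem hitLim_dead {W : TPWN P T} {M : Finset P} (h : M ≠ {W.o}) (h' : ¬ ∃ t, W.pre t ⊆ M) :
    W.hitLim M = 0 := by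
  have : ∀ n, W.hit n M = 0 := fun n => val_dead (sp := id) h h' n
  simp [hitLim, this]

omit [Fintype P] in
theorem hitLim_eq {W : TPWN P T} {M : Finset P} (hM : W.SReach M) {D : Finset T}
    (hD : D ∈ W.conflictSets M) :
    W.hitLim M = ∑ t ∈ D, W.pr D t * W.hitLim (W.fireSet M t) := by
  refine tendsto_nhds_unique ((W.tendsto_hit M).comp (Filter.tendsto_add_atTop_nat 1)) ?_
  have : (fun n => W.hit n M) ∘ (fun a => a + 1) =
      fun n => ∑ t ∈ D, W.pr D t * W.hit n (W.fireSet M t) := funext fun n => hit_succ hM hD n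
  rw [this]
  exact tendsto_finsetSum _ fun t _ => (W.tendsto_hit _).const_mul _

omit [Fintype P] in
/-- If a weighted average of numbers `≥ c` is `c`, then all of them are `c`. -/
theorem eq_of_average {W : TPWN P T} {D : Finset T} (hD : D.Nonempty) {f : T → ℝ} {c : ℝ}
    (hf : ∀ t ∈ D, c ≤ f t) (h : c = ∑ t ∈ D, W.pr D t * f t) : ∀ t ∈ D, f t = c := by
  have h1 : ∑ t ∈ D, W.pr D t * (f t - c) = 0 := by
    simp only [mul_sub]
    rw [Finset.sum_sub_distrib, ← h, ← Finset.sum_mul, W.sum_pr hD, one_mul, sub_self]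
  rw [Finset.sum_eq_zero_iff_of_nonneg] at h1
  · intro t ht
    have := h1 t ht
    rw [mul_eq_zero] at this
    rcases this with h | h
    · exact absurd h (W.pr_pos hD t).ne'
    · linarith
  · exact fun t ht => mul_nonneg (W.pr_nonneg _ _) (sub_nonneg.2 (hf t ht))

/-- In a sound net the final marking is reached almost surely: the least probability is attained
at some marking, it is inherited by the successors, and hence equals the one of the final marking. -/
theorem hitLim_eq_one {W : TPWN P T} (hs : W.Sound) {M : Finset P} (hM : W.SReach M) :
    W.hitLim M = 1 := by
  obtain ⟨M₀, hM₀, hmin⟩ := Set.exists_min_image {M | W.SReach M} W.hitLim (Set.toFinite _) ⟨M, hM⟩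
  obtain ⟨σ, hσ⟩ := hs _ hM₀
  obtain ⟨M', -, h1, h2⟩ := SReach.induction (p := fun M => W.hitLim M = W.hitLim M₀) hM₀ hσ rfl
    fun N t hN hN' ht => eq_of_average ⟨t, self_mem_conflictSet ht⟩
      (f := fun t => W.hitLim (W.fireSet N t))
      (fun u hu => hmin _ (hN.fire (mem_conflictSet.1 hu).2.1))
      (hN'.symm.trans (hitLim_eq hN ⟨t, ht, rfl⟩)) t (self_mem_conflictSet ht)
  rw [← ofSet_injective h2, W.hitLim_final] at h1
  exact le_antisymm (W.hitLim_le_one M) (h1.trans_le (hmin M hM))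

omit [Fintype P] in
theorem exists_fires_of_hit {W : TPWN P T} (n : ℕ) {M : Finset P} (hM : W.SReach M)
    (h : W.hit n M ≠ 0) : ∃ σ, W.Fires (WorkflowNet.ofSet M) σ (WorkflowNet.ofSet {W.o}) := by
  by_cases hf : M = {W.o}
  · exact ⟨[], by rw [hf]; rfl⟩
  induction n generalizing M with
  | zero => exact absurd (if_neg hf) h
  | succ n ih =>
    by_cases he : ∃ t, W.pre t ⊆ M
    · obtain ⟨t, ht⟩ := he
      rw [hit_succ hM ⟨t, ht, rfl⟩] at h
      obtain ⟨u, hu, h'⟩ := Finset.exists_ne_zero_of_sum_ne_zero h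
      have hu' := (mem_conflictSet.1 hu).2.1
      have hr := hM.fire hu'
      have : ∃ σ, W.Fires (WorkflowNet.ofSet (W.fireSet M u)) σ (WorkflowNet.ofSet {W.o}) := by
        by_cases hf' : W.fireSet M u = {W.o}
        · exact ⟨[], by rw [hf']; rfl⟩
        · exact ih hr (right_ne_zero_of_mul h') hf'
      obtain ⟨σ, hσ⟩ := this
      refine ⟨u :: σ, WorkflowNet.enabled_ofSet.2 hu', ?_⟩
      rwa [fire_ofSet hM hu']
    · exact absurd (val_dead (sp := id) hf he _) h

omit [Fintype P] in
/-- If the final marking is almost surely reached from the initial one, then also from all reachable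
markings, since a weighted average of probabilities is one only if all of them are. -/
theorem hitLim_init_lt_one {W : TPWN P T} (hs : ¬ W.Sound) : W.hitLim {W.i} < 1 := by
  refine lt_of_le_of_ne (W.hitLim_le_one _) fun h => hs ?_
  rintro m ⟨σ, hσ⟩
  obtain ⟨M, hM, h1, rfl⟩ := SReach.induction (p := fun M => 1 - W.hitLim M = 0) W.sReach_init hσ
    (by rw [h, sub_self]) fun N t hN hN' ht => by
      refine eq_of_average (W := W) (D := W.conflictSet t N) ⟨t, self_mem_conflictSet ht⟩
        (f := fun t => 1 - W.hitLim (W.fireSet N t))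
        (fun u _ => sub_nonneg.2 (W.hitLim_le_one _)) ?_ t (self_mem_conflictSet ht)
      simp only [mul_sub, Finset.sum_sub_distrib]
      rw [← hitLim_eq hN ⟨t, ht, rfl⟩]
      simp only [mul_one]
      rw [W.sum_pr ⟨t, self_mem_conflictSet ht⟩, hN']
  by_contra hno
  have : ∀ n, W.hit n M = 0 := fun n => by
    by_contra h'
    exact hno (exists_fires_of_hit n hM h')
  have h0 : W.hitLim M = 0 := by simp [hitLim, this]
  rw [h0] at h1
  norm_num at h1

end TPWN

/-! ### The path measure of a scheduler -/

namespace MDP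

variable {Q : Type*} [Finite Q] [MeasurableSpace Q] [DiscreteMeasurableSpace Q]

theorem _root_.DependsOn.measurable_of_finite {n : ℕ} {f : (ℕ → Q) → ℝ≥0∞}
    (hf : DependsOn f (Set.Iic n)) : Measurable f := by
  rcases isEmpty_or_nonempty Q with h | ⟨⟨q⟩⟩
  · exact measurable_of_countable f
  obtain ⟨F, hF⟩ : ∃ F : (Finset.Iic n → Q) → ℝ≥0∞, ∀ π, f π = F fun i => π i := by
    refine ⟨fun z => f fun i => if h : i ∈ Finset.Iic n then z ⟨i, h⟩ else q, fun π => hf fun i hi => ?_⟩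
    rw [dif_pos (Finset.mem_Iic.2 hi)]
  rw [funext hF]
  have h1 : Measurable F := measurable_of_countable _
  have h2 : Measurable fun (π : ℕ → Q) (i : Finset.Iic n) => π i :=
    measurable_pi_lambda _ fun i => measurable_pi_apply _
  have h3 := Measurable.comp h1 h2
  exact h3

theorem lintegral_prob_eq {D : MDP Q} (S : D.Scheduler) {n : ℕ} {f : (ℕ → Q) → ℝ≥0∞}
    (hf : DependsOn f (Set.Iic n)) :
    ∫⁻ π, f π ∂S.prob = Kernel.lmarginalPartialTraj S.kernel 0 n f fun _ => D.init := by
  rw [Kernel.lmarginalPartialTraj, Scheduler.prob]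
  have h := Kernel.traj_map_frestrictLe_apply (X := fun _ => Q) (κ := S.kernel) 0 n
    (Preorder.frestrictLe 0 fun _ => D.init)
  rw [← h, lintegral_map]
  · refine lintegral_congr fun π => hf fun i hi => ?_
    simp [Function.updateFinset, Set.mem_Iic.1 hi]
  · exact hf.measurable_of_finite.comp measurable_updateFinset
  · exact Preorder.measurable_frestrictLe n

/-- The last state of a path of length `n + 1` is distributed according to the choice of the
scheduler after the first `n + 1` states. -/
theorem lintegral_prob_succ {D : MDP Q} (S : D.Scheduler) {n : ℕ} {f f' : (ℕ → Q) → ℝ≥0∞}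
    (hf : DependsOn f (Set.Iic (n + 1))) (hf' : DependsOn f' (Set.Iic n))
    (h : ∀ π : ℕ → Q, f' π = ∫⁻ s, f (Function.update π (n + 1) s)
      ∂(S.choice n (Preorder.frestrictLe n π)).toMeasure) :
    ∫⁻ π, f π ∂S.prob = ∫⁻ π, f' π ∂S.prob := by
  rw [lintegral_prob_eq S hf, lintegral_prob_eq S hf',
    ← Kernel.lmarginalPartialTraj_self (Nat.zero_le n) (Nat.le_succ n) hf.measurable_of_finite]
  congr 1
  funext π
  rw [Kernel.lmarginalPartialTraj_succ n hf.measurable_of_finite, h]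
  rfl

theorem lintegral_prob_zero {D : MDP Q} (S : D.Scheduler) {f : (ℕ → Q) → ℝ≥0∞}
    (hf : DependsOn f (Set.Iic 0)) : ∫⁻ π, f π ∂S.prob = f fun _ => D.init := by
  rw [lintegral_prob_eq S hf, Kernel.lmarginalPartialTraj_le _ le_rfl hf.measurable_of_finite]

instance {D : MDP Q} (S : D.Scheduler) : IsProbabilityMeasure S.prob := by
  unfold Scheduler.prob; infer_instance

theorem lintegral_toMeasure (l : PMF Q) (f : Q → ℝ≥0∞) :
    ∫⁻ s, f s ∂l.toMeasure = ∑' s, f s * l s := by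
  rw [lintegral_countable']
  exact tsum_congr fun s => by rw [PMF.toMeasure_apply_singleton _ _ (measurableSet_singleton s)]

theorem lintegral_pure (q : Q) (f : Q → ℝ≥0∞) : ∫⁻ s, f s ∂(PMF.pure q).toMeasure = f q := by
  rw [lintegral_toMeasure, tsum_eq_single q]
  · simp
  · intro b hb
    simp [hb]

end MDP

namespace TPWN

variable {P T : Type*} [Fintype P] [DecidableEq P] [Fintype T]

theorem lintegral_conflictProb {W : TPWN P T} {M : Finset P} {C : Finset T}
    (hC : C ∈ W.conflictSets M) {l : PMF W.State} (hl : ⇑l = W.conflictProb M C)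
    {f : W.State → ℝ≥0∞} {f' : T → ℝ≥0∞}
    (hf : ∀ t (h : W.pre t ⊆ M), t ∈ C → f (Sum.inr ⟨(M, t), h⟩) = f' t) :
    ∫⁻ s, f s ∂l.toMeasure = ∑ t ∈ C, ENNReal.ofReal (W.pr C t) * f' t := by
  rw [MDP.lintegral_toMeasure, hl]
  let F : C → W.State := fun u => Sum.inr ⟨(M, u.1), pre_subset_of_mem hC u.2⟩
  have hF : Function.Injective F := fun u v huv => by
    have := congrArg (fun y => y.1.2) (Sum.inr_injective huv)
    exact Subtype.ext this
  rw [← hF.tsum_eq]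
  · rw [tsum_fintype, ← Finset.sum_coe_sort C]
    refine Finset.sum_congr rfl fun u _ => ?_
    rw [hf u.1 _ u.2, mul_comm]
    congr 1
    exact if_pos ⟨rfl, u.2⟩
  · intro y hy
    rcases y with M' | ⟨⟨M', u⟩, hu⟩
    · exact absurd (mul_zero _) hy
    · by_cases h : M' = M ∧ u ∈ C
      · obtain ⟨rfl, huC⟩ := h
        exact ⟨⟨u, huC⟩, rfl⟩
      · have h0 : W.conflictProb M C (Sum.inr ⟨(M', u), hu⟩) = 0 := if_neg h
        exact absurd ((congrArg _ h0).trans (mul_zero _)) hy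

/-- The possible steps of the MDP from one state to the next. -/
def MStep (W : TPWN P T) : W.State → W.State → Prop
  | Sum.inl M, s => ((¬ ∃ t, W.pre t ⊆ M) ∧ s = Sum.inl M) ∨
      ∃ t, ∃ h : W.pre t ⊆ M, s = Sum.inr ⟨(M, t), h⟩
  | Sum.inr x, s => s = Sum.inl (W.fireSet x.1.1 x.1.2)

/-- The first `n + 1` states of the path form a path of the MDP. -/
def IsPath (W : TPWN P T) : ℕ → (ℕ → W.State) → Prop
  | 0, π => π 0 = Sum.inl {W.i}
  | n + 1, π => W.IsPath n π ∧ W.MStep (π n) (π (n + 1))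

/-- The marking belonging to a state. -/
def State.mk {W : TPWN P T} : W.State → Finset P
  | Sum.inl M => M
  | Sum.inr x => x.1.1

/-- The timestamp of the transitions among the first `n` states of a path. -/
def stamp (W : TPWN P T) (π : ℕ → W.State) (n : ℕ) : P → WithBot ℕ :=
  W.timestamp (transitions π n)

/-- The timestamp after passing through a state. -/
def pass (W : TPWN P T) (x : P → WithBot ℕ) : W.State → P → WithBot ℕ
  | Sum.inl _ => x
  | Sum.inr y => W.upd x y.1.2

omit [Fintype P] in
theorem stamp_succ (W : TPWN P T) (π : ℕ → W.State) (n : ℕ) :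
    W.stamp π (n + 1) = W.pass (W.stamp π n) (π n) := by
  unfold stamp transitions timestamp
  rw [List.range_succ, List.filterMap_append, List.foldl_append]
  rcases h : π n with M | y <;> simp [h, pass]

omit [Fintype P] in
theorem stamp_zero (W : TPWN P T) (π : ℕ → W.State) : W.stamp π 0 = W.timestampInit := rfl

theorem IsPath.stamp {W : TPWN P T} {n : ℕ} {π : ℕ → W.State} (h : W.IsPath n π) :
    W.TReach (W.stamp π n) ∧ (π n).mk = supp (W.stamp π n) := by
  induction n with
  | zero =>
    rw [stamp_zero, supp_timestampInit, show π 0 = _ from h]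
    exact ⟨TReach.init, rfl⟩
  | succ n ih =>
    obtain ⟨h1, h2⟩ := h
    obtain ⟨h3, h4⟩ := ih h1
    rw [stamp_succ]
    rcases hn : π n with M | ⟨⟨M, t⟩, ht⟩
    · rw [hn] at h2 h4
      refine ⟨h3, ?_⟩
      rcases h2 with ⟨-, h2⟩ | ⟨t, ht, h2⟩ <;> rw [h2] <;> exact h4
    · rw [hn] at h2 h4
      rw [show π (n + 1) = _ from h2]
      change M = _ at h4
      change W.pre t ⊆ M at ht
      rw [h4] at ht
      refine ⟨TReach.step _ _ h3 ht, ?_⟩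
      change W.fireSet M t = supp (W.upd _ t)
      rw [supp_upd ht, h4]

omit [Fintype P] in
theorem isPath_congr {W : TPWN P T} {n : ℕ} {π π' : ℕ → W.State} (h : ∀ m ≤ n, π m = π' m) :
    W.IsPath n π ↔ W.IsPath n π' := by
  induction n with
  | zero => simp [IsPath, h 0 le_rfl]
  | succ n ih =>
    rw [IsPath, IsPath, ih fun m hm => h m (by omega), h n (by omega), h (n + 1) le_rfl]

omit [Fintype P] in
theorem stamp_congr {W : TPWN P T} {n : ℕ} {π π' : ℕ → W.State} (h : ∀ m < n, π m = π' m) :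
    W.stamp π n = W.stamp π' n := by
  induction n with
  | zero => rfl
  | succ n ih => rw [stamp_succ, stamp_succ, ih fun m hm => h m (by omega), h n (by omega)]

/-- Functions `V j s x` of a state `s` and a timestamp `x` such that `V (j + 1)` is the expectation
of `V j` after one step of the MDP, whatever the scheduler chooses. -/
structure IsHarmonic (W : TPWN P T) (V : ℕ → W.State → (P → WithBot ℕ) → ℝ≥0∞) : Prop where
  conflict : ∀ j x, W.TReach x → ∀ C ∈ W.conflictSets (supp x),
    V (j + 1) (Sum.inl (supp x)) x =
      ∑ t ∈ C, ENNReal.ofReal (W.pr C t) *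
        if h : W.pre t ⊆ supp x then V j (Sum.inr ⟨(supp x, t), h⟩) x else 0
  dead : ∀ j x, W.TReach x → (¬ ∃ t, W.pre t ⊆ supp x) →
    V (j + 1) (Sum.inl (supp x)) x = V j (Sum.inl (supp x)) x
  fire : ∀ j x t, W.TReach x → ∀ h : W.pre t ⊆ supp x,
    V (j + 1) (Sum.inr ⟨(supp x, t), h⟩) x = V j (Sum.inl (W.fireSet (supp x) t)) (W.upd x t)

open Classical in
/-- A function that is harmonic for every choice of the scheduler has the same expectation after `n`
steps under all schedulers, namely its value at the initial state. -/
theorem lintegral_harmonic {W : TPWN P T} {V : ℕ → W.State → (P → WithBot ℕ) → ℝ≥0∞}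
    (hV : W.IsHarmonic V) (S : W.mdp.Scheduler) (n j : ℕ) :
    ∫⁻ π, (if W.IsPath n π then V j (π n) (W.stamp π n) else 0) ∂S.prob =
      V (j + n) (Sum.inl {W.i}) W.timestampInit := by
  have hdep : ∀ n j, DependsOn (fun π => if W.IsPath n π then V j (π n) (W.stamp π n) else 0)
      (Set.Iic n) := by
    intro n j π π' h
    dsimp only
    rw [isPath_congr h, stamp_congr fun m hm => h m (le_of_lt hm), h n (Set.mem_Iic.2 le_rfl)]
  induction n generalizing j with
  | zero =>
    rw [MDP.lintegral_prob_zero S (hdep 0 j)]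
    exact if_pos rfl
  | succ n ih =>
    rw [show j + (n + 1) = (j + 1) + n by ring, ← ih (j + 1)]
    refine MDP.lintegral_prob_succ S (hdep _ _) (hdep _ _) fun π => ?_
    have e1 : ∀ s, W.IsPath (n + 1) (Function.update π (n + 1) s) ↔
        W.IsPath n π ∧ W.MStep (π n) s := by
      intro s
      have hu : ∀ m ≤ n, Function.update π (n + 1) s m = π m := fun m hm =>
        Function.update_of_ne (by omega) _ _
      rw [IsPath, isPath_congr hu, hu n le_rfl, Function.update_self]
    have e2 : ∀ s, W.stamp (Function.update π (n + 1) s) (n + 1) = W.stamp π (n + 1) := fun s =>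
      stamp_congr fun m hm => Function.update_of_ne (by omega) _ _
    simp only [e1, e2, Function.update_self]
    by_cases hp : W.IsPath n π
    swap
    · simp [hp]
    simp only [hp, if_true, true_and]
    rw [stamp_succ]
    obtain ⟨hr, hm⟩ := hp.stamp
    have hmem := S.choice_mem n (Preorder.frestrictLe n π)
    generalize W.stamp π n = x at *
    generalize S.choice n (Preorder.frestrictLe n π) = l at *
    change l ∈ W.mdp.steps (π n) at hmem
    generalize π n = s at *
    rcases s with M | ⟨⟨M, t⟩, ht⟩
    · change M = supp x at hm
      subst hm
      rcases hmem with ⟨hd, rfl⟩ | ⟨C, hC, hl⟩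
      · have hd' : ¬ ∃ t, W.pre t ⊆ supp x := fun ⟨t, ht⟩ => hd t ht
        rw [MDP.lintegral_pure]
        exact (hV.dead j x hr hd').trans (if_pos (Or.inl ⟨hd', rfl⟩)).symm
      · rw [hV.conflict j x hr C hC, lintegral_conflictProb hC hl]
        intro t h ht
        rw [dif_pos h]
        exact if_pos (Or.inr ⟨t, h, rfl⟩)
    · change M = supp x at hm
      subst hm
      rw [show l = _ from hmem, MDP.lintegral_pure]
      exact (hV.fire j x t hr ht).trans (if_pos rfl).symm

open Classical in
/-- The measure of a scheduler is concentrated on the paths of the MDP: the constant function `1` is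
harmonic, and its integral over the paths of length `n` is the probability of these paths. -/
theorem ae_isPath {W : TPWN P T} (S : W.mdp.Scheduler) : ∀ᵐ π ∂S.prob, ∀ n, W.IsPath n π := by
  rw [ae_all_iff]
  intro n
  have hV : W.IsHarmonic fun _ _ _ => 1 := by
    refine ⟨fun j x _ C hC => ?_, fun _ _ _ _ => rfl, fun _ _ _ _ _ => rfl⟩
    rw [Finset.sum_congr rfl fun t ht => by rw [dif_pos (pre_subset_of_mem hC ht), mul_one],
      ← ENNReal.ofReal_sum_of_nonneg fun t _ => W.pr_nonneg C t,
      W.sum_pr (nonempty_of_mem_conflictSets hC), ENNReal.ofReal_one]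
  have h := lintegral_harmonic hV S n 0
  have hdep : DependsOn (fun π : ℕ → W.State => if W.IsPath n π then (1 : ℝ≥0∞) else 0)
      (Set.Iic n) := by
    intro π π' h
    dsimp only
    rw [isPath_congr h]
  have hm : MeasurableSet {π : ℕ → W.State | W.IsPath n π} := by
    have : {π : ℕ → W.State | W.IsPath n π} =
        (fun π : ℕ → W.State => if W.IsPath n π then (1 : ℝ≥0∞) else 0) ⁻¹' {1} := by
      ext π
      by_cases h : W.IsPath n π <;> simp [h]
    rw [this]
    exact hdep.measurable_of_finite (measurableSet_singleton _)
  change S.prob {π | W.IsPath n π}ᶜ = 0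
  rw [prob_compl_eq_zero_iff hm, ← lintegral_indicator_one hm, ← h]
  refine lintegral_congr fun π => ?_
  by_cases h : W.IsPath n π <;> simp [h]

/-- The expected terminal reward with `j` steps of the MDP left, from a state and a timestamp. The
occurrence of a transition takes two steps of the MDP, so that `j` steps starting at a marking allow
for `j / 2` transitions. -/
def valMDP (W : TPWN P T) (g : (P → WithBot ℕ) → ℝ) (j : ℕ) (s : W.State) (x : P → WithBot ℕ) :
    ℝ≥0∞ :=
  match s with
  | Sum.inl _ => ENNReal.ofReal (W.val supp W.upd g (j / 2) x)
  | Sum.inr y => if j = 0 then 0 else ENNReal.ofReal (W.val supp W.upd g ((j - 1) / 2) (W.upd x y.1.2))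

theorem isHarmonic_valMDP (W : TPWN P T) {g : (P → WithBot ℕ) → ℝ} (hg : ∀ x, 0 ≤ g x) :
    W.IsHarmonic (W.valMDP g) := by
  refine ⟨fun j x hx C hC => ?_, fun j x _ hd => ?_, fun j x t _ h => ?_⟩
  · have e : ∀ t ∈ C, (if h : W.pre t ⊆ supp x then W.valMDP g j (Sum.inr ⟨(supp x, t), h⟩) x
        else 0) = if j = 0 then 0 else
          ENNReal.ofReal (W.val supp W.upd g ((j - 1) / 2) (W.upd x t)) := fun t ht =>
      dif_pos (pre_subset_of_mem hC ht)
    rw [Finset.sum_congr rfl fun t ht => by rw [e t ht]]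
    cases j with
    | zero =>
      simp only [valMDP, if_true, mul_zero, Finset.sum_const_zero]
      rw [show (0 + 1) / 2 = 0 from rfl, val, if_neg (ne_final_of_mem hC), ENNReal.ofReal_zero]
    | succ k =>
      simp only [valMDP, Nat.add_eq_zero_iff, one_ne_zero, and_false, if_false,
        Nat.add_sub_cancel]
      rw [show (k + 1 + 1) / 2 = k / 2 + 1 by omega, val_succ W.isUnfolding_timestamp _ hx.sReach hC,
        ENNReal.ofReal_sum_of_nonneg fun t _ => mul_nonneg (W.pr_nonneg _ _) (val_nonneg hg _ _)]
      exact Finset.sum_congr rfl fun t _ => ENNReal.ofReal_mul (W.pr_nonneg _ _)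
  · simp only [valMDP]
    by_cases hf : supp x = {W.o}
    · rw [val_final hf, val_final hf]
    · rw [val_dead hf hd, val_dead hf hd]
  · simp [valMDP]

open Classical in
/-- The terminal reward of a path, if it has reached the final marking after `n` steps. -/
def termReward (W : TPWN P T) (g : (P → WithBot ℕ) → ℝ) (n : ℕ) (π : ℕ → W.State) : ℝ≥0∞ :=
  if π n = State.marking {W.o} then ENNReal.ofReal (g (W.stamp π n)) else 0

omit [Fintype P] in
theorem measurable_termReward [Finite P] (W : TPWN P T) (g : (P → WithBot ℕ) → ℝ) (n : ℕ) :
    Measurable (W.termReward g n) := by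
  cases nonempty_fintype P
  refine DependsOn.measurable_of_finite (n := n) fun π π' h => ?_
  unfold termReward
  rw [stamp_congr fun m hm => h m (le_of_lt hm), h n (Set.mem_Iic.2 le_rfl)]

/-- The expected reward collected within `n` steps is the same for all schedulers. -/
theorem lintegral_termReward (W : TPWN P T) {g : (P → WithBot ℕ) → ℝ} (hg : ∀ x, 0 ≤ g x)
    (S : W.mdp.Scheduler) (n : ℕ) : ∫⁻ π, W.termReward g n π ∂S.prob =
      ENNReal.ofReal (W.val supp W.upd g (n / 2) W.timestampInit) := by
  classical
  have h := lintegral_harmonic (W.isHarmonic_valMDP hg) S n 0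
  rw [zero_add] at h
  refine Eq.trans (lintegral_congr_ae ?_) h
  filter_upwards [ae_isPath S] with π hπ
  rw [if_pos (hπ n)]
  obtain ⟨-, h2⟩ := (hπ n).stamp
  unfold termReward
  rcases hn : π n with M | y
  · rw [hn] at h2
    change M = _ at h2
    subst h2
    change _ = ENNReal.ofReal (W.val supp W.upd g 0 (W.stamp π n))
    rw [val]
    by_cases hf : supp (W.stamp π n) = {W.o}
    · rw [if_pos hf]
      exact if_pos (congrArg Sum.inl hf)
    · rw [if_neg hf, ENNReal.ofReal_zero]
      exact if_neg fun h => hf (Sum.inl_injective h)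
  · exact if_neg (by rintro ⟨⟩)

omit [Fintype P] in
theorem IsPath.final_stays {W : TPWN P T} {π : ℕ → W.State} (hπ : ∀ n, W.IsPath n π) {n m : ℕ}
    (hnm : n ≤ m) (hn : π n = Sum.inl {W.o}) :
    π m = Sum.inl {W.o} ∧ W.stamp π m = W.stamp π n := by
  induction m, hnm using Nat.le_induction with
  | base => exact ⟨hn, rfl⟩
  | succ m _ ih =>
    have h := (hπ (m + 1)).2
    rw [ih.1] at h
    rw [stamp_succ, ih.1, ih.2]
    refine ⟨?_, rfl⟩
    rcases h with ⟨-, h⟩ | ⟨t, ht, -⟩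
    · exact h
    · exact absurd ht (W.not_enabled_final t)

omit [Fintype P] in
theorem termReward_mono {W : TPWN P T} {π : ℕ → W.State} (hπ : ∀ n, W.IsPath n π)
    (g : (P → WithBot ℕ) → ℝ) : Monotone fun n => W.termReward g n π := by
  intro n m hnm
  dsimp only
  rw [termReward]
  split_ifs with h
  · obtain ⟨h1, h2⟩ := IsPath.final_stays hπ hnm h
    rw [← h2]
    exact (if_pos (show π m = State.marking {W.o} from h1)).ge
  · exact zero_le

/-- The probability of ever reaching the final marking. -/
theorem prob_hits (W : TPWN P T) (S : W.mdp.Scheduler) :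
    S.prob {π | ∃ n, π n = State.marking {W.o}} = ENNReal.ofReal (W.hitLim {W.i}) := by
  have hval : ∀ n x, W.val supp W.upd (fun _ => 1) n x = W.hit n (supp x) := by
    intro n
    induction n with
    | zero => intro x; rfl
    | succ n ih =>
      intro x
      rw [hit, val, val]
      refine if_congr Iff.rfl rfl (Finset.sum_congr rfl fun t ht => ?_)
      rw [ih, supp_upd, hit]
      · rfl
      · by_cases h : ∃ t, W.pre t ⊆ supp x
        · exact pre_subset_of_mem (someConflictSet_mem h) ht
        · rw [id, someConflictSet_eq_empty h] at ht
          cases ht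
  have h1 : ∀ n, ∫⁻ π, W.termReward (fun _ => 1) n π ∂S.prob =
      ENNReal.ofReal (W.hit (n / 2) {W.i}) := fun n => by
    rw [lintegral_termReward W (fun _ => zero_le_one), hval, supp_timestampInit]
  have hm : MeasurableSet {π : ℕ → W.State | ∃ n, π n = State.marking {W.o}} := by
    rw [Set.ofPred_exists]
    exact MeasurableSet.iUnion fun n => (measurable_pi_apply n) (measurableSet_singleton _)
  have h2 : S.prob {π | ∃ n, π n = State.marking {W.o}} =
      ∫⁻ π, ⨆ n, W.termReward (fun _ => 1) n π ∂S.prob := by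
    rw [← lintegral_indicator_one hm]
    refine lintegral_congr fun π => ?_
    by_cases h : ∃ n, π n = State.marking {W.o}
    · rw [Set.indicator_of_mem (by exact h), Pi.one_apply]
      refine le_antisymm ?_ (iSup_le fun n => ?_)
      · obtain ⟨n, hn⟩ := h
        refine le_iSup_of_le n ?_
        rw [termReward, if_pos hn, ENNReal.ofReal_one]
      · rw [termReward]
        split_ifs <;> simp
    · rw [Set.indicator_of_notMem (by exact h)]
      symm
      rw [ENNReal.iSup_eq_zero]
      exact fun n => if_neg fun hn => h ⟨n, hn⟩
  rw [h2, lintegral_iSup' (fun n => (W.measurable_termReward _ n).aemeasurable)]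
  · simp only [h1]
    refine iSup_eq_of_tendsto ?_ ?_
    · intro n m hnm
      exact ENNReal.ofReal_le_ofReal (W.hit_mono _ (Nat.div_le_div_right hnm))
    · refine ENNReal.tendsto_ofReal ((W.tendsto_hit _).comp ?_)
      exact Filter.tendsto_atTop_mono' _ (Filter.Eventually.of_forall fun n => le_rfl)
        (Nat.tendsto_div_const_atTop two_ne_zero)
  · filter_upwards [ae_isPath S] with π hπ using termReward_mono hπ _

/-- In an unsound net the paths missing the final marking have positive probability, and the time of
each of them is infinite. -/
theorem expectedTime_of_not_sound {W : TPWN P T} (hs : ¬ W.Sound) (S : W.mdp.Scheduler) :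
    W.expectedTime S = ⊤ := by
  by_contra h
  have hm : MeasurableSet {π : ℕ → W.State | ∃ n, π n = State.marking {W.o}} := by
    rw [Set.ofPred_exists]
    exact MeasurableSet.iUnion fun n => (measurable_pi_apply n) (measurableSet_singleton _)
  have h1 : S.prob {π | ∃ n, π n = State.marking {W.o}}ᶜ ≠ 0 := by
    intro h0
    rw [prob_compl_eq_zero_iff hm, prob_hits, ENNReal.ofReal_eq_one] at h0
    exact (hitLim_init_lt_one hs).ne h0
  apply h
  rw [expectedTime, eq_top_iff]
  calc (⊤ : ℝ≥0∞) = ∫⁻ π in {π | ∃ n, π n = State.marking {W.o}}ᶜ, ⊤ ∂S.prob := by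
        rw [setLIntegral_const, ENNReal.top_mul h1]
    _ = ∫⁻ π in {π | ∃ n, π n = State.marking {W.o}}ᶜ, W.timeTo {W.o} π ∂S.prob := by
        refine setLIntegral_congr_fun hm.compl fun π hπ => ?_
        have hπ' : ¬ ∃ n, π n = State.marking {W.o} := hπ
        rw [timeTo, dif_neg hπ']
    _ ≤ _ := setLIntegral_le_lintegral _ _

open Filter Topology Classical in
/-- In a sound net almost all paths visit the final marking, and the expected time is the limit of the
expected terminal rewards by monotone convergence. -/
theorem expectedTime_of_sound {W : TPWN P T} (hs : W.Sound) {v : ℝ}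
    (hv : Tendsto (fun n => W.val supp W.upd (fun x => (maxEntry x : ℝ)) n W.timestampInit)
      atTop (𝓝 v)) (S : W.mdp.Scheduler) : W.expectedTime S = ENNReal.ofReal v := by
  have hm : MeasurableSet {π : ℕ → W.State | ∃ n, π n = State.marking {W.o}} := by
    rw [Set.ofPred_exists]
    exact MeasurableSet.iUnion fun n => (measurable_pi_apply n) (measurableSet_singleton _)
  have hh : ∀ᵐ π ∂S.prob, ∃ n, π n = State.marking {W.o} := by
    change S.prob {π | ∃ n, π n = State.marking {W.o}}ᶜ = 0
    rw [prob_compl_eq_zero_iff hm, prob_hits, hitLim_eq_one hs W.sReach_init, ENNReal.ofReal_one]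
  have h2 : W.expectedTime S =
      ∫⁻ π, ⨆ n, W.termReward (fun x => (maxEntry x : ℝ)) n π ∂S.prob := by
    refine lintegral_congr_ae ?_
    filter_upwards [ae_isPath S, hh] with π hπ h
    rw [timeTo, dif_pos h]
    have key : ∀ n, π n = State.marking {W.o} →
        W.termReward (fun x => (maxEntry x : ℝ)) n π = (maxEntry (W.stamp π n) : ℝ≥0∞) := by
      intro n hn
      rw [termReward, if_pos hn, ENNReal.ofReal_natCast]
    refine le_antisymm ?_ (iSup_le fun n => ?_)
    · exact le_iSup_of_le (Nat.find h) (key _ (Nat.find_spec h)).ge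
    · by_cases hn : π n = State.marking {W.o}
      · rw [key n hn, (IsPath.final_stays hπ (Nat.find_le hn) (Nat.find_spec h)).2]
        rfl
      · rw [termReward, if_neg hn]
        exact zero_le
  rw [h2, lintegral_iSup' (fun n => (W.measurable_termReward _ n).aemeasurable)]
  · simp only [lintegral_termReward W (fun x => Nat.cast_nonneg (maxEntry x))]
    refine iSup_eq_of_tendsto ?_ ?_
    · intro n m hnm
      exact ENNReal.ofReal_le_ofReal
        (val_mono (fun x => Nat.cast_nonneg (maxEntry x)) _ (Nat.div_le_div_right hnm))
    · exact ENNReal.tendsto_ofReal (hv.comp (Nat.tendsto_div_const_atTop two_ne_zero))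
  · filter_upwards [ae_isPath S] with π hπ using termReward_mono hπ _

end TPWN

/-! ### Conflicting transitions can start at the same time -/

namespace TPWN

variable {P T : Type*} [Fintype P] [DecidableEq P] [Fintype T]

/-- `W.Late θ x y`: the timestamp `y` is obtained from `x` by transitions ending after `θ`. -/
inductive Late (W : TPWN P T) (θ : ℕ) (x : P → WithBot ℕ) : (P → WithBot ℕ) → Prop
  | refl : Late W θ x x
  | step (y : P → WithBot ℕ) (v : T) : Late W θ x y → W.pre v ⊆ supp y →
      (θ : WithBot ℕ) < (W.pre v).sup y + W.dur v → Late W θ x (W.upd y v)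

theorem Late.tReach {W : TPWN P T} {θ : ℕ} {x y : P → WithBot ℕ} (h : W.Late θ x y)
    (hx : W.TReach x) : W.TReach y := by
  induction h with
  | refl => exact hx
  | step y v _ hv _ ih => exact TReach.step y v ih hv

omit [Fintype P] in
/-- The tokens with timestamp at most `θ` are not touched by a transition ending after `θ`. -/
theorem notMem_of_late {W : TPWN P T} {θ : ℕ} {y : P → WithBot ℕ} {v : T}
    (hθ : (θ : WithBot ℕ) < (W.pre v).sup y + W.dur v) {p : P} (hp : W.upd y v p ≠ ⊥)
    (hp' : W.upd y v p ≤ θ) : p ∉ W.post v ∧ p ∉ W.pre v := by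
  have h1 : p ∉ W.post v := fun h => by
    rw [upd, if_pos h] at hp'
    exact absurd hθ (not_lt.2 hp')
  refine ⟨h1, fun h2 => hp ?_⟩
  rw [upd, if_neg h1, if_pos h2]

theorem enabled_of_late {W : TPWN P T} {θ : ℕ} {y : P → WithBot ℕ} {v t : T}
    (hθ : (θ : WithBot ℕ) < (W.pre v).sup y + W.dur v) (ht : W.pre t ⊆ supp (W.upd y v))
    (hs : (W.pre t).sup (W.upd y v) ≤ θ) :
    W.pre t ⊆ supp y ∧ Disjoint (W.pre v) (W.pre t) ∧
      (W.pre t).sup (W.upd y v) = (W.pre t).sup y := by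
  have key : ∀ p ∈ W.pre t, p ∉ W.post v ∧ p ∉ W.pre v := fun p hp =>
    notMem_of_late hθ (mem_supp.1 (ht hp)) ((Finset.le_sup hp).trans hs)
  have key' : ∀ p ∈ W.pre t, W.upd y v p = y p := fun p hp =>
    upd_of_notMem (key p hp).1 (key p hp).2
  refine ⟨fun p hp => ?_, Finset.disjoint_right.2 fun p hp => (key p hp).2,
    Finset.sup_congr rfl key'⟩
  have := mem_supp.1 (ht hp)
  rw [key' p hp] at this
  exact mem_supp.2 this

/-- A transition ending by `θ` can be moved in front of all the transitions ending after `θ`: it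
only uses tokens with timestamp at most `θ`, and these have not been touched. -/
theorem Late.swap {W : TPWN P T} {θ : ℕ} {x y : P → WithBot ℕ} (hx : W.TReach x)
    (h : W.Late θ x y) {v : T} (hv : W.pre v ⊆ supp y) (hs : (W.pre v).sup y + W.dur v ≤ θ) :
    W.Late θ (W.upd x v) (W.upd y v) ∧ W.pre v ⊆ supp x ∧ (W.pre v).sup x = (W.pre v).sup y := by
  induction h with
  | refl => exact ⟨Late.refl, hv, rfl⟩
  | step y u hl hu hθ ih =>
    have hy := (hl.tReach hx).sReach
    have hs' : (W.pre v).sup (W.upd y u) ≤ θ := le_trans (by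
      conv_lhs => rw [← add_zero ((W.pre v).sup (W.upd y u))]
      gcongr
      exact_mod_cast Nat.zero_le _) hs
    obtain ⟨h1, h2, h3⟩ := enabled_of_late hθ hv hs'
    obtain ⟨h4, h5, h6⟩ := ih h1 (h3 ▸ hs)
    refine ⟨?_, h5, h6.trans h3.symm⟩
    rw [upd_comm hy hu h1 h2]
    have h7 := disjoint_post_pre hy h1 hu h2.symm
    refine Late.step _ _ h4 ?_ ?_
    · rw [supp_upd h1]
      exact pre_subset_fire hu h2.symm
    · rwa [Finset.sup_congr rfl fun p hp => upd_of_notMem (W := W) (x := y) (t := v)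
        (Finset.disjoint_right.1 h7 hp) (Finset.disjoint_left.1 h2 hp)]

/-- A firing sequence can be reordered such that the transitions ending after `θ` come last. -/
theorem TReach.exists_late {W : TPWN P T} {x : P → WithBot ℕ} (hx : W.TReach x) (θ : ℕ) :
    ∃ x₁, W.TReach x₁ ∧ (∀ p, x₁ p ≤ θ) ∧ W.Late θ x₁ x := by
  induction hx with
  | init =>
    refine ⟨_, TReach.init, fun p => ?_, Late.refl⟩
    rw [timestampInit]
    split_ifs
    · exact_mod_cast Nat.zero_le _
    · exact bot_le
  | step y v hy hv ih =>
    obtain ⟨x₁, h1, h2, h3⟩ := ih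
    rcases lt_or_ge (θ : WithBot ℕ) ((W.pre v).sup y + W.dur v) with h | h
    · exact ⟨x₁, h1, h2, Late.step y v h3 hv h⟩
    · obtain ⟨h4, h5, h6⟩ := h3.swap h1 hv h
      refine ⟨_, TReach.step _ _ h1 h5, fun p => ?_, h4⟩
      rw [upd]
      split_ifs
      exacts [h6 ▸ h, bot_le, h2 p]

/-- If all tokens of `x` have a timestamp at most `θ`, then undoing the later transitions one by one
keeps both `t` and, by confusion-freeness, the transitions in conflict with `t` enabled. -/
theorem Late.sup_pre_le {W : TPWN P T} {θ : ℕ} {x y : P → WithBot ℕ} (hx : W.TReach x)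
    (hθ : ∀ p, x p ≤ θ) (h : W.Late θ x y) {t u : T} (ht : (W.pre t).sup y ≤ θ)
    (hu : u ∈ W.conflictSet t (supp y)) : (W.pre u).sup y ≤ θ := by
  induction h with
  | refl => exact Finset.sup_le fun p _ => hθ p
  | step y v hl hv hθv ih =>
    have hy := (hl.tReach hx).sReach
    obtain ⟨h1, h2, h3⟩ := enabled_of_late hθv (mem_conflictSet.1 hu).1 ht
    rw [supp_upd hv, conflictSet_fire hy hv h1 h2] at hu
    have h4 := ih (h3 ▸ ht) hu
    have hue := (mem_conflictSet.1 hu).2.1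
    have h5 : Disjoint (W.pre v) (W.pre u) := by
      by_contra h
      have h6 : v ∈ W.conflictSet u (supp y) := mem_conflictSet.2 ⟨hue, hv, fun h' => h h'.symm⟩
      rw [conflictSet_eq hy hu] at h6
      exact (mem_conflictSet.1 h6).2.2 h2.symm
    rwa [Finset.sup_congr rfl fun p hp => upd_of_notMem (W := W) (x := y) (t := v)
      (Finset.disjoint_right.1 (disjoint_post_pre hy hv hue h5) hp)
      (Finset.disjoint_right.1 h5 hp)]

/-- Conflicting transitions have the same starting time. If a token needed by `u` arrived after
the tokens needed by `t`, then the sequence could be reordered such that `u` is not in conflict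
with `t` before the arrival of that token, and this would be a confusion. -/
theorem sup_pre_eq {W : TPWN P T} {x : P → WithBot ℕ} (hx : W.TReach x) {t u : T}
    (hu : u ∈ W.conflictSet t (supp x)) : (W.pre u).sup x = (W.pre t).sup x := by
  have key : ∀ t u, u ∈ W.conflictSet t (supp x) → (W.pre u).sup x ≤ (W.pre t).sup x := by
    intro t u hu
    obtain ⟨θ, hθ⟩ := WithBot.ne_bot_iff_exists.1 (sup_pre_ne_bot' (mem_conflictSet.1 hu).1)
    obtain ⟨x₁, h1, h2, h3⟩ := hx.exists_late θ
    rw [← hθ]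
    exact h3.sup_pre_le h1 h2 hθ.ge hu
  refine le_antisymm (key t u hu) (key u t ?_)
  obtain ⟨h1, h2, h3⟩ := mem_conflictSet.1 hu
  exact mem_conflictSet.2 ⟨h2, h1, fun h => h3 h.symm⟩

theorem sup_biUnion_pre {W : TPWN P T} {x : P → WithBot ℕ} (hx : W.TReach x) {C : Finset T}
    (hC : C ∈ W.conflictSets (supp x)) {t : T} (ht : t ∈ C) :
    (C.biUnion W.pre).sup x = (W.pre t).sup x := by
  rw [Finset.sup_biUnion]
  refine le_antisymm (Finset.sup_le fun u hu => ?_)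
    (Finset.le_sup (f := fun u => (W.pre u).sup x) ht)
  rw [eq_conflictSet hx.sReach hC ht] at hu
  exact (sup_pre_eq hx hu).le

/-! ### The finite abstraction -/

omit [DecidableEq P] in
theorem supp_eq_of_map_sub {x y : P → WithBot ℕ} {τ : ℕ}
    (h : ∀ p, y p = (x p).map fun k => k - τ) : supp y = supp x := by
  ext p
  rw [mem_supp, mem_supp, h p, Ne, WithBot.map_eq_bot_iff]

omit [Fintype P] [DecidableEq P] in
theorem sup_map_sub {x y : P → WithBot ℕ} {τ : ℕ} (h : ∀ p, y p = (x p).map fun k => k - τ)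
    (s : Finset P) : s.sup y = (s.sup x).map fun k => k - τ := by
  have hm : Monotone fun k : WithBot ℕ => k.map fun k => k - τ :=
    WithBot.monotone_map_iff.2 fun a b hab => Nat.sub_le_sub_right hab τ
  rw [funext h]
  symm
  exact Finset.apply_sup_eq_sup_comp (fun k : WithBot ℕ => k.map fun k => k - τ)
    (fun a b => hm.map_sup a b) rfl

/-- The abstract state `y` stands for the timestamp `x` at time `τ`, where `τ` is the total
reward collected so far: all entries are relative to `τ`, and no transition can start earlier. -/
structure Abstracts (W : TPWN P T) (x y : P → WithBot ℕ) (τ : ℕ) : Prop where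
  reach : W.TReach x
  eq : ∀ p, y p = (x p).map fun k => k - τ
  le_start : ∀ t, W.pre t ⊆ supp x → (τ : WithBot ℕ) ≤ (W.pre t).sup x
  le_max : ∃ p, (τ : WithBot ℕ) ≤ x p

theorem Abstracts.supp_eq {W : TPWN P T} {x y : P → WithBot ℕ} {τ : ℕ} (h : W.Abstracts x y τ) :
    supp y = supp x := supp_eq_of_map_sub h.eq

theorem abstracts_init (W : TPWN P T) : W.Abstracts W.timestampInit W.timestampInit 0 := by
  refine ⟨TReach.init, fun p => ?_, fun t ht => ?_, W.i, by simp [timestampInit]⟩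
  · cases W.timestampInit p <;> simp
  · obtain ⟨k, hk⟩ := WithBot.ne_bot_iff_exists.1 (sup_pre_ne_bot' ht)
    rw [← hk]
    exact WithBot.coe_le_coe.2 (Nat.zero_le k)

theorem startTime_eq {W : TPWN P T} {x : P → WithBot ℕ} (hx : W.TReach x) {C : Finset T}
    (hC : C ∈ W.conflictSets (supp x)) {t : T} (ht : t ∈ C) :
    (W.pre t).sup x = (W.startTime x C : WithBot ℕ) := by
  obtain ⟨k, hk⟩ := WithBot.ne_bot_iff_exists.1 (sup_pre_ne_bot' (pre_subset_of_mem hC ht))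
  rw [startTime, sup_biUnion_pre hx hC ht, ← hk]
  rfl

/-- The starting time of a conflict set is the accumulated reward plus its starting time in the
abstract state; no truncation occurs since no transition can start before `τ`. -/
theorem Abstracts.startTime {W : TPWN P T} {x y : P → WithBot ℕ} {τ : ℕ} (h : W.Abstracts x y τ)
    {C : Finset T} (hC : C ∈ W.conflictSets (supp x)) :
    τ + W.startTime y C = W.startTime x C := by
  obtain ⟨t, ht⟩ := nonempty_of_mem_conflictSets hC
  have h1 := startTime_eq h.reach hC ht
  have h2 := h.le_start t (pre_subset_of_mem hC ht)
  have h3 : W.startTime y C = W.startTime x C - τ := by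
    rw [TPWN.startTime, sup_map_sub h.eq, sup_biUnion_pre h.reach hC ht, h1]
    rfl
  rw [h1] at h2
  have : τ ≤ W.startTime x C := by exact_mod_cast h2
  omega

omit [Fintype P] in
theorem EarliestFirst.mem [Fintype P] {W : TPWN P T} {γ : (P → WithBot ℕ) → Finset T}
    (hγ : W.EarliestFirst γ) {y : P → WithBot ℕ} {t : T} (ht : t ∈ γ y) :
    γ y ∈ W.conflictSets (supp y) := by
  rcases hγ y with ⟨-, h⟩ | ⟨h, -⟩
  · rw [h] at ht
    cases ht
  · exact h

theorem EarliestFirst.reward_eq {W : TPWN P T} {γ : (P → WithBot ℕ) → Finset T}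
    (hγ : W.EarliestFirst γ) {y : P → WithBot ℕ} {t : T} (ht : t ∈ γ y) :
    W.reward y = W.startTime y (γ y) := by
  rcases hγ y with ⟨-, h⟩ | ⟨h1, h2⟩
  · rw [h] at ht
    cases ht
  · refine le_antisymm (Nat.sInf_le ⟨_, h1, rfl⟩) (le_csInf ⟨_, _, h1, rfl⟩ ?_)
    rintro _ ⟨C, hC, rfl⟩
    exact h2 C hC

/-- After an earliest-first step, no enabled transition can start before the starting time of that
step, so the invariant holds with the increased reward. -/
theorem Abstracts.step {W : TPWN P T} {γ : (P → WithBot ℕ) → Finset T}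
    (hγ : W.EarliestFirst γ) {x y : P → WithBot ℕ} {τ : ℕ} (h : W.Abstracts x y τ) {t : T}
    (ht : t ∈ γ y) : W.Abstracts (W.upd x t) (W.absStep y t) (τ + W.reward y) := by
  have hC : γ y ∈ W.conflictSets (supp x) := h.supp_eq ▸ hγ.mem ht
  have hte := pre_subset_of_mem hC ht
  have hr : τ + W.reward y = W.startTime x (γ y) := by rw [hγ.reward_eq ht, h.startTime hC]
  have hs : (W.pre t).sup x = ((τ + W.reward y : ℕ) : WithBot ℕ) := by
    rw [startTime_eq h.reach hC ht, hr]
  have hs' : (W.pre t).sup y = (W.reward y : WithBot ℕ) := by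
    rw [sup_map_sub h.eq, hs]
    exact congrArg _ (Nat.add_sub_cancel_left _ _)
  refine ⟨TReach.step _ _ h.reach hte, fun p => ?_, fun u hu => ?_, ?_⟩
  · rw [absStep, hs', upd, upd, hs, hs']
    split_ifs
    · change WithBot.map _ ((W.reward y + W.dur t : ℕ) : WithBot ℕ) =
        WithBot.map _ ((τ + W.reward y + W.dur t : ℕ) : WithBot ℕ)
      refine congrArg ((↑) : ℕ → WithBot ℕ) ?_
      change W.reward y + W.dur t - W.reward y = τ + W.reward y + W.dur t - (τ + W.reward y)
      omega
    · rfl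
    · rw [h.eq p]
      cases x p with
      | bot => rfl
      | coe k => exact congrArg ((↑) : ℕ → WithBot ℕ) (Nat.sub_sub k τ (W.reward y))
  · by_cases hd : Disjoint (W.pre u) (W.post t)
    · have hd' : Disjoint (W.pre t) (W.pre u) := by
        rw [Finset.disjoint_right]
        intro p hp hpt
        have := mem_supp.1 (hu hp)
        rw [upd, if_neg (Finset.disjoint_left.1 hd hp), if_pos hpt] at this
        exact this rfl
      have hsame : ∀ p ∈ W.pre u, W.upd x t p = x p := fun p hp =>
        upd_of_notMem (Finset.disjoint_left.1 hd hp) (Finset.disjoint_right.1 hd' hp)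
      have hux : W.pre u ⊆ supp x := fun p hp => by
        rw [mem_supp, ← hsame p hp]
        exact mem_supp.1 (hu hp)
      rw [Finset.sup_congr rfl hsame]
      have hD : W.conflictSet u (supp x) ∈ W.conflictSets (supp x) := ⟨u, hux, rfl⟩
      rw [startTime_eq h.reach hD (self_mem_conflictSet hux), hr]
      rcases hγ y with ⟨-, h'⟩ | ⟨-, h'⟩
      · rw [h'] at ht
        cases ht
      · have := h' (W.conflictSet u (supp x)) (by rw [h.supp_eq]; exact hD)
        have h1 := h.startTime hC
        have h2 := h.startTime hD
        exact_mod_cast (by omega : W.startTime x (γ y) ≤ _)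
    · rw [Finset.not_disjoint_iff] at hd
      obtain ⟨p, hp, hp'⟩ := hd
      refine le_trans ?_ (Finset.le_sup hp)
      rw [upd, if_pos hp', hs]
      exact_mod_cast Nat.le_add_right _ _
  · obtain ⟨p, hp⟩ := W.post_nonempty t
    refine ⟨p, ?_⟩
    rw [upd, if_pos hp, hs]
    exact_mod_cast Nat.le_add_right _ _

theorem AbsReachable.exists_abstracts {W : TPWN P T} {γ : (P → WithBot ℕ) → Finset T}
    (hγ : W.EarliestFirst γ) {y : P → WithBot ℕ} (hy : W.AbsReachable γ y) :
    ∃ x τ, W.Abstracts x y τ := by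
  induction hy with
  | init => exact ⟨_, _, W.abstracts_init⟩
  | step y t _ ht ih =>
    obtain ⟨x, τ, h⟩ := ih
    exact ⟨_, _, h.step hγ ht⟩

theorem AbsReachable.sReach {W : TPWN P T} {γ : (P → WithBot ℕ) → Finset T}
    (hγ : W.EarliestFirst γ) {y : P → WithBot ℕ} (hy : W.AbsReachable γ y) :
    W.SReach (supp y) := by
  obtain ⟨x, τ, h⟩ := hy.exists_abstracts hγ
  exact h.supp_eq ▸ h.reach.sReach

theorem supp_absStep {W : TPWN P T} {y : P → WithBot ℕ} {t : T} (ht : W.pre t ⊆ supp y) :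
    supp (W.absStep y t) = W.fireSet (supp y) t := by
  rw [← supp_upd ht]
  exact supp_eq_of_map_sub fun p => rfl

omit [Fintype P] in
theorem AbsReachable.le_maxDur {W : TPWN P T} {γ : (P → WithBot ℕ) → Finset T}
    {y : P → WithBot ℕ} (hy : W.AbsReachable γ y) (p : P) : y p ≤ (W.maxDur : WithBot ℕ) := by
  induction hy with
  | init =>
    rw [timestampInit]
    split_ifs
    · exact_mod_cast Nat.zero_le _
    · exact bot_le
  | step y t _ ht ih =>
    rw [absStep, upd]
    split_ifs
    · have hd : W.dur t ≤ W.maxDur := Finset.le_sup (Finset.mem_univ t)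
      cases h : (W.pre t).sup y with
      | bot => exact bot_le
      | coe k =>
        change ((k + W.dur t - k : ℕ) : WithBot ℕ) ≤ _
        rw [Nat.add_sub_cancel_left]
        exact_mod_cast hd
    · exact bot_le
    · cases h : y p with
      | bot => exact bot_le
      | coe k =>
        rw [h] at ih
        change ((k - _ : ℕ) : WithBot ℕ) ≤ _
        exact le_trans (WithBot.coe_le_coe.2 (Nat.sub_le _ _)) ih

theorem finite_absReachable (W : TPWN P T) (γ : (P → WithBot ℕ) → Finset T) :
    {y | W.AbsReachable γ y}.Finite := by
  refine Set.Finite.subset (Set.Finite.pi' fun _ : P => Set.finite_Iic (W.maxDur : WithBot ℕ)) ?_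
  exact fun y hy p => hy.le_maxDur p

/-- The expected time until the final marking is reached, counted from the present time, on the
runs reaching it within `n` transitions. -/
def absVal (W : TPWN P T) (γ : (P → WithBot ℕ) → Finset T) : ℕ → (P → WithBot ℕ) → ℝ
  | 0, y => if supp y = {W.o} then maxEntry y else 0
  | n + 1, y => if supp y = {W.o} then maxEntry y else W.reward y * W.hit (n + 1) (supp y) +
      ∑ t ∈ γ y, W.pr (γ y) t * absVal W γ n (W.absStep y t)

theorem absVal_final {W : TPWN P T} {γ : (P → WithBot ℕ) → Finset T} {y : P → WithBot ℕ}
    (h : supp y = {W.o}) (n : ℕ) : W.absVal γ n y = maxEntry y := by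
  cases n <;> rw [absVal, if_pos h]

theorem EarliestFirst.eq_empty {W : TPWN P T} {γ : (P → WithBot ℕ) → Finset T}
    (hγ : W.EarliestFirst γ) {y : P → WithBot ℕ} (h : ¬ ∃ t, W.pre t ⊆ supp y) : γ y = ∅ := by
  rcases hγ y with ⟨-, h'⟩ | ⟨⟨t, ht, -⟩, -⟩
  · exact h'
  · exact absurd ⟨t, ht⟩ h

theorem EarliestFirst.mem_of_exists {W : TPWN P T} {γ : (P → WithBot ℕ) → Finset T}
    (hγ : W.EarliestFirst γ) {y : P → WithBot ℕ} (h : ∃ t, W.pre t ⊆ supp y) :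
    γ y ∈ W.conflictSets (supp y) := by
  rcases hγ y with ⟨h', -⟩ | ⟨h', -⟩
  · obtain ⟨t, ht⟩ := h
    have : W.conflictSet t (supp y) ∈ W.conflictSets (supp y) := ⟨t, ht, rfl⟩
    rw [h'] at this
    exact this.elim
  · exact h'

theorem Abstracts.val_eq_of_final {W : TPWN P T} (γ : (P → WithBot ℕ) → Finset T) (n : ℕ)
    {x y : P → WithBot ℕ} {τ : ℕ} (h : W.Abstracts x y τ) (hf : supp x = {W.o}) :
    W.val supp W.upd (fun x => (maxEntry x : ℝ)) n x =
      τ * W.hit n (supp x) + W.absVal γ n y := by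
  rw [val_final hf, absVal_final (h.supp_eq.trans hf), hf, hit_final, mul_one]
  obtain ⟨p, hp⟩ := h.le_max
  have h1 : (τ : WithBot ℕ) ≤ Finset.univ.sup x := hp.trans (Finset.le_sup (Finset.mem_univ p))
  rw [maxEntry, maxEntry, sup_map_sub h.eq]
  cases hm : Finset.univ.sup x with
  | bot => rw [hm] at h1; cases h1
  | coe k =>
    rw [hm] at h1
    have h2 : τ ≤ k := WithBot.coe_le_coe.1 h1
    change (k : ℝ) = τ + ((k - τ : ℕ) : ℝ)
    rw [Nat.cast_sub h2]
    ring

/-- The timed semantics and the abstraction agree after any number of steps. The reward `τ` collected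
before counts only for those continuations that reach the final marking, hence the factor `hit`. -/
theorem Abstracts.val_eq {W : TPWN P T} {γ : (P → WithBot ℕ) → Finset T}
    (hγ : W.EarliestFirst γ) (n : ℕ) {x y : P → WithBot ℕ} {τ : ℕ} (h : W.Abstracts x y τ) :
    W.val supp W.upd (fun x => (maxEntry x : ℝ)) n x =
      τ * W.hit n (supp x) + W.absVal γ n y := by
  by_cases hf : supp x = {W.o}
  · exact h.val_eq_of_final γ n hf
  induction n generalizing x y τ with
  | zero =>
    rw [val, if_neg hf, hit, val, if_neg (by exact hf), absVal, if_neg (h.supp_eq ▸ hf)]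
    ring
  | succ n ih =>
    rw [absVal, if_neg (h.supp_eq ▸ hf), h.supp_eq]
    by_cases he : ∃ t, W.pre t ⊆ supp x
    · have hC := hγ.mem_of_exists (y := y) (h.supp_eq.symm ▸ he)
      rw [h.supp_eq] at hC
      rw [val_succ W.isUnfolding_timestamp n h.reach.sReach hC, hit_succ h.reach.sReach hC]
      rw [← add_assoc, ← add_mul, Finset.mul_sum, ← Finset.sum_add_distrib]
      refine Finset.sum_congr rfl fun t ht => ?_
      have h' := h.step hγ ht
      have hte := pre_subset_of_mem hC ht
      have : W.val supp W.upd (fun x => (maxEntry x : ℝ)) n (W.upd x t) =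
          ((τ + W.reward y : ℕ) : ℝ) * W.hit n (supp (W.upd x t)) +
            W.absVal γ n (W.absStep y t) := by
        by_cases hf' : supp (W.upd x t) = {W.o}
        · exact h'.val_eq_of_final γ n hf'
        · exact ih h' hf'
      rw [this, supp_upd hte]
      push_cast
      ring
    · have hd : W.hit (n + 1) (supp x) = 0 := val_dead (sp := id) hf he _
      rw [val_dead hf he, hγ.eq_empty (y := y) (h.supp_eq.symm ▸ he), hd, Finset.sum_empty]
      ring

end TPWN

/-! ### The linear system -/

namespace TPWN

variable {P T : Type*} [Fintype P] [DecidableEq P] [Fintype T]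

theorem EarliestFirst.mem_of_sound {W : TPWN P T} (hs : W.Sound)
    {γ : (P → WithBot ℕ) → Finset T} (hγ : W.EarliestFirst γ) {y : P → WithBot ℕ}
    (hy : W.AbsReachable γ y) (hf : supp y ≠ {W.o}) : γ y ∈ W.conflictSets (supp y) := by
  refine hγ.mem_of_exists ?_
  by_contra h
  have h1 := hitLim_dead hf h
  rw [hitLim_eq_one hs (hy.sReach hγ)] at h1
  exact one_ne_zero h1

/-- The minimum principle: a function that dominates its averages and is nonnegative at the final
states is nonnegative, since the final states are reached almost surely. -/
theorem nonneg_of_superharmonic {W : TPWN P T} (hs : W.Sound) {γ : (P → WithBot ℕ) → Finset T}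
    (hγ : W.EarliestFirst γ) {Z : (P → WithBot ℕ) → ℝ}
    (h1 : ∀ y, W.AbsReachable γ y → supp y ≠ {W.o} →
      ∑ t ∈ γ y, W.pr (γ y) t * Z (W.absStep y t) ≤ Z y)
    (h2 : ∀ y, W.AbsReachable γ y → supp y = {W.o} → 0 ≤ Z y)
    {y : P → WithBot ℕ} (hy : W.AbsReachable γ y) : 0 ≤ Z y := by
  obtain ⟨c, hc⟩ := ((W.finite_absReachable γ).image Z).bddBelow
  have hc' : ∀ y, W.AbsReachable γ y → -|c| ≤ Z y := fun y hy =>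
    (neg_abs_le c).trans (hc ⟨y, hy, rfl⟩)
  have key : ∀ n y, W.AbsReachable γ y → -|c| * (1 - W.hit n (supp y)) ≤ Z y := by
    intro n
    induction n with
    | zero =>
      intro y hy
      by_cases hf : supp y = {W.o}
      · rw [hf, hit_final, sub_self, mul_zero]
        exact h2 y hy hf
      · rw [hit, val, if_neg (by exact hf), sub_zero, mul_one]
        exact hc' y hy
    | succ n ih =>
      intro y hy
      by_cases hf : supp y = {W.o}
      · rw [hf, hit_final, sub_self, mul_zero]
        exact h2 y hy hf
      · refine le_trans ?_ (h1 y hy hf)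
        have hC := hγ.mem_of_sound hs hy hf
        rw [hit_succ (hy.sReach hγ) hC, ← W.sum_pr (nonempty_of_mem_conflictSets hC),
          ← Finset.sum_sub_distrib, Finset.mul_sum]
        refine Finset.sum_le_sum fun t ht => ?_
        have := ih _ (AbsReachable.step y t hy ht)
        rw [supp_absStep (pre_subset_of_mem hC ht)] at this
        calc _ = W.pr (γ y) t * (-|c| * (1 - W.hit n (W.fireSet (supp y) t))) := by ring
          _ ≤ _ := mul_le_mul_of_nonneg_left this (W.pr_nonneg _ _)
  have hlim : Filter.Tendsto (fun n => -|c| * (1 - W.hit n (supp y))) Filter.atTop (nhds 0) := by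
    have := ((tendsto_const_nhds (x := (1 : ℝ))).sub (W.tendsto_hit (supp y))).const_mul (-|c|)
    rwa [hitLim_eq_one hs (hy.sReach hγ), sub_self, mul_zero] at this
  exact le_of_tendsto' hlim fun n => key n y hy

/-- The minimum principle applies to the difference of two solutions and to its negative. -/
theorem SolvesSystem.unique {W : TPWN P T} (hs : W.Sound) {γ : (P → WithBot ℕ) → Finset T}
    (hγ : W.EarliestFirst γ) {X Y : (P → WithBot ℕ) → ℝ} (hX : W.SolvesSystem γ X)
    (hY : W.SolvesSystem γ Y) {y : P → WithBot ℕ} (hy : W.AbsReachable γ y) : Y y = X y := by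
  have key : ∀ X Y : (P → WithBot ℕ) → ℝ, W.SolvesSystem γ X → W.SolvesSystem γ Y →
      0 ≤ Y y - X y := by
    intro X Y hX hY
    refine nonneg_of_superharmonic hs hγ (Z := fun y => Y y - X y) (fun y hy hf => ?_)
      (fun y hy hf => ?_) hy
    · rw [(hX y hy).1 hf, (hY y hy).1 hf, add_sub_add_left_eq_sub, ← Finset.sum_sub_distrib]
      exact (Finset.sum_congr rfl fun t _ => mul_sub _ _ _).le
    · rw [(hX y hy).2 hf, (hY y hy).2 hf, sub_self]
  exact le_antisymm (by linarith [key Y X hY hX]) (by linarith [key X Y hX hY])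

/-- The system has a rational solution, because its matrix is injective. -/
theorem exists_rat_solution {W : TPWN P T} (hs : W.Sound) {γ : (P → WithBot ℕ) → Finset T}
    (hγ : W.EarliestFirst γ) :
    ∃ X : (P → WithBot ℕ) → ℚ, W.SolvesSystem γ fun y => (X y : ℝ) := by
  classical
  let ι := {y // W.AbsReachable γ y}
  have : Finite ι := W.finite_absReachable γ
  let ext : (ι → ℚ) →ₗ[ℚ] ((P → WithBot ℕ) → ℚ) :=
    { toFun := fun X y => if h : W.AbsReachable γ y then X ⟨y, h⟩ else 0
      map_add' := fun X Y => by funext y; dsimp only [Pi.add_apply]; split_ifs <;> simp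
      map_smul' := fun a X => by
        funext y; dsimp only [Pi.smul_apply, RingHom.id_apply]; split_ifs <;> simp }
  have hext : ∀ (X : ι → ℚ) (y : ι), ext X y.1 = X y := fun X y => dif_pos y.2
  let L : (ι → ℚ) →ₗ[ℚ] (ι → ℚ) :=
    { toFun := fun X y => ext X y.1 - if supp y.1 = {W.o} then 0 else
        ∑ t ∈ γ y.1, W.w t / W.weight (γ y.1) * ext X (W.absStep y.1 t)
      map_add' := fun X Y => by
        funext y
        simp only [map_add, Pi.add_apply, mul_add, Finset.sum_add_distrib]
        split_ifs <;> ring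
      map_smul' := fun a X => by
        funext y
        simp only [map_smul, Pi.smul_apply, smul_eq_mul, RingHom.id_apply, mul_sub]
        split_ifs
        · ring
        · rw [Finset.mul_sum]
          congr 1
          exact Finset.sum_congr rfl fun t _ => by ring }
  have hinj : Function.Injective L := by
    rw [← LinearMap.ker_eq_bot, LinearMap.ker_eq_bot']
    intro X hX
    have hX' : ∀ y, W.AbsReachable γ y → ext X y = if supp y = {W.o} then 0 else
        ∑ t ∈ γ y, W.w t / W.weight (γ y) * ext X (W.absStep y t) := fun y hy =>
      sub_eq_zero.1 (congrFun hX ⟨y, hy⟩)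
    have h1 : ∀ y, W.AbsReachable γ y → supp y ≠ {W.o} →
        ((ext X y : ℚ) : ℝ) = ∑ t ∈ γ y, W.pr (γ y) t * ((ext X (W.absStep y t) : ℚ) : ℝ) := by
      intro y hy hf
      rw [hX' y hy, if_neg hf]
      push_cast [pr]
      rfl
    have h2 : ∀ y, W.AbsReachable γ y → supp y = {W.o} → ((ext X y : ℚ) : ℝ) = 0 := by
      intro y hy hf
      rw [hX' y hy, if_pos hf, Rat.cast_zero]
    funext y
    have h3 := nonneg_of_superharmonic hs hγ (Z := fun y => ((ext X y : ℚ) : ℝ))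
      (fun y hy hf => (h1 y hy hf).ge) (fun y hy hf => (h2 y hy hf).ge) y.2
    have h4 := nonneg_of_superharmonic hs hγ (Z := fun y => -((ext X y : ℚ) : ℝ))
      (fun y hy hf => by simp only [mul_neg, Finset.sum_neg_distrib]; rw [h1 y hy hf])
      (fun y hy hf => by rw [h2 y hy hf, neg_zero]) y.2
    have h5 : ((ext X y.1 : ℚ) : ℝ) = 0 := le_antisymm (by linarith) h3
    rw [hext] at h5
    exact_mod_cast h5
  obtain ⟨X, hX⟩ := LinearMap.injective_iff_surjective.1 hinj
    fun y => if supp y.1 = {W.o} then (maxEntry y.1 : ℚ) else W.reward y.1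
  refine ⟨ext X, fun y hy => ?_⟩
  have h := congrFun hX ⟨y, hy⟩
  change ext X y - _ = _ at h
  constructor
  · intro hf
    rw [if_neg hf, if_neg hf, sub_eq_iff_eq_add] at h
    dsimp only
    rw [h]
    push_cast
    rfl
  · intro hf
    rw [if_pos hf, if_pos hf, sub_zero] at h
    dsimp only
    rw [h, Rat.cast_natCast]

theorem absVal_mono {W : TPWN P T} (γ : (P → WithBot ℕ) → Finset T) (y : P → WithBot ℕ) :
    Monotone fun n => W.absVal γ n y := by
  refine monotone_nat_of_le_succ fun n => ?_
  induction n generalizing y with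
  | zero =>
    by_cases hf : supp y = {W.o}
    · rw [absVal_final hf, absVal_final hf]
    · rw [absVal, if_neg hf, absVal, if_neg hf]
      have : ∀ t, 0 ≤ W.absVal γ 0 (W.absStep y t) := fun t => by
        rw [absVal]; split_ifs <;> positivity
      exact add_nonneg (mul_nonneg (Nat.cast_nonneg _) (W.hit_nonneg _ _))
        (Finset.sum_nonneg fun t _ => mul_nonneg (W.pr_nonneg _ _) (this t))
  | succ n ih =>
    rw [absVal, absVal]
    split_ifs
    · exact le_rfl
    · gcongr with t
      · exact W.hit_mono _ (Nat.le_succ _)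
      · exact W.pr_nonneg _ _
      · exact ih _

theorem absVal_le {W : TPWN P T} (hs : W.Sound) {γ : (P → WithBot ℕ) → Finset T}
    (hγ : W.EarliestFirst γ) {X : (P → WithBot ℕ) → ℝ} (hX : W.SolvesSystem γ X) (n : ℕ)
    {y : P → WithBot ℕ} (hy : W.AbsReachable γ y) : W.absVal γ n y ≤ X y := by
  by_cases hf : supp y = {W.o}
  · rw [absVal_final hf, (hX y hy).2 hf]
  induction n generalizing y with
  | zero =>
    rw [absVal, if_neg hf]
    refine nonneg_of_superharmonic hs hγ (Z := X) (fun y hy hf => ?_) (fun y hy hf => ?_) hy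
    · rw [(hX y hy).1 hf]
      exact le_add_of_nonneg_left (Nat.cast_nonneg _)
    · rw [(hX y hy).2 hf]
      exact Nat.cast_nonneg _
  | succ n ih =>
    rw [absVal, if_neg hf, (hX y hy).1 hf]
    refine add_le_add ?_ (Finset.sum_le_sum fun t ht => ?_)
    · exact mul_le_of_le_one_right (Nat.cast_nonneg _) (W.hit_le_one _ _)
    · have hy' := AbsReachable.step y t hy ht
      refine mul_le_mul_of_nonneg_left ?_ (W.pr_nonneg _ _)
      by_cases hf' : supp (W.absStep y t) = {W.o}
      · rw [absVal_final hf', (hX _ hy').2 hf']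
      · exact ih hy' hf'

open Filter Topology in
/-- The values are bounded by `X`, and their limit is a solution itself, hence equal to `X`. -/
theorem tendsto_absVal {W : TPWN P T} (hs : W.Sound) {γ : (P → WithBot ℕ) → Finset T}
    (hγ : W.EarliestFirst γ) {X : (P → WithBot ℕ) → ℝ} (hX : W.SolvesSystem γ X)
    {y : P → WithBot ℕ} (hy : W.AbsReachable γ y) :
    Tendsto (fun n => W.absVal γ n y) atTop (𝓝 (X y)) := by
  have hlim : ∀ y, W.AbsReachable γ y →
      Tendsto (fun n => W.absVal γ n y) atTop (𝓝 (⨆ n, W.absVal γ n y)) := fun y hy =>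
    tendsto_atTop_ciSup (absVal_mono γ y)
      ⟨X y, by rintro _ ⟨n, rfl⟩; exact absVal_le hs hγ hX n hy⟩
  have hsol : W.SolvesSystem γ fun y => ⨆ n, W.absVal γ n y := by
    refine fun y hy => ⟨fun hf => ?_, fun hf => ?_⟩
    · refine tendsto_nhds_unique ((hlim y hy).comp (tendsto_add_atTop_nat 1)) ?_
      have e : (fun n => W.absVal γ n y) ∘ (fun a => a + 1) = fun n =>
          W.reward y * W.hit (n + 1) (supp y) +
            ∑ t ∈ γ y, W.pr (γ y) t * W.absVal γ n (W.absStep y t) := by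
        funext n
        rw [Function.comp_apply, absVal, if_neg hf]
      rw [e]
      refine Tendsto.add ?_ (tendsto_finsetSum _ fun t ht =>
        (hlim _ (AbsReachable.step y t hy ht)).const_mul _)
      have := ((W.tendsto_hit (supp y)).comp (tendsto_add_atTop_nat 1)).const_mul (W.reward y : ℝ)
      rwa [hitLim_eq_one hs (hy.sReach hγ), mul_one] at this
    · simp only [absVal_final hf, ciSup_const]
  rw [← SolvesSystem.unique hs hγ hX hsol hy]
  exact hlim y hy

/-- The value of the linear system at the initial state is the expected time. -/
theorem expectedTime_eq {W : TPWN P T} (hs : W.Sound) {γ : (P → WithBot ℕ) → Finset T}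
    (hγ : W.EarliestFirst γ) {X : (P → WithBot ℕ) → ℝ} (hX : W.SolvesSystem γ X)
    (S : W.mdp.Scheduler) : W.expectedTime S = ENNReal.ofReal (X W.timestampInit) := by
  refine expectedTime_of_sound hs ?_ S
  have h : ∀ n, W.val supp W.upd (fun x => (maxEntry x : ℝ)) n W.timestampInit =
      W.absVal γ n W.timestampInit := fun n => by
    rw [W.abstracts_init.val_eq hγ n, Nat.cast_zero, zero_mul, zero_add]
  simp only [h]
  exact tendsto_absVal hs hγ hX AbsReachable.init

theorem SolvesSystem.nonneg {W : TPWN P T} (hs : W.Sound) {γ : (P → WithBot ℕ) → Finset T}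
    (hγ : W.EarliestFirst γ) {X : (P → WithBot ℕ) → ℝ} (hX : W.SolvesSystem γ X)
    {y : P → WithBot ℕ} (hy : W.AbsReachable γ y) : 0 ≤ X y := by
  refine le_trans ?_ (absVal_le hs hγ hX 0 hy)
  rw [absVal]
  split_ifs <;> positivity

end TPWN

/-! ### Polynomial-time functions -/

namespace Complexity

/-- Types whose elements are represented by trees. -/
class Enc (α : Type) where
  /-- the tree representing an element -/
  enc : α → Data

open Enc

/-- The size of the tree representing an element. -/
def sz {α : Type} [Enc α] (a : α) : ℕ := (enc a).size

instance : Enc Data := ⟨id⟩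
instance : Enc Unit := ⟨fun _ => Data.nil⟩
instance : Enc Bool := ⟨Data.ofBool⟩
instance : Enc ℕ := ⟨Data.ofNat⟩
instance {α β : Type} [Enc α] [Enc β] : Enc (α × β) := ⟨fun p => Data.cons (enc p.1) (enc p.2)⟩
instance {α : Type} [Enc α] : Enc (List α) := ⟨fun l => Data.ofList (l.map enc)⟩

variable {α β γ δ : Type} [Enc α] [Enc β] [Enc γ] [Enc δ]

/-- Functions of the input that are bounded by a polynomial in the size of the input. -/
@[fun_prop]
def PB (u : α → ℕ) : Prop := ∃ k, ∀ a, u a ≤ (sz a + 1) ^ k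

/-- Functions computed in polynomial time, with results of polynomial size. In the present model
the second condition does not follow from the first one, since subtrees can be shared. -/
@[fun_prop]
def PT (f : α → β) : Prop :=
  ∃ (c : Prog) (k : ℕ), ∀ a, (∃ n, Runs c (enc a) (enc (f a)) n ∧ n ≤ (sz a + 1) ^ k) ∧
    sz (f a) ≤ (sz a + 1) ^ k

theorem _root_.Data.size_pos (d : Data) : 0 < d.size := by
  cases d <;> simp [Data.size]

theorem sz_pos (a : α) : 0 < sz a := Data.size_pos _

theorem two_le_sz (a : α) : 2 ≤ sz a + 1 := Nat.succ_le_succ (sz_pos a)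

theorem pow_mono_sz (a : α) {j k : ℕ} (h : j ≤ k) : (sz a + 1) ^ j ≤ (sz a + 1) ^ k :=
  Nat.pow_le_pow_right (Nat.succ_pos _) h

theorem PB.mono {u v : α → ℕ} (hv : PB v) (h : ∀ a, u a ≤ v a) : PB u := by
  obtain ⟨k, hk⟩ := hv
  exact ⟨k, fun a => (h a).trans (hk a)⟩

theorem PB.id : PB fun a : α => sz a := ⟨1, fun a => by rw [pow_one]; exact Nat.le_succ _⟩

@[fun_prop]
theorem PB.const (c : ℕ) : PB fun _ : α => c := by
  refine ⟨c, fun a => ?_⟩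
  calc c ≤ 2 ^ c := Nat.lt_two_pow_self.le
    _ ≤ _ := Nat.pow_le_pow_left (two_le_sz a) _

@[fun_prop]
theorem PB.add {u v : α → ℕ} (hu : PB u) (hv : PB v) : PB fun a => u a + v a := by
  obtain ⟨j, hj⟩ := hu
  obtain ⟨k, hk⟩ := hv
  refine ⟨max j k + 1, fun a => ?_⟩
  have h1 := (hj a).trans (pow_mono_sz a (le_max_left j k))
  have h2 := (hk a).trans (pow_mono_sz a (le_max_right j k))
  calc u a + v a ≤ (sz a + 1) ^ max j k * 2 := by omega
    _ ≤ _ := by rw [pow_succ]; exact Nat.mul_le_mul_left _ (two_le_sz a)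

@[fun_prop]
theorem PB.mul {u v : α → ℕ} (hu : PB u) (hv : PB v) : PB fun a => u a * v a := by
  obtain ⟨j, hj⟩ := hu
  obtain ⟨k, hk⟩ := hv
  exact ⟨j + k, fun a => by rw [pow_add]; exact Nat.mul_le_mul (hj a) (hk a)⟩

@[fun_prop]
theorem PB.pow {u : α → ℕ} (hu : PB u) (k : ℕ) : PB fun a => u a ^ k := by
  induction k with
  | zero => simpa using PB.const 1
  | succ k ih => simpa only [pow_succ] using ih.mul hu

@[fun_prop]
theorem PT.pb {f : α → β} (hf : PT f) : PB fun a => sz (f a) := by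
  obtain ⟨c, k, h⟩ := hf
  exact ⟨k, fun a => (h a).2⟩

theorem PB.comp {u : β → ℕ} {f : α → β} (hu : PB u) (hf : PT f) : PB fun a => u (f a) := by
  obtain ⟨k, hk⟩ := hu
  exact ((hf.pb.add (PB.const 1)).pow k).mono fun a => hk (f a)

/-- A program witnesses that a function is computable in polynomial time. -/
theorem PT.intro {f : α → β} (c : Prog) {u : α → ℕ} (hu : PB u)
    (hc : ∀ a, ∃ n, Runs c (enc a) (enc (f a)) n ∧ n ≤ u a) (hs : PB fun a => sz (f a)) :
    PT f := by
  obtain ⟨j, hj⟩ := hu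
  obtain ⟨k, hk⟩ := hs
  refine ⟨c, max j k, fun a => ⟨?_, (hk a).trans (pow_mono_sz a (le_max_right j k))⟩⟩
  obtain ⟨n, h1, h2⟩ := hc a
  exact ⟨n, h1, (h2.trans (hj a)).trans (pow_mono_sz a (le_max_left j k))⟩

theorem PT.exists_runs {f : α → β} (hf : PT f) : ∃ (c : Prog) (u : α → ℕ), PB u ∧
    ∀ a, ∃ n, Runs c (enc a) (enc (f a)) n ∧ n ≤ u a := by
  obtain ⟨c, k, h⟩ := hf
  exact ⟨c, _, ⟨k, fun a => le_rfl⟩, fun a => (h a).1⟩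

/-- The program with a given constant result. -/
def _root_.Prog.const : Data → Prog
  | Data.nil => Prog.nil
  | Data.cons a b => Prog.cons (Prog.const a) (Prog.const b)

theorem runs_const (d x : Data) : Runs (Prog.const d) x d d.size := by
  induction d with
  | nil => exact Runs.nil x
  | cons a b iha ihb => exact Runs.cons iha ihb

@[fun_prop]
theorem PT.id : PT fun a : α => a :=
  PT.intro Prog.id (PB.const 1) (fun _ => ⟨1, Runs.id _, le_rfl⟩) PB.id

@[fun_prop]
theorem PT.const (b : β) : PT fun _ : α => b :=
  PT.intro (Prog.const (enc b)) (PB.const (enc b).size)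
    (fun _ => ⟨_, runs_const _ _, le_rfl⟩) (PB.const _)

@[fun_prop]
theorem PT.comp {g : β → γ} {f : α → β} (hg : PT g) (hf : PT f) : PT fun a => g (f a) := by
  obtain ⟨c, u, hu, hc⟩ := hf.exists_runs
  obtain ⟨d, v, hv, hd⟩ := hg.exists_runs
  refine PT.intro (Prog.seq c d) ((hu.add (hv.comp hf)).add (PB.const 1)) (fun a => ?_)
    (hg.pb.comp hf)
  obtain ⟨n, h1, h2⟩ := hc a
  obtain ⟨m, h3, h4⟩ := hd (f a)
  exact ⟨_, Runs.seq h1 h3, by omega⟩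

theorem sz_prod (p : α × β) : sz p = sz p.1 + sz p.2 + 1 := rfl

@[fun_prop]
theorem PT.prodMk {f : α → β} {g : α → γ} (hf : PT f) (hg : PT g) : PT fun a => (f a, g a) := by
  obtain ⟨c, u, hu, hc⟩ := hf.exists_runs
  obtain ⟨d, v, hv, hd⟩ := hg.exists_runs
  refine PT.intro (Prog.cons c d) ((hu.add hv).add (PB.const 1)) (fun a => ?_)
    ((hf.pb.add hg.pb).add (PB.const 1))
  obtain ⟨n, h1, h2⟩ := hc a
  obtain ⟨m, h3, h4⟩ := hd a
  exact ⟨_, Runs.cons h1 h3, by omega⟩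

theorem PT.fst' : PT fun p : α × β => p.1 :=
  PT.intro Prog.hd (PB.const 1) (fun _ => ⟨1, Runs.hd _, le_rfl⟩)
    (PB.id.mono fun p => by rw [sz_prod]; omega)

theorem PT.snd' : PT fun p : α × β => p.2 :=
  PT.intro Prog.tl (PB.const 1) (fun _ => ⟨1, Runs.tl _, le_rfl⟩)
    (PB.id.mono fun p => by rw [sz_prod]; omega)

@[fun_prop]
theorem PT.fst {f : α → β × γ} (hf : PT f) : PT fun a => (f a).1 := PT.fst'.comp hf

@[fun_prop]
theorem PT.snd {f : α → β × γ} (hf : PT f) : PT fun a => (f a).2 := PT.snd'.comp hf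

theorem PT.of_enc_eq {f : α → β} {g : α → γ} (hf : PT f) (h : ∀ a, enc (g a) = enc (f a)) :
    PT g := by
  obtain ⟨c, k, hc⟩ := hf
  refine ⟨c, k, fun a => ?_⟩
  have e : sz (g a) = sz (f a) := congrArg Data.size (h a)
  rw [e, h a]
  exact hc a

@[fun_prop]
theorem PT.cond {b : α → Bool} {f g : α → β} (hb : PT b) (hf : PT f) (hg : PT g) :
    PT fun a => bif b a then f a else g a := by
  obtain ⟨c, u, hu, hc⟩ := hb.exists_runs
  obtain ⟨d, v, hv, hd⟩ := hf.exists_runs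
  obtain ⟨e, w, hw, he⟩ := hg.exists_runs
  refine PT.intro (Prog.ite c d e) ((hu.add (hv.add hw)).add (PB.const 1)) (fun a => ?_)
    ((hf.pb.add hg.pb).mono fun a => by cases b a <;> simp)
  obtain ⟨n, h1, h2⟩ := hc a
  obtain ⟨m, h3, h4⟩ := hd a
  obtain ⟨k, h5, h6⟩ := he a
  cases hba : b a
  · rw [hba] at h1
    exact ⟨_, Runs.ite_false h1 h5, by omega⟩
  · rw [hba] at h1
    exact ⟨_, Runs.ite_true h1 h3, by omega⟩

@[fun_prop]
theorem PT.not {b : α → Bool} (hb : PT b) : PT fun a => !b a :=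
  (hb.cond (PT.const false) (PT.const true)).of_enc_eq fun a => by cases b a <;> rfl

@[fun_prop]
theorem PT.and {b c : α → Bool} (hb : PT b) (hc : PT c) : PT fun a => b a && c a :=
  (hb.cond hc (PT.const false)).of_enc_eq fun a => by cases b a <;> rfl

@[fun_prop]
theorem PT.or {b c : α → Bool} (hb : PT b) (hc : PT c) : PT fun a => b a || c a :=
  (hb.cond (PT.const true) hc).of_enc_eq fun a => by cases b a <;> rfl

@[fun_prop]
theorem PT.xor {b c : α → Bool} (hb : PT b) (hc : PT c) : PT fun a => xor (b a) (c a) :=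
  (hb.cond hc.not hc).of_enc_eq fun a => by cases b a <;> cases c a <;> rfl

/-! ### Lists -/

theorem sz_cons (a : α) (l : List α) : sz (a :: l) = sz a + sz l + 1 := rfl

theorem sz_nil : sz ([] : List α) = 1 := rfl

theorem sz_append (l l' : List α) : sz (l ++ l') + 1 = sz l + sz l' := by
  induction l with
  | nil => rw [List.nil_append, sz_nil, add_comm]
  | cons a l ih => rw [List.cons_append, sz_cons, sz_cons]; omega

theorem sz_reverse (l : List α) : sz l.reverse = sz l := by
  induction l with
  | nil => rfl
  | cons a l ih =>
    have := sz_append l.reverse [a]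
    rw [List.reverse_cons, sz_cons]
    rw [sz_cons, sz_nil] at this
    omega

theorem sz_mem {a : α} {l : List α} (h : a ∈ l) : sz a < sz l := by
  induction l with
  | nil => cases h
  | cons b l ih =>
    rw [sz_cons]
    rcases List.mem_cons.1 h with rfl | h
    · omega
    · have := ih h
      omega

theorem length_lt_sz (l : List α) : l.length < sz l := by
  induction l with
  | nil => exact Nat.one_pos
  | cons a l ih => rw [sz_cons, List.length_cons]; omega

theorem sz_le_of_forall {l : List α} {m : ℕ} (h : ∀ a ∈ l, sz a ≤ m) :
    sz l ≤ l.length * (m + 1) + 1 := by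
  induction l with
  | nil => rw [sz_nil]; omega
  | cons a l ih =>
    have h1 := h a List.mem_cons_self
    have h2 := ih fun b hb => h b (List.mem_cons_of_mem _ hb)
    rw [sz_cons, List.length_cons, Nat.succ_mul]
    omega

theorem sz_sublist {l l' : List α} (h : l.Sublist l') : sz l ≤ sz l' := by
  induction h with
  | slnil => exact le_rfl
  | cons a _ ih => rw [sz_cons]; omega
  | cons_cons a _ ih => rw [sz_cons, sz_cons]; omega

@[fun_prop]
theorem PT.cons {f : γ → α} {l : γ → List α} (hf : PT f) (hl : PT l) :
    PT fun c => f c :: l c := (hf.prodMk hl).of_enc_eq fun _ => rfl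

@[fun_prop]
theorem PT.tail {l : γ → List α} (hl : PT l) : PT fun c => (l c).tail := by
  have : PT fun l : List α => l.tail :=
    PT.intro Prog.tl (PB.const 1) (fun l => ⟨1, by cases l <;> exact Runs.tl _, le_rfl⟩)
      (PB.id.mono fun l => by cases l <;> simp [sz_cons]; omega)
  exact this.comp hl

@[fun_prop]
theorem PT.isEmpty {l : γ → List α} (hl : PT l) : PT fun c => (l c).isEmpty := by
  have : PT fun l : List α => l.isEmpty :=
    PT.intro (Prog.ite Prog.id Prog.nil (Prog.const (enc true))) (PB.const 5) (fun l => by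
      cases l
      · exact ⟨_, Runs.ite_false (Runs.id _) (runs_const _ _), le_rfl⟩
      · exact ⟨_, Runs.ite_true (Runs.id _) (Runs.nil _), by omega⟩)
      ((PB.const 3).mono fun l => by cases l <;> simp [sz, enc, Data.ofBool, Data.size])
  exact this.comp hl

@[fun_prop]
theorem PT.headD {l : γ → List α} {d : γ → α} (hl : PT l) (hd : PT d) :
    PT fun c => (l c).headD (d c) := by
  have : PT fun p : List α × α => p.1.headD p.2 :=
    PT.intro (Prog.ite Prog.hd (Prog.seq Prog.hd Prog.hd) Prog.tl) (PB.const 5) (fun p => by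
      obtain ⟨l, d⟩ := p
      cases l
      · exact ⟨_, Runs.ite_false (Runs.hd _) (Runs.tl _), by omega⟩
      · exact ⟨_, Runs.ite_true (Runs.hd _) (Runs.seq (Runs.hd _) (Runs.hd _)), by omega⟩)
      (PB.id.mono fun p => by
        obtain ⟨l, d⟩ := p
        cases l <;> simp only [sz_prod, sz_cons, List.headD_nil, List.headD_cons] <;> omega)
  exact this.comp (hl.prodMk hd)

theorem sz_replicate_unit (n : ℕ) : sz (List.replicate n ()) = 2 * n + 1 := by
  induction n with
  | zero => rfl
  | succ n ih =>
    have : sz () = 1 := rfl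
    rw [List.replicate_succ, sz_cons, ih, this]
    omega

/-- A bound on the size of the intermediate results of an iteration over a list yields a bound on
the running time. -/
theorem PT.exists_runs_foldl {l : γ → List α} {b : γ → β} {s : γ → β → α → β} (hl : PT l)
    (hb : PT b) (hs : PT fun p : γ × β × α => s p.1 p.2.1 p.2.2) :
    ∃ (prog : Prog) (k : ℕ), ∀ c B, (∀ l₁ l₂, l c = l₁ ++ l₂ → sz (l₁.foldl (s c) (b c)) ≤ B) →
      ∃ n, Runs prog (enc c) (enc ((l c).foldl (s c) (b c))) n ∧ n ≤ (sz c + B + 2) ^ k := by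
  obtain ⟨cl, ul, hul, hcl⟩ := hl.exists_runs
  obtain ⟨cb, ub, hub, hcb⟩ := hb.exists_runs
  obtain ⟨cs, us, ⟨k, hk⟩, hcs⟩ := hs.exists_runs
  let arg := Prog.cons (Prog.seq Prog.tl Prog.tl)
    (Prog.cons (Prog.seq Prog.tl Prog.hd) (Prog.seq Prog.hd Prog.hd))
  let body := Prog.cons (Prog.seq Prog.hd Prog.tl)
    (Prog.cons (Prog.seq arg cs) (Prog.seq Prog.tl Prog.tl))
  have hloop : ∀ (c : γ) (B : ℕ) (l : List α) (b : β),
      (∀ l₁ a l₂, l = l₁ ++ a :: l₂ → us (c, l₁.foldl (s c) b, a) ≤ B) →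
      ∃ n, Runs (Prog.loop Prog.hd body) (Data.cons (enc l) (Data.cons (enc b) (enc c)))
        (Data.cons (enc ([] : List α)) (Data.cons (enc (l.foldl (s c) b)) (enc c))) n ∧
        n ≤ l.length * (B + 30) + 2 := by
    intro c B l
    induction l with
    | nil => exact fun b _ => ⟨_, Runs.loop_stop (Runs.hd _), by omega⟩
    | cons a l ih =>
      intro b hB
      obtain ⟨m, hm1, hm2⟩ := ih (s c b a) fun l₁ a' l₂ hl => hB (a :: l₁) a' l₂ (by rw [hl]; rfl)
      have h0 := hB [] a l rfl
      obtain ⟨n, hn1, hn2⟩ := hcs (c, b, a)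
      have harg : Runs arg (Data.cons (enc (a :: l)) (Data.cons (enc b) (enc c)))
          (enc (c, b, a)) 11 :=
        Runs.cons (Runs.seq (Runs.tl _) (Runs.tl _))
          (Runs.cons (Runs.seq (Runs.tl _) (Runs.hd _)) (Runs.seq (Runs.hd _) (Runs.hd _)))
      have hbody : Runs body (Data.cons (enc (a :: l)) (Data.cons (enc b) (enc c)))
          (Data.cons (enc l) (Data.cons (enc (s c b a)) (enc c))) _ :=
        Runs.cons (Runs.seq (Runs.hd _) (Runs.tl _))
          (Runs.cons (Runs.seq harg hn1) (Runs.seq (Runs.tl _) (Runs.tl _)))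
      refine ⟨_, Runs.loop_step (Runs.hd _) hbody hm1, ?_⟩
      rw [List.length_cons, Nat.succ_mul]
      have : us (c, b, a) ≤ B := h0
      omega
  -- a polynomial in the bound, expressed as a polynomial in the size of a pair
  have hlq : PB fun q : γ × List Unit => sz (l q.1) := (hl.comp PT.fst').pb
  have hulq : PB fun q : γ × List Unit => ul q.1 := hul.comp PT.fst'
  have hubq : PB fun q : γ × List Unit => ub q.1 := hub.comp PT.fst'
  have hcq : PB fun q : γ × List Unit => sz q.1 := PT.fst'.pb
  have hBq : PB fun q : γ × List Unit => sz q.2 := PT.snd'.pb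
  have hq : PB fun q : γ × List Unit => ul q.1 + ub q.1 + sz (l q.1) *
      ((sz q.1 + sz q.2 + sz (l q.1) + 3) ^ k + 30) + 20 :=
    ((hulq.add hubq).add (hlq.mul (((((hcq.add hBq).add hlq).add (PB.const 3)).pow k).add
      (PB.const 30)))).add (PB.const 20)
  obtain ⟨j, hj⟩ := hq
  refine ⟨Prog.seq (Prog.seq (Prog.cons cl (Prog.cons cb Prog.id)) (Prog.loop Prog.hd body))
      (Prog.seq Prog.tl Prog.hd), 2 * j, fun c B h => ?_⟩
  have hpad : sz (List.replicate B ()) = 2 * B + 1 :=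
    sz_replicate_unit B
  obtain ⟨n₁, h1, h1'⟩ := hcl c
  obtain ⟨n₂, h2, h2'⟩ := hcb c
  obtain ⟨n₃, h3, h3'⟩ := hloop c ((sz c + (2 * B + 1) + sz (l c) + 3) ^ k) (l c) (b c) (by
    intro l₁ a l₂ hl
    refine (hk _).trans (Nat.pow_le_pow_left ?_ k)
    have e1 := h l₁ (a :: l₂) hl
    have e2 : sz a < sz (l c) := sz_mem (by rw [hl]; simp)
    rw [sz_prod, sz_prod]
    dsimp only
    omega)
  refine ⟨_, Runs.seq (Runs.seq (Runs.cons h1 (Runs.cons h2 (Runs.id _))) h3)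
    (Runs.seq (Runs.tl _) (Runs.hd _)), ?_⟩
  have e3 := Nat.mul_le_mul_right ((sz c + (2 * B + 1) + sz (l c) + 3) ^ k + 30)
    (length_lt_sz (l c)).le
  have e4 := hj (c, List.replicate B ())
  rw [sz_prod] at e4
  dsimp only at e4
  rw [hpad] at e4
  have e5 : (sz c + (2 * B + 1) + 1 + 1) ^ j ≤ (sz c + B + 2) ^ (2 * j) := by
    rw [pow_mul]
    refine Nat.pow_le_pow_left ?_ j
    have := sz_pos c
    nlinarith
  omega

/-- Iterating over a list is possible in polynomial time if the intermediate results have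
polynomial size. -/
theorem PT.foldl {l : γ → List α} {b : γ → β} {s : γ → β → α → β} (hl : PT l) (hb : PT b)
    (hs : PT fun p : γ × β × α => s p.1 p.2.1 p.2.2) {u : γ → ℕ} (hu : PB u)
    (h : ∀ c l₁ l₂, l c = l₁ ++ l₂ → sz (l₁.foldl (s c) (b c)) ≤ u c) :
    PT fun c => (l c).foldl (s c) (b c) := by
  obtain ⟨prog, k, hp⟩ := PT.exists_runs_foldl hl hb hs
  exact PT.intro prog (((PB.id.add hu).add (PB.const 2)).pow k) (fun c => hp c (u c) (h c))
    (hu.mono fun c => h c (l c) [] (by rw [List.append_nil]))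

theorem PT.foldl_of_bounded {l : γ → List α} {b : γ → β} {s : γ → β → α → β} (hl : PT l)
    (hb : PT b) (hs : PT fun p : γ × β × α => s p.1 p.2.1 p.2.2) {m : ℕ} (h : ∀ b : β, sz b ≤ m) :
    PT fun c => (l c).foldl (s c) (b c) :=
  PT.foldl hl hb hs (PB.const m) fun _ _ _ _ => h _

theorem sz_bool (b : Bool) : sz b ≤ 3 := by
  cases b <;> simp [sz, enc, Data.ofBool, Data.size]

omit [Enc α] in
theorem foldl_and (l : List α) (f : α → Bool) (b : Bool) :
    l.foldl (fun r a => r && f a) b = (b && l.all f) := by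
  induction l generalizing b with
  | nil => simp
  | cons a l ih => rw [List.foldl_cons, ih, List.all_cons, Bool.and_assoc]

@[fun_prop]
theorem PT.all {l : γ → List α} {f : γ → α → Bool} (hl : PT l)
    (hf : PT fun p : γ × α => f p.1 p.2) : PT fun c => (l c).all (f c) := by
  have hf' : PT fun p : γ × Bool × α => p.2.1 && f p.1 p.2.2 :=
    PT.and (by fun_prop) (hf.comp (f := fun p : γ × Bool × α => (p.1, p.2.2)) (by fun_prop))
  refine (PT.foldl_of_bounded (s := fun c r a => r && f c a) hl (PT.const true) hf' sz_bool).of_enc_eq fun c => ?_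
  rw [foldl_and, Bool.true_and]

@[fun_prop]
theorem PT.any {l : γ → List α} {f : γ → α → Bool} (hl : PT l)
    (hf : PT fun p : γ × α => f p.1 p.2) : PT fun c => (l c).any (f c) := by
  refine (PT.all (f := fun c a => !f c a) hl hf.not).not.of_enc_eq fun c => ?_
  rw [List.not_all_eq_any_not]
  simp

omit [Enc α] in
theorem foldl_cons_eq (l l' : List α) : l.foldl (fun r a => a :: r) l' = l.reverse ++ l' := by
  induction l generalizing l' with
  | nil => rfl
  | cons a l ih => rw [List.foldl_cons, ih]; simp

theorem PT.reverseAppend {l l' : γ → List α} (hl : PT l) (hl' : PT l') :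
    PT fun c => (l c).reverse ++ l' c := by
  have hs : PT fun p : γ × List α × α => p.2.2 :: p.2.1 := by fun_prop
  refine (PT.foldl (s := fun _ r a => a :: r) hl hl' hs (hl.pb.add hl'.pb) ?_).of_enc_eq
    fun c => by rw [foldl_cons_eq]
  intro c l₁ l₂ h
  rw [foldl_cons_eq]
  have h1 := sz_append l₁.reverse (l' c)
  have h2 := sz_append l₁ l₂
  have h3 := sz_pos l₂
  rw [h]
  rw [sz_reverse] at h1
  omega

@[fun_prop]
theorem PT.reverse {l : γ → List α} (hl : PT l) : PT fun c => (l c).reverse :=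
  (hl.reverseAppend (PT.const [])).of_enc_eq fun c => by rw [List.append_nil]

@[fun_prop]
theorem PT.append {l l' : γ → List α} (hl : PT l) (hl' : PT l') : PT fun c => l c ++ l' c :=
  (hl.reverse.reverseAppend hl').of_enc_eq fun c => by rw [List.reverse_reverse]

omit [Enc α] [Enc β] in
theorem foldl_reverse_append_eq (f : α → List β) (l : List α) (l' : List β) :
    l.foldl (fun r a => (f a).reverse ++ r) l' = (l.flatMap f).reverse ++ l' := by
  induction l generalizing l' with
  | nil => rfl
  | cons a l ih => rw [List.foldl_cons, ih]; simp

@[fun_prop]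
theorem PT.flatMap {l : γ → List α} {f : γ → α → List β} (hl : PT l)
    (hf : PT fun p : γ × α => f p.1 p.2) : PT fun c => (l c).flatMap (f c) := by
  have hf' : PT fun p : γ × List β × α => (f p.1 p.2.2).reverse ++ p.2.1 :=
    PT.append (PT.reverse (hf.comp (f := fun p : γ × List β × α => (p.1, p.2.2)) (by fun_prop)))
      (by fun_prop)
  obtain ⟨k, hk⟩ := hf.pb
  have hB : PB fun c : γ => sz (l c) * ((sz c + sz (l c) + 2) ^ k) + 1 :=
    ((hl.pb.mul (((PB.id.add hl.pb).add (PB.const 2)).pow k)).add (PB.const 1))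
  have key : ∀ (c : γ) (l₁ : List α), (∀ a ∈ l₁, a ∈ l c) →
      sz (l₁.flatMap (f c)) ≤ l₁.length * ((sz c + sz (l c) + 2) ^ k) + 1 := by
    intro c l₁
    induction l₁ with
    | nil => intro _; rw [List.flatMap_nil, sz_nil]; omega
    | cons a l₁ ih =>
      intro h
      have h1 := ih fun b hb => h b (List.mem_cons_of_mem _ hb)
      have h2 := sz_append (f c a) (l₁.flatMap (f c))
      have h3 := hk (c, a)
      have h4 : (sz (c, a) + 1) ^ k ≤ (sz c + sz (l c) + 2) ^ k := by
        refine Nat.pow_le_pow_left ?_ k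
        have := sz_mem (h a List.mem_cons_self)
        rw [sz_prod]
        dsimp only
        omega
      rw [List.flatMap_cons, List.length_cons, Nat.succ_mul]
      dsimp only at h3
      omega
  refine (PT.foldl (s := fun c r a => (f c a).reverse ++ r) hl (PT.const []) hf' hB
    ?_).reverse.of_enc_eq fun c => ?_
  · intro c l₁ l₂ h
    rw [foldl_reverse_append_eq, List.append_nil, sz_reverse]
    refine (key c l₁ fun a ha => by rw [h]; exact List.mem_append_left _ ha).trans ?_
    refine Nat.succ_le_succ (Nat.mul_le_mul_right _ ?_)
    have := length_lt_sz (l c)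
    rw [h, List.length_append] at this
    rw [h]
    omega
  · rw [foldl_reverse_append_eq, List.append_nil, List.reverse_reverse]

@[fun_prop]
theorem PT.map {l : γ → List α} {f : γ → α → β} (hl : PT l)
    (hf : PT fun p : γ × α => f p.1 p.2) : PT fun c => (l c).map (f c) :=
  (PT.flatMap (f := fun c a => [f c a]) hl (hf.cons (PT.const []))).of_enc_eq fun c => by
    rw [List.map_eq_flatMap]

@[fun_prop]
theorem PT.filter {l : γ → List α} {f : γ → α → Bool} (hl : PT l)
    (hf : PT fun p : γ × α => f p.1 p.2) : PT fun c => (l c).filter (f c) :=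
  (PT.flatMap (f := fun c a => bif f c a then [a] else []) hl
    (hf.cond (by fun_prop) (PT.const []))).of_enc_eq fun c => by
      congr 1
      induction l c with
      | nil => rfl
      | cons a l ih => cases h : f c a <;> simp [h, ih]

end Complexity

/-! ### Binary arithmetic in polynomial time -/

namespace Complexity

open Enc

variable {α β γ δ : Type} [Enc α] [Enc β] [Enc γ] [Enc δ]

theorem PT.congr {f g : α → β} (hf : PT f) (h : ∀ a, g a = f a) : PT g := (funext h : g = f) ▸ hf

theorem enc_bit {b : Bool} {n : ℕ} (h : n = 0 → b = true) :
    enc (Nat.bit b n) = Data.cons (enc b) (enc n) := by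
  change Data.ofList ((Nat.bit b n).bits.map _) = _
  rw [Nat.bits_append_bit n b h]
  rfl

theorem enc_zero : enc (0 : ℕ) = Data.nil := by
  change Data.ofList ((0 : ℕ).bits.map Data.ofBool) = _
  rw [Nat.zero_bits]
  rfl

theorem nat_bit_cases {p : ℕ → Prop} (h0 : p 0)
    (hb : ∀ b n, (n = 0 → b = true) → p (Nat.bit b n)) (n : ℕ) : p n := by
  by_cases h : n = 0
  · rw [h]; exact h0
  · have e := Nat.bit_bodd_div2 n
    rw [← e]
    refine hb _ _ fun h' => ?_
    rw [h'] at e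
    cases hb : n.bodd
    · rw [hb] at e
      exact absurd e.symm h
    · rfl

theorem sz_zero : sz (0 : ℕ) = 1 := by rw [sz, enc_zero]; rfl

theorem sz_bit_le (b : Bool) (n : ℕ) : sz (Nat.bit b n) ≤ sz n + 4 := by
  by_cases h : n = 0 → b = true
  · have := sz_bool b
    rw [sz, enc_bit h]
    change sz b + sz n + 1 ≤ _
    omega
  · push Not at h
    obtain ⟨rfl, h⟩ := h
    cases b
    · rw [show Nat.bit false 0 = 0 from rfl]; omega
    · exact absurd rfl h

theorem le_sz_bit (b : Bool) (n : ℕ) : sz n ≤ sz (Nat.bit b n) := by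
  by_cases h : n = 0 → b = true
  · have := sz_pos b
    have e : sz (Nat.bit b n) = sz b + sz n + 1 := by rw [sz, enc_bit h]; rfl
    omega
  · push Not at h
    obtain ⟨rfl, h⟩ := h
    rw [sz_zero]
    exact sz_pos _

theorem sz_le_size (n : ℕ) : sz n ≤ 4 * Nat.size n + 1 := by
  induction n using Nat.binaryRec' with
  | zero => rw [sz_zero]; omega
  | bit b n h ih =>
    have h1 := sz_bit_le b n
    rw [Nat.size_bit]
    · omega
    · intro h0
      rw [Nat.bit_eq_zero_iff] at h0
      have := h h0.1
      simp [h0.2] at this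

theorem size_le_sz (n : ℕ) : Nat.size n ≤ sz n := by
  induction n using Nat.binaryRec' with
  | zero => rw [Nat.size_zero]; omega
  | bit b n h ih =>
    have h1 := sz_pos b
    have e : sz (Nat.bit b n) = sz b + sz n + 1 := by rw [sz, enc_bit h]; rfl
    rw [Nat.size_bit]
    · omega
    · intro h0
      rw [Nat.bit_eq_zero_iff] at h0
      have := h h0.1
      simp [h0.2] at this

theorem sz_mono_nat {m n : ℕ} (h : m ≤ n) : sz m ≤ 4 * sz n + 1 :=
  (sz_le_size m).trans (by have := Nat.size_le_size h; have := size_le_sz n; omega)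

theorem lt_two_pow_sz (n : ℕ) : n < 2 ^ sz n :=
  Nat.size_le.1 (size_le_sz n)

theorem sz_le_of_lt_two_pow {n k : ℕ} (h : n < 2 ^ k) : sz n ≤ 4 * k + 1 :=
  (sz_le_size n).trans (by have := Nat.size_le.2 h; omega)

@[fun_prop]
theorem PT.encode {f : γ → α} (hf : PT f) : PT fun c => enc (f c) := hf.of_enc_eq fun _ => rfl

@[fun_prop]
theorem PT.bodd {f : γ → ℕ} (hf : PT f) : PT fun c => (f c).bodd := by
  have : PT fun n : ℕ => n.bodd := PT.intro Prog.hd (PB.const 1) (fun n => ⟨1, by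
    have : (enc n).hd = enc n.bodd := by
      induction n using nat_bit_cases with
      | h0 => rw [enc_zero]; rfl
      | hb b n h => rw [enc_bit h, Nat.bodd_bit]; rfl
    rw [← this]
    exact Runs.hd _, le_rfl⟩) ((PB.const 3).mono fun _ => sz_bool _)
  exact this.comp hf

@[fun_prop]
theorem PT.div2 {f : γ → ℕ} (hf : PT f) : PT fun c => (f c).div2 := by
  have : PT fun n : ℕ => n.div2 := PT.intro Prog.tl (PB.const 1) (fun n => ⟨1, by
    have : (enc n).tl = enc n.div2 := by
      induction n using nat_bit_cases with
      | h0 => rw [enc_zero, Nat.div2_zero, enc_zero]; rfl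
      | hb b n h => rw [enc_bit h, Nat.div2_bit]; rfl
    rw [← this]
    exact Runs.tl _, le_rfl⟩) (PB.id.mono fun n => by
      conv_rhs => rw [← Nat.bit_bodd_div2 n]
      exact le_sz_bit _ _)
  exact this.comp hf

theorem sz_div2_le (n : ℕ) : sz n.div2 ≤ sz n := by
  conv_rhs => rw [← Nat.bit_bodd_div2 n]
  exact le_sz_bit _ _

@[fun_prop]
theorem PT.eqZero {f : γ → ℕ} (hf : PT f) : PT fun c => decide (f c = 0) := by
  have : PT fun n : ℕ => decide (n = 0) :=
    PT.intro (Prog.ite Prog.id Prog.nil (Prog.const (enc true))) (PB.const 5) (fun n => by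
      induction n using nat_bit_cases with
      | h0 =>
        rw [enc_zero]
        exact ⟨_, Runs.ite_false (Runs.id _) (runs_const _ _), le_rfl⟩
      | hb b n h =>
        have : decide (Nat.bit b n = 0) = false := by
          rw [decide_eq_false_iff_not, Nat.bit_eq_zero_iff]
          rintro ⟨rfl, rfl⟩
          exact absurd (h rfl) Bool.false_ne_true
        rw [enc_bit h, this]
        exact ⟨_, Runs.ite_true (Runs.id _) (Runs.nil _), by omega⟩)
      ((PB.const 3).mono fun _ => sz_bool _)
  exact this.comp hf

@[fun_prop]
theorem PT.bit {b : γ → Bool} {f : γ → ℕ} (hb : PT b) (hf : PT f) :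
    PT fun c => Nat.bit (b c) (f c) := by
  have : PT fun c => bif decide (f c = 0) && !b c then enc 0 else enc (b c, f c) := by fun_prop
  refine this.of_enc_eq fun c => ?_
  by_cases h : f c = 0 → b c = true
  · have e : (decide (f c = 0) && !b c) = false := by
      by_cases h0 : f c = 0
      · simp [h h0]
      · simp [h0]
    rw [e, enc_bit h]
    rfl
  · push Not at h
    obtain ⟨h0, h1⟩ := h
    have h1 : b c = false := by simpa using h1
    rw [h0, h1]
    rfl

@[fun_prop]
theorem PT.bits {f : γ → ℕ} (hf : PT f) : PT fun c => (f c).bits := hf.of_enc_eq fun _ => rfl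

theorem sz_bits (n : ℕ) : sz n.bits = sz n := rfl

/-- The number with the given binary digits, most significant digit first. -/
def ofDigits (l : List Bool) : ℕ := l.foldl (fun n d => Nat.bit d n) 0

theorem sz_foldl_bit_le (l : List Bool) (n : ℕ) :
    sz (l.foldl (fun n d => Nat.bit d n) n) ≤ 4 * l.length + sz n := by
  induction l generalizing n with
  | nil => simp
  | cons d l ih =>
    have h1 := ih (Nat.bit d n)
    have h2 := sz_bit_le d n
    rw [List.foldl_cons, List.length_cons]
    omega

@[fun_prop]
theorem PT.ofDigits {l : γ → List Bool} (hl : PT l) : PT fun c => ofDigits (l c) := by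
  have hs : PT fun p : γ × ℕ × Bool => Nat.bit p.2.2 p.2.1 := by fun_prop
  refine PT.foldl (s := fun _ n d => Nat.bit d n) hl (PT.const 0) hs
    (u := fun c => 4 * sz (l c) + 1) (by fun_prop) fun c l₁ l₂ h => ?_
  have h1 := sz_foldl_bit_le l₁ 0
  have h2 := length_lt_sz (l c)
  rw [h, List.length_append] at h2
  rw [sz_zero] at h1
  rw [h]
  omega

/-- The majority of three bits. -/
def maj (a b c : Bool) : Bool := (a && b) || (a && c) || (b && c)

/-- One step of the addition of two numbers with a carry, starting with the least significant
digits; the digits of the result are collected in the first component. -/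
def addStep (s : List Bool × ℕ × ℕ × Bool) : List Bool × ℕ × ℕ × Bool :=
  (xor (xor s.2.1.bodd s.2.2.1.bodd) s.2.2.2 :: s.1, s.2.1.div2, s.2.2.1.div2,
    maj s.2.1.bodd s.2.2.1.bodd s.2.2.2)

/-- One step of the subtraction of two numbers with a borrow. -/
def subStep (s : List Bool × ℕ × ℕ × Bool) : List Bool × ℕ × ℕ × Bool :=
  (xor (xor s.2.1.bodd s.2.2.1.bodd) s.2.2.2 :: s.1, s.2.1.div2, s.2.2.1.div2,
    maj (!s.2.1.bodd) s.2.2.1.bodd s.2.2.2)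

/-- Adding two numbers digit by digit, started with digits `o` and carry `c`, yields the digits of the
sum `a + b + c` followed by those in `o`. -/
theorem foldl_addStep (l : List Bool) (o : List Bool) (a b : ℕ) (c : Bool)
    (h : a + b + c.toNat < 2 ^ l.length) :
    ((l.foldl (fun s _ => addStep s) (o, a, b, c)).1).foldl (fun n d => Nat.bit d n) 0 =
      o.foldl (fun n d => Nat.bit d n) (a + b + c.toNat) := by
  induction l generalizing o a b c with
  | nil =>
    have : a + b + c.toNat = 0 := by simpa using h
    rw [this]
    rfl
  | cons e l ih =>
    have ha := Nat.bodd_add_div2 a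
    have hb := Nat.bodd_add_div2 b
    have key : a + b + c.toNat = Nat.bit (xor (xor a.bodd b.bodd) c)
        (a.div2 + b.div2 + (maj a.bodd b.bodd c).toNat) := by
      rw [Nat.bit_val]
      generalize a.bodd = x at ha ⊢
      generalize b.bodd = y at hb ⊢
      cases x <;> cases y <;> cases c <;> simp [maj] at ha hb ⊢ <;> omega
    rw [List.length_cons, pow_succ, key, Nat.bit_val] at h
    rw [List.foldl_cons, addStep, ih _ _ _ _ (by dsimp only; omega), List.foldl_cons, key]

/-- The digits produced by the subtraction, preceded by the final borrow with a negative sign, represent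
the integral difference `a - b - c` followed by the digits in `o`. -/
theorem foldl_subStep (l : List Bool) (o : List Bool) (a b : ℕ) (c : Bool)
    (ha : a < 2 ^ l.length) (hb : b < 2 ^ l.length) :
    let s := l.foldl (fun s _ => subStep s) (o, a, b, c)
    s.1.foldl (fun n d => 2 * n + (d.toNat : ℤ)) (-(s.2.2.2.toNat : ℤ)) =
      o.foldl (fun n d => 2 * n + (d.toNat : ℤ)) ((a : ℤ) - b - c.toNat) := by
  induction l generalizing o a b c with
  | nil =>
    have ha : a = 0 := by simpa using ha
    have hb : b = 0 := by simpa using hb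
    subst ha hb
    simp
  | cons e l ih =>
    have ha' := Nat.bodd_add_div2 a
    have hb' := Nat.bodd_add_div2 b
    have key : (a : ℤ) - b - c.toNat = 2 * ((a.div2 : ℤ) - b.div2 -
        ((maj (!a.bodd) b.bodd c).toNat : ℤ)) + ((xor (xor a.bodd b.bodd) c).toNat : ℤ) := by
      generalize a.bodd = x at ha' ⊢
      generalize b.bodd = y at hb' ⊢
      cases x <;> cases y <;> cases c <;> simp [maj] at ha' hb' ⊢ <;> omega
    rw [List.length_cons, pow_succ] at ha hb
    dsimp only
    rw [List.foldl_cons, subStep]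
    have h := ih (xor (xor a.bodd b.bodd) c :: o) a.div2 b.div2 (maj (!a.bodd) b.bodd c)
      (by rw [Nat.div2_val]; omega) (by rw [Nat.div2_val]; omega)
    dsimp only at h
    rw [h, List.foldl_cons, key]

theorem foldl_digits_int (l : List Bool) (n : ℕ) :
    ((l.foldl (fun n d => Nat.bit d n) n : ℕ) : ℤ) =
      l.foldl (fun n d => 2 * n + (d.toNat : ℤ)) (n : ℤ) := by
  induction l generalizing n with
  | nil => rfl
  | cons d l ih =>
    rw [List.foldl_cons, List.foldl_cons, ih, Nat.bit_val]
    push_cast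
    rfl

theorem foldl_digits_neg (l : List Bool) {n : ℤ} (h : n < 0) :
    l.foldl (fun n d => 2 * n + (d.toNat : ℤ)) n < 0 := by
  induction l generalizing n with
  | nil => exact h
  | cons d l ih =>
    refine ih ?_
    cases d <;> simp <;> omega

/-- The list of digits of two numbers, together with one more element; it is long enough to drive
an addition or subtraction. -/
def fuel (a b : ℕ) : List Bool := true :: (a.bits ++ b.bits)

theorem add_lt_two_pow_fuel (a b : ℕ) : a + b < 2 ^ (fuel a b).length := by
  rw [fuel, List.length_cons, List.length_append, Nat.size_eq_bits_len, Nat.size_eq_bits_len,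
    pow_succ, pow_add]
  have h1 := Nat.lt_size_self a
  have h2 := Nat.lt_size_self b
  nlinarith

theorem add_eq_foldl (a b : ℕ) :
    a + b = ofDigits ((fuel a b).foldl (fun s _ => addStep s) ([], a, b, false)).1 := by
  have h := foldl_addStep (fuel a b) [] a b false (by simpa using add_lt_two_pow_fuel a b)
  rw [ofDigits]
  simpa using h.symm

/-- The final borrow decides whether the difference is negative, in which case truncated subtraction
yields zero. -/
theorem sub_eq_foldl (a b : ℕ) :
    a - b = bif ((fuel a b).foldl (fun s _ => subStep s) ([], a, b, false)).2.2.2 then 0 else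
      ofDigits ((fuel a b).foldl (fun s _ => subStep s) ([], a, b, false)).1 := by
  have h0 := add_lt_two_pow_fuel a b
  have h := foldl_subStep (fuel a b) [] a b false (by omega) (by omega)
  dsimp only at h
  generalize (fuel a b).foldl (fun s _ => subStep s) ([], a, b, false) = s at *
  obtain ⟨o, a', b', c⟩ := s
  dsimp only at *
  cases c
  · simp only [Bool.toNat_false, Nat.cast_zero, neg_zero, List.foldl_nil, sub_zero] at h
    have h1 := foldl_digits_int o 0
    rw [Nat.cast_zero, h] at h1
    change _ = ofDigits o
    rw [ofDigits]
    omega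
  · simp only [Bool.toNat_true, Nat.cast_one, List.foldl_nil, Bool.toNat_false, Nat.cast_zero,
      sub_zero] at h
    have h1 := foldl_digits_neg o (n := -1) (by norm_num)
    rw [h] at h1
    change _ = 0
    omega

/-- The size of the state of an addition or subtraction stays polynomial. -/
theorem sz_foldl_step_le {step : List Bool × ℕ × ℕ × Bool → List Bool × ℕ × ℕ × Bool}
    (h1 : ∀ s, ∃ d, (step s).1 = d :: s.1) (h2 : ∀ s, (step s).2.1 = s.2.1.div2)
    (h3 : ∀ s, (step s).2.2.1 = s.2.2.1.div2) (l : List Bool) (s : List Bool × ℕ × ℕ × Bool) :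
    sz (l.foldl (fun s _ => step s) s) ≤
      sz s.1 + 4 * l.length + sz s.2.1 + sz s.2.2.1 + 6 := by
  induction l generalizing s with
  | nil =>
    have := sz_bool s.2.2.2
    simp only [List.foldl_nil, sz_prod, List.length_nil]
    omega
  | cons e l ih =>
    have h := ih (step s)
    obtain ⟨d, hd⟩ := h1 s
    have h4 := sz_div2_le s.2.1
    have h5 := sz_div2_le s.2.2.1
    have h6 := sz_bool d
    rw [hd, h2, h3, sz_cons] at h
    rw [List.foldl_cons, List.length_cons]
    omega

theorem PT.foldl_step {step : List Bool × ℕ × ℕ × Bool → List Bool × ℕ × ℕ × Bool}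
    (h1 : ∀ s, ∃ d, (step s).1 = d :: s.1) (h2 : ∀ s, (step s).2.1 = s.2.1.div2)
    (h3 : ∀ s, (step s).2.2.1 = s.2.2.1.div2) (hs : PT step) {f g : γ → ℕ} (hf : PT f)
    (hg : PT g) :
    PT fun c => (fuel (f c) (g c)).foldl (fun s _ => step s) ([], f c, g c, false) := by
  have hfuel : PT fun c => fuel (f c) (g c) := by unfold fuel; fun_prop
  have hs' : PT fun p : γ × (List Bool × ℕ × ℕ × Bool) × Bool => step p.2.1 :=
    hs.comp (by fun_prop)
  refine PT.foldl (s := fun _ s _ => step s) hfuel (by fun_prop) hs'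
    (u := fun c => 1 + 4 * sz (fuel (f c) (g c)) + sz (f c) + sz (g c) + 6) (by fun_prop) ?_
  intro c l₁ l₂ h
  refine (sz_foldl_step_le h1 h2 h3 l₁ _).trans ?_
  have h4 := length_lt_sz (fuel (f c) (g c))
  rw [h, List.length_append] at h4
  rw [h]
  change 1 + _ + _ + _ + _ ≤ _
  dsimp only
  omega

@[fun_prop]
theorem PT.maj {a b c : γ → Bool} (ha : PT a) (hb : PT b) (hc : PT c) :
    PT fun x => maj (a x) (b x) (c x) := by unfold Complexity.maj; fun_prop

@[fun_prop]
theorem PT.add {f g : γ → ℕ} (hf : PT f) (hg : PT g) : PT fun c => f c + g c := by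
  have hs : PT addStep := by unfold addStep; fun_prop
  exact (PT.foldl_step (fun s => ⟨_, rfl⟩) (fun s => rfl) (fun s => rfl) hs hf
    hg).fst.ofDigits.congr fun c => add_eq_foldl _ _

@[fun_prop]
theorem PT.sub {f g : γ → ℕ} (hf : PT f) (hg : PT g) : PT fun c => f c - g c := by
  have hs : PT subStep := by unfold subStep; fun_prop
  have h := PT.foldl_step (fun s => ⟨_, rfl⟩) (fun s => rfl) (fun s => rfl) hs hf hg
  exact (h.snd.snd.snd.cond (PT.const 0) h.fst.ofDigits).congr fun c => sub_eq_foldl _ _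

@[fun_prop]
theorem PT.le {f g : γ → ℕ} (hf : PT f) (hg : PT g) : PT fun c => decide (f c ≤ g c) :=
  (hf.sub hg).eqZero.congr fun _ => decide_eq_decide.2 Nat.sub_eq_zero_iff_le.symm

@[fun_prop]
theorem PT.eq {f g : γ → ℕ} (hf : PT f) (hg : PT g) : PT fun c => decide (f c = g c) :=
  ((hf.le hg).and (hg.le hf)).congr fun c => by
    rw [← Bool.decide_and]
    simp [le_antisymm_iff]

@[fun_prop]
theorem PT.max {f g : γ → ℕ} (hf : PT f) (hg : PT g) : PT fun c => max (f c) (g c) :=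
  ((hf.le hg).cond hg hf).congr fun c => by
    by_cases h : f c ≤ g c
    · simp [h]
    · simp [h, le_of_not_ge h]

theorem mul_eq_foldl (a b : ℕ) : (a.bits.reverse).foldl
    (fun r d => Nat.bit false r + bif d then b else 0) 0 = a * b := by
  induction a using Nat.binaryRec' with
  | zero => simp
  | bit d a h ih =>
    rw [Nat.bits_append_bit a d h, List.reverse_cons, List.foldl_append, ih, List.foldl_cons,
      List.foldl_nil, Nat.bit_val, Nat.bit_val]
    cases d <;> simp <;> ring

theorem foldl_mul_le (l : List Bool) (b r : ℕ) :
    l.foldl (fun r d => Nat.bit false r + bif d then b else 0) r ≤ (r + b) * 2 ^ l.length := by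
  induction l generalizing r with
  | nil => simp
  | cons d l ih =>
    rw [List.foldl_cons, List.length_cons, pow_succ]
    refine (ih _).trans ?_
    rw [Nat.bit_val]
    have : 2 * r + Bool.toNat false + (bif d then b else 0) + b ≤ 2 * (r + b) := by
      cases d <;> simp <;> omega
    calc _ ≤ 2 * (r + b) * 2 ^ l.length := Nat.mul_le_mul_right _ this
      _ = _ := by ring

@[fun_prop]
theorem PT.mul {f g : γ → ℕ} (hf : PT f) (hg : PT g) : PT fun c => f c * g c := by
  have hs : PT fun p : γ × ℕ × Bool => Nat.bit false p.2.1 + bif p.2.2 then g p.1 else 0 :=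
    PT.add (by fun_prop) (PT.cond (by fun_prop) (hg.comp (by fun_prop)) (by fun_prop))
  refine (PT.foldl (s := fun c r d => Nat.bit false r + bif d then g c else 0)
    hf.bits.reverse (PT.const 0) hs (u := fun c => 4 * (sz (f c) + sz (g c)) + 1)
    (by fun_prop) ?_).congr fun c => (mul_eq_foldl _ _).symm
  intro c l₁ l₂ h
  have h1 := foldl_mul_le l₁ (g c) 0
  have h2 : l₁.length ≤ sz (f c) := by
    have := length_lt_sz (f c).bits.reverse
    rw [sz_reverse, sz_bits, h, List.length_append] at this
    omega
  refine sz_le_of_lt_two_pow (h1.trans_lt ?_)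
  rw [pow_add, zero_add, mul_comm]
  exact Nat.mul_lt_mul_of_le_of_lt (Nat.pow_le_pow_right two_pos h2) (lt_two_pow_sz _)
    (by positivity)

/-! ### Integers -/

/-- An integer is represented by its positive and its negative part. -/
instance : Enc ℤ := ⟨fun z => enc (z.toNat, (-z).toNat)⟩

@[fun_prop]
theorem PT.toNat {f : γ → ℤ} (hf : PT f) : PT fun c => (f c).toNat := by
  have : PT fun z : ℤ => z.toNat := PT.intro Prog.hd (PB.const 1)
    (fun _ => ⟨1, Runs.hd _, le_rfl⟩) (PB.id.mono fun z => by
      change _ ≤ sz (z.toNat, (-z).toNat)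
      rw [sz_prod]
      dsimp only
      omega)
  exact this.comp hf

theorem PT.negToNat {f : γ → ℤ} (hf : PT f) : PT fun c => (-f c).toNat := by
  have : PT fun z : ℤ => (-z).toNat := PT.intro Prog.tl (PB.const 1)
    (fun _ => ⟨1, Runs.tl _, le_rfl⟩) (PB.id.mono fun z => by
      change _ ≤ sz (z.toNat, (-z).toNat)
      rw [sz_prod]
      dsimp only
      omega)
  exact this.comp hf

theorem PT.natSub {f g : γ → ℕ} (hf : PT f) (hg : PT g) : PT fun c => (f c : ℤ) - g c :=
  (PT.prodMk (hf.sub hg) (hg.sub hf)).of_enc_eq fun c => by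
    change enc (((f c : ℤ) - g c).toNat, (-((f c : ℤ) - g c)).toNat) = _
    rw [neg_sub, Int.toNat_sub, Int.toNat_sub]

@[fun_prop]
theorem PT.natCast {f : γ → ℕ} (hf : PT f) : PT fun c => (f c : ℤ) :=
  (hf.natSub (PT.const 0)).congr fun c => by simp

@[fun_prop]
theorem PT.intNeg {f : γ → ℤ} (hf : PT f) : PT fun c => -f c :=
  (hf.negToNat.natSub hf.toNat).congr fun c => by omega

@[fun_prop]
theorem PT.intAdd {f g : γ → ℤ} (hf : PT f) (hg : PT g) : PT fun c => f c + g c :=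
  ((hf.toNat.add hg.toNat).natSub (hf.negToNat.add hg.negToNat)).congr fun c => by
    push_cast
    omega

@[fun_prop]
theorem PT.intSub {f g : γ → ℤ} (hf : PT f) (hg : PT g) : PT fun c => f c - g c :=
  (hf.intAdd hg.intNeg).congr fun _ => sub_eq_add_neg _ _

@[fun_prop]
theorem PT.intMul {f g : γ → ℤ} (hf : PT f) (hg : PT g) : PT fun c => f c * g c :=
  (((hf.toNat.mul hg.toNat).add (hf.negToNat.mul hg.negToNat)).natSub
    ((hf.toNat.mul hg.negToNat).add (hf.negToNat.mul hg.toNat))).congr fun c => by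
    have h1 : ∀ z : ℤ, z = (z.toNat : ℤ) - ((-z).toNat : ℤ) := fun z => by omega
    conv_lhs => rw [h1 (f c), h1 (g c)]
    push_cast
    ring

theorem sz_int_le {z : ℤ} {k : ℕ} (h : z.natAbs < 2 ^ k) : sz z ≤ 8 * k + 3 := by
  change sz (z.toNat, (-z).toNat) ≤ _
  rw [sz_prod]
  have h1 : sz z.toNat ≤ 4 * k + 1 := sz_le_of_lt_two_pow (by omega)
  have h2 : sz (-z).toNat ≤ 4 * k + 1 := sz_le_of_lt_two_pow (by omega)
  dsimp only
  omega

theorem natAbs_lt_two_pow_sz (z : ℤ) : z.natAbs < 2 ^ sz z := by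
  have e : sz z = sz z.toNat + sz (-z).toNat + 1 := rfl
  rcases le_total 0 z with h | h
  · have : z.natAbs = z.toNat := by omega
    rw [this]
    exact (lt_two_pow_sz _).trans_le (Nat.pow_le_pow_right two_pos (by omega))
  · have : z.natAbs = (-z).toNat := by omega
    rw [this]
    exact (lt_two_pow_sz _).trans_le (Nat.pow_le_pow_right two_pos (by omega))

end Complexity

/-! ### The Faddeev–LeVerrier algorithm -/

namespace Complexity

open Polynomial Matrix

section Adjugate

variable {ι R : Type*} [Fintype ι] [DecidableEq ι] [CommRing R]

theorem derivative_det (M : Matrix ι ι R[X]) :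
    derivative M.det = ∑ i, (M.updateCol i fun k => derivative (M k i)).det := by
  simp only [det_apply', map_sum]
  rw [Finset.sum_comm]
  refine Finset.sum_congr rfl fun σ _ => ?_
  rw [← Polynomial.C_eq_intCast, derivative_C_mul, derivative_prod_finset, Finset.mul_sum]
  refine Finset.sum_congr rfl fun i _ => ?_
  rw [← Finset.mul_prod_erase _ _ (Finset.mem_univ i), mul_comm (∏ _ ∈ _, _), updateCol_self]
  congr 2
  exact Finset.prod_congr rfl fun j hj => by rw [updateCol_ne (Finset.ne_of_mem_erase hj)]

/-- Jacobi's formula for the characteristic matrix. -/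
theorem derivative_charpoly (B : Matrix ι ι R) :
    derivative B.charpoly = (adjugate B.charmatrix).trace := by
  rw [Matrix.charpoly, derivative_det, trace]
  refine Finset.sum_congr rfl fun i _ => ?_
  have h : (fun k => derivative (B.charmatrix k i)) = Pi.single i 1 := by
    funext k
    rw [charmatrix_apply, diagonal_apply]
    by_cases hk : k = i
    · simp [hk]
    · simp [hk]
  rw [diag_apply, h, ← transpose_apply (adjugate _), adjugate_transpose, adjugate_apply,
    updateRow_transpose, det_transpose]

/-- The coefficients of the adjugate of the characteristic matrix. -/
def adjCoeff (B : Matrix ι ι R) (j : ℕ) : Matrix ι ι R :=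
  Matrix.of fun i k => (adjugate B.charmatrix i k).coeff j

theorem adjugate_charmatrix_mul_apply (B : Matrix ι ι R) (i k : ι) :
    adjugate B.charmatrix i k * X - ∑ l, adjugate B.charmatrix i l * C (B l k) =
      B.charpoly * C ((1 : Matrix ι ι R) i k) := by
  have h := congrFun (congrFun (adjugate_mul B.charmatrix) i) k
  rw [mul_apply] at h
  simp only [charmatrix_apply, diagonal_apply, mul_sub, Finset.sum_sub_distrib, mul_ite, mul_zero,
    Finset.sum_ite_eq', Finset.mem_univ, if_true] at h
  rw [h, Matrix.charpoly, Matrix.smul_apply, one_apply, one_apply]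
  split_ifs <;> simp

/-- Comparison of the coefficients in the product of the characteristic matrix and its adjugate. -/
theorem adjCoeff_eq_add (B : Matrix ι ι R) (j : ℕ) :
    adjCoeff B j = adjCoeff B (j + 1) * B + B.charpoly.coeff (j + 1) • 1 := by
  ext i k
  have h := congrArg (fun p => p.coeff (j + 1)) (adjugate_charmatrix_mul_apply B i k)
  simp only [coeff_sub, coeff_mul_X, finsetSum_coeff, coeff_mul_C] at h
  rw [Matrix.add_apply, mul_apply, Matrix.smul_apply, smul_eq_mul, ← h]
  simp [adjCoeff]

theorem adjCoeff_zero_mul (B : Matrix ι ι R) :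
    adjCoeff B 0 * B + B.charpoly.coeff 0 • 1 = 0 := by
  ext i k
  have h := congrArg (fun p => p.coeff 0) (adjugate_charmatrix_mul_apply B i k)
  simp only [coeff_sub, coeff_mul_X_zero, finsetSum_coeff, coeff_mul_C] at h
  rw [Matrix.add_apply, mul_apply, Matrix.smul_apply, smul_eq_mul, ← h]
  simp [adjCoeff]

/-- The derivative of the characteristic polynomial is the trace of the adjugate of the characteristic
matrix. -/
theorem trace_adjCoeff (B : Matrix ι ι R) (j : ℕ) :
    (adjCoeff B j).trace = (j + 1) * B.charpoly.coeff (j + 1) := by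
  have h := congrArg (fun p => coeff p j) (derivative_charpoly B)
  simp only [coeff_derivative, trace, finsetSum_coeff, diag_apply] at h
  rw [mul_comm, h]
  rfl

theorem exists_adjCoeff_eq_zero (B : Matrix ι ι R) : ∃ m, ∀ j, m ≤ j → adjCoeff B j = 0 := by
  refine ⟨(∑ i, ∑ k, (adjugate B.charmatrix i k).natDegree) + 1, fun j hj => ?_⟩
  ext i k
  refine coeff_eq_zero_of_natDegree_lt (lt_of_lt_of_le ?_ hj)
  refine Nat.lt_succ_of_le (le_trans ?_ (Finset.single_le_sum (fun _ _ => Nat.zero_le _)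
    (Finset.mem_univ i)))
  exact Finset.single_le_sum (f := fun k => (adjugate B.charmatrix i k).natDegree)
    (fun _ _ => Nat.zero_le _) (Finset.mem_univ k)

theorem adjCoeff_eq_zero [Nontrivial R] (B : Matrix ι ι R) {j : ℕ} (h : Fintype.card ι ≤ j) :
    adjCoeff B j = 0 := by
  obtain ⟨m, hm⟩ := exists_adjCoeff_eq_zero B
  have key : ∀ d j, Fintype.card ι ≤ j → m ≤ j + d → adjCoeff B j = 0 := by
    intro d
    induction d with
    | zero => exact fun j _ h => hm j h
    | succ d ih =>
      intro j h1 h2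
      rw [adjCoeff_eq_add, ih (j + 1) (by omega) (by omega),
        coeff_eq_zero_of_natDegree_lt (by rw [charpoly_natDegree_eq_dim]; omega), zero_mul,
        zero_smul, add_zero]
  exact key m j h (by omega)

theorem adjCoeff_card_sub_one (B : Matrix ι ι R) [Nonempty ι] :
    adjCoeff B (Fintype.card ι - 1) = 1 := by
  nontriviality R
  have h : Fintype.card ι - 1 + 1 = Fintype.card ι := Nat.sub_add_cancel Fintype.card_pos
  have h1 := B.charpoly_monic.coeff_natDegree
  rw [charpoly_natDegree_eq_dim] at h1
  rw [adjCoeff_eq_add, h, adjCoeff_eq_zero B le_rfl, h1, zero_mul, zero_add, one_smul]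

/-- The iteration of Faddeev and LeVerrier, scaled by factorials so that no division is needed. -/
def faddeev (B : Matrix ι ι R) : ℕ → Matrix ι ι R
  | 0 => 1
  | k + 1 => ((k + 1 : ℕ) : R) • (faddeev B k * B) - (faddeev B k * B).trace • 1

/-- The iterates are the coefficients of the adjugate of the characteristic matrix, and their traces
the coefficients of the characteristic polynomial, up to factorials. -/
theorem faddeev_eq (B : Matrix ι ι R) [Nonempty ι] {k : ℕ} (hk : k < Fintype.card ι) :
    faddeev B k = (k.factorial : R) • adjCoeff B (Fintype.card ι - 1 - k) ∧
    (faddeev B k * B).trace =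
      -(((k + 1).factorial : R) * B.charpoly.coeff (Fintype.card ι - 1 - k)) := by
  have htr : ∀ k j, k + 1 + j = Fintype.card ι →
      faddeev B k = (k.factorial : R) • adjCoeff B j → (faddeev B k * B).trace =
      -(((k + 1).factorial : R) * B.charpoly.coeff j) := by
    intro k j hj h
    have h1 : (adjCoeff B j * B).trace = -((k + 1) * B.charpoly.coeff j) := by
      have hc : (Fintype.card ι : R) = k + 1 + j := by rw [← hj]; push_cast; ring
      cases j with
      | zero =>
        have h2 := congrArg trace (adjCoeff_zero_mul B)
        rw [trace_add, trace_smul, trace_one, trace_zero, smul_eq_mul, hc] at h2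
        push_cast at h2
        linear_combination h2
      | succ j =>
        have h2 := congrArg trace (adjCoeff_eq_add B j)
        rw [trace_add, trace_smul, trace_one, trace_adjCoeff, smul_eq_mul, hc] at h2
        push_cast at h2
        linear_combination -h2
    rw [h, smul_mul_assoc, trace_smul, h1, Nat.factorial_succ, smul_eq_mul]
    push_cast
    ring
  induction k with
  | zero =>
    have h : faddeev B 0 = ((0 : ℕ).factorial : R) • adjCoeff B (Fintype.card ι - 1 - 0) := by
      rw [Nat.sub_zero, adjCoeff_card_sub_one, Nat.factorial_zero, Nat.cast_one, one_smul]
      rfl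
    exact ⟨h, htr _ _ (by omega) h⟩
  | succ k ih =>
    obtain ⟨ih1, ih2⟩ := ih (by omega)
    have hj : Fintype.card ι - 1 - k = Fintype.card ι - 1 - (k + 1) + 1 := by omega
    have h : faddeev B (k + 1) =
        ((k + 1).factorial : R) • adjCoeff B (Fintype.card ι - 1 - (k + 1)) := by
      rw [faddeev, ih2, ih1, adjCoeff_eq_add B (Fintype.card ι - 1 - (k + 1)), ← hj, smul_add,
        smul_mul_assoc, smul_smul, smul_smul, neg_smul, sub_neg_eq_add, Nat.factorial_succ]
      push_cast
      rfl
    exact ⟨h, htr _ _ (by omega) h⟩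

/-- The last step of the iteration computes a multiple of the determinant, together with a
multiple of the inverse matrix. -/
theorem faddeev_mul (B : Matrix ι ι R) [Nonempty ι] :
    (Fintype.card ι : R) • (faddeev B (Fintype.card ι - 1) * B) =
      (faddeev B (Fintype.card ι - 1) * B).trace • 1 := by
  have hc : Fintype.card ι - 1 + 1 = Fintype.card ι := Nat.sub_add_cancel Fintype.card_pos
  obtain ⟨h1, h2⟩ := faddeev_eq B (k := Fintype.card ι - 1) (by omega)
  have h3 := adjCoeff_zero_mul B
  have h4 : ((Fintype.card ι).factorial : R) =
      Fintype.card ι * ((Fintype.card ι - 1).factorial : R) := by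
    rw [← Nat.cast_mul, Nat.mul_factorial_pred Fintype.card_ne_zero]
  rw [h2, hc, h1, Nat.sub_self, smul_mul_assoc, eq_neg_of_add_eq_zero_left h3, smul_smul, h4,
    smul_neg, smul_smul, neg_smul]

theorem trace_faddeev_mul (B : Matrix ι ι R) [Nonempty ι] :
    (faddeev B (Fintype.card ι - 1) * B).trace =
      -(((Fintype.card ι).factorial : R) * (-1) ^ Fintype.card ι * B.det) := by
  have hc : Fintype.card ι - 1 + 1 = Fintype.card ι := Nat.sub_add_cancel Fintype.card_pos
  obtain ⟨h1, h2⟩ := faddeev_eq B (k := Fintype.card ι - 1) (by omega)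
  rw [h2, hc, Nat.sub_self, det_eq_sign_charpoly_coeff, mul_assoc, ← mul_assoc (_ ^ _), ← pow_add,
    Even.neg_one_pow ⟨_, rfl⟩, one_mul]

end Adjugate
end Complexity

/-! ### Linear systems over the integers in polynomial time -/

namespace Complexity

open Enc Matrix

variable {α β γ δ : Type} [Enc α] [Enc β] [Enc γ] [Enc δ]

theorem sz_le_of_le_length {n : ℕ} {l : List α} (h : n ≤ l.length) : sz n ≤ 4 * sz l + 1 := by
  refine sz_le_of_lt_two_pow (lt_of_le_of_lt h ?_)
  exact (length_lt_sz l).trans Nat.lt_two_pow_self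

@[fun_prop]
theorem PT.length {l : γ → List α} (hl : PT l) : PT fun c => (l c).length := by
  have hs : PT fun p : γ × ℕ × α => p.2.1 + 1 := by fun_prop
  have h : ∀ (l : List α) (n : ℕ), l.foldl (fun n _ => n + 1) n = n + l.length := by
    intro l
    induction l with
    | nil => simp
    | cons a l ih => intro n; rw [List.foldl_cons, ih, List.length_cons]; omega
  refine (PT.foldl (s := fun _ n _ => n + 1) hl (PT.const 0) hs
    (u := fun c => 4 * sz (l c) + 1) (by fun_prop) fun c l₁ l₂ e => ?_).congr fun c => by
      rw [h, zero_add]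
  rw [h, zero_add]
  exact sz_le_of_le_length (by rw [e, List.length_append]; omega)

@[fun_prop]
theorem PT.range_length {l : γ → List α} (hl : PT l) : PT fun c => List.range (l c).length := by
  have hs : PT fun p : γ × List ℕ × α => p.2.1 ++ [p.2.1.length] := by fun_prop
  have h : ∀ l : List α, l.foldl (fun (r : List ℕ) _ => r ++ [r.length]) [] =
      List.range l.length := by
    intro l
    induction l using List.reverseRecOn with
    | nil => rfl
    | append_singleton l a ih =>
      rw [List.foldl_append, ih, List.length_append, List.foldl_cons, List.foldl_nil,
        List.length_range, List.length_singleton, List.range_succ]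
  refine (PT.foldl (s := fun _ r _ => r ++ [r.length]) hl (PT.const []) hs
    (u := fun c => sz (l c) * (4 * sz (l c) + 2) + 1) (by fun_prop) fun c l₁ l₂ e => ?_).congr
      fun c => (h _).symm
  rw [h]
  have hlen : l₁.length ≤ (l c).length := by rw [e, List.length_append]; omega
  refine (sz_le_of_forall (m := 4 * sz (l c) + 1) fun a ha => ?_).trans ?_
  · exact sz_le_of_le_length ((List.mem_range.1 ha).le.trans hlen)
  · rw [List.length_range]
    have := length_lt_sz (l c)
    exact Nat.succ_le_succ (Nat.mul_le_mul_right _ (by omega))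

theorem sz_getD_le (l : List α) (n : ℕ) (d : α) : sz (l.getD n d) ≤ sz l + sz d := by
  by_cases h : n < l.length
  · rw [List.getD_eq_getElem _ _ h]
    exact (sz_mem (List.getElem_mem h)).le.trans (by omega)
  · rw [List.getD_eq_default _ _ (by omega)]
    omega

/-- One step of the search for an element of a list: the index decreases to `0`, then the element
is stored. -/
def getDStep (s : ℕ × List α) (a : α) : ℕ × List α :=
  bif s.2.isEmpty then bif decide (s.1 = 0) then (0, [a]) else (s.1 - 1, []) else s

omit [Enc α] in
theorem foldl_getDStep (l : List α) (n : ℕ) (d : α) :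
    ((l.foldl getDStep (n, [])).2).headD d = l.getD n d := by
  have h1 : ∀ (l : List α) (s : ℕ × List α), s.2 ≠ [] → l.foldl getDStep s = s := by
    intro l s hs
    induction l with
    | nil => rfl
    | cons a l ih =>
      have : getDStep s a = s := by rw [getDStep, List.isEmpty_eq_false_iff.2 hs]; rfl
      rw [List.foldl_cons, this, ih]
  induction l generalizing n with
  | nil => rfl
  | cons a l ih =>
    rw [List.foldl_cons]
    cases n with
    | zero => rw [getDStep]; exact congrArg (fun s => s.2.headD d) (h1 l (0, [a]) (by simp))
    | succ n =>
      have : getDStep (n + 1, []) a = (n, []) := by simp [getDStep]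
      rw [this, ih, List.getD_cons_succ]

@[fun_prop]
theorem PT.getD {l : γ → List α} {n : γ → ℕ} {d : γ → α} (hl : PT l) (hn : PT n) (hd : PT d) :
    PT fun c => (l c).getD (n c) (d c) := by
  have hs : PT fun p : γ × (ℕ × List α) × α => getDStep p.2.1 p.2.2 := by
    unfold getDStep; fun_prop
  have hb : ∀ (l : List α) (s : ℕ × List α),
      sz (l.foldl getDStep s) ≤ (4 * sz s.1 + 1) + (sz s.2 + sz l) + 1 := by
    have : ∀ (l : List α) (s : ℕ × List α), (l.foldl getDStep s).1 ≤ s.1 ∧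
        sz (l.foldl getDStep s).2 ≤ sz s.2 + sz l := by
      intro l
      induction l with
      | nil => exact fun s => ⟨le_rfl, Nat.le_add_right _ _⟩
      | cons a l ih =>
        intro s
        obtain ⟨h1, h2⟩ := ih (getDStep s a)
        have h3 : (getDStep s a).1 ≤ s.1 ∧ sz (getDStep s a).2 ≤ sz s.2 + sz a + 1 := by
          obtain ⟨n, _ | ⟨x, l⟩⟩ := s
          · cases n
            · exact ⟨le_rfl, by change sz a + 1 + 1 ≤ 1 + sz a + 1; omega⟩
            · exact ⟨Nat.sub_le _ _, by change 1 ≤ _; omega⟩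
          · exact ⟨le_rfl, by change sz (x :: l) ≤ sz (x :: l) + sz a + 1; omega⟩
        rw [List.foldl_cons, sz_cons]
        exact ⟨h1.trans h3.1, by omega⟩
    intro l s
    have h1 := sz_mono_nat (this l s).1
    have h2 := (this l s).2
    rw [sz_prod]
    omega
  refine (PT.headD (PT.snd (PT.foldl (s := fun _ s a => getDStep s a) (b := fun c => (n c, []))
    hl (by fun_prop) hs (u := fun c => 4 * sz (n c) + 1 + (1 + sz (l c)) + 1) (by fun_prop)
    fun c l₁ l₂ e => ?_)) hd).congr fun c => (foldl_getDStep _ _ _).symm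
  refine (hb l₁ (n c, [])).trans ?_
  have h1 : sz l₁ ≤ sz (l c) := by rw [e]; exact sz_sublist (List.sublist_append_left _ _)
  have h2 : sz ([] : List α) = 1 := sz_nil
  dsimp only
  omega

theorem natAbs_sum_lt (l : List ℤ) : l.sum.natAbs < 2 ^ sz l := by
  induction l with
  | nil => exact Nat.one_lt_two_pow (n := sz ([] : List ℤ)) (sz_pos _).ne' |>.trans_le' (by simp)
  | cons a l ih =>
    rw [List.sum_cons, sz_cons]
    have h1 := natAbs_lt_two_pow_sz a
    have h2 := Int.natAbs_add_le a l.sum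
    have h3 : 2 ^ sz a ≤ 2 ^ (sz a + sz l) := Nat.pow_le_pow_right two_pos (by omega)
    have h4 : 2 ^ sz l ≤ 2 ^ (sz a + sz l) := Nat.pow_le_pow_right two_pos (by omega)
    rw [pow_succ]
    omega

@[fun_prop]
theorem PT.sum {l : γ → List ℤ} (hl : PT l) : PT fun c => (l c).sum := by
  have hs : PT fun p : γ × ℤ × ℤ => p.2.1 + p.2.2 := by fun_prop
  refine (PT.foldl (s := fun _ x y => x + y) hl (PT.const 0) hs (u := fun c => 8 * sz (l c) + 3)
    (by fun_prop) fun c l₁ l₂ e => ?_).congr fun c => List.sum_eq_foldl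
  rw [← List.sum_eq_foldl]
  refine sz_int_le ((natAbs_sum_lt l₁).trans_le (Nat.pow_le_pow_right two_pos ?_))
  rw [e]
  exact sz_sublist (List.sublist_append_left _ _)

/-- The square matrix with the given entries, as a list of rows. -/
def mkMat (n : ℕ) (f : ℕ → ℕ → ℤ) : List (List ℤ) :=
  (List.range n).map fun i => (List.range n).map fun j => f i j

/-- The entries of a matrix given as a list of rows. -/
def entry (L : List (List ℤ)) (i j : ℕ) : ℤ := (L.getD i []).getD j 0

/-- The entries of a product of matrices. -/
def mulEntry (n : ℕ) (L L' : List (List ℤ)) (i j : ℕ) : ℤ :=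
  ((List.range n).map fun k => entry L i k * entry L' k j).sum

/-- The trace of a matrix. -/
def traceList (n : ℕ) (L : List (List ℤ)) : ℤ := ((List.range n).map fun i => entry L i i).sum

/-- The list of rows of a matrix. -/
def ofMatrix {n : ℕ} (A : Matrix (Fin n) (Fin n) ℤ) : List (List ℤ) :=
  mkMat n fun i j => if h : i < n ∧ j < n then A ⟨i, h.1⟩ ⟨j, h.2⟩ else 0

/-- The matrix with a given list of rows. -/
def toMatrix (n : ℕ) (L : List (List ℤ)) : Matrix (Fin n) (Fin n) ℤ :=
  Matrix.of fun i j => entry L i j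

theorem mkMat_eq_ofMatrix (n : ℕ) (f : ℕ → ℕ → ℤ) :
    mkMat n f = ofMatrix (Matrix.of fun i j : Fin n => f i j) := by
  refine List.map_congr_left fun i hi => List.map_congr_left fun j hj => ?_
  dsimp only
  rw [dif_pos ⟨List.mem_range.1 hi, List.mem_range.1 hj⟩]
  rfl

theorem entry_mkMat {n : ℕ} (f : ℕ → ℕ → ℤ) {i j : ℕ} (hi : i < n) (hj : j < n) :
    entry (mkMat n f) i j = f i j := by
  simp [entry, mkMat, hi, hj]

theorem entry_ofMatrix {n : ℕ} (A : Matrix (Fin n) (Fin n) ℤ) (i j : Fin n) :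
    entry (ofMatrix A) i j = A i j := by
  rw [ofMatrix, entry_mkMat _ i.2 j.2, dif_pos ⟨i.2, j.2⟩]

theorem sum_map_range (n : ℕ) (f : ℕ → ℤ) :
    ((List.range n).map f).sum = ∑ i : Fin n, f i := by
  rw [← Finset.sum_range]
  rfl

theorem mulEntry_ofMatrix {n : ℕ} (A : Matrix (Fin n) (Fin n) ℤ) (L : List (List ℤ))
    (i j : Fin n) : mulEntry n (ofMatrix A) L i j = (A * toMatrix n L) i j := by
  rw [mulEntry, sum_map_range, mul_apply]
  refine Finset.sum_congr rfl fun k _ => ?_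
  rw [entry_ofMatrix]
  rfl

theorem traceList_ofMatrix {n : ℕ} (A : Matrix (Fin n) (Fin n) ℤ) :
    traceList n (ofMatrix A) = A.trace := by
  rw [traceList, sum_map_range, trace]
  exact Finset.sum_congr rfl fun k _ => entry_ofMatrix A k k

@[fun_prop]
theorem PT.entry {L : γ → List (List ℤ)} {i j : γ → ℕ} (hL : PT L) (hi : PT i) (hj : PT j) :
    PT fun c => entry (L c) (i c) (j c) := by unfold Complexity.entry; fun_prop

@[fun_prop]
theorem PT.mulEntry {B : γ → List α} {L L' : γ → List (List ℤ)} {i j : γ → ℕ} (hB : PT B)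
    (hL : PT L) (hL' : PT L') (hi : PT i) (hj : PT j) :
    PT fun c => mulEntry (B c).length (L c) (L' c) (i c) (j c) := by
  unfold Complexity.mulEntry; fun_prop

@[fun_prop]
theorem PT.traceList {B : γ → List α} {L : γ → List (List ℤ)} (hB : PT B)
    (hL : PT L) : PT fun c => traceList (B c).length (L c) := by
  unfold Complexity.traceList; fun_prop

@[fun_prop]
theorem PT.mkMat {B : γ → List α} {f : γ → ℕ → ℕ → ℤ} (hB : PT B)
    (hf : PT fun p : γ × ℕ × ℕ => f p.1 p.2.1 p.2.2) :
    PT fun c => mkMat (B c).length (f c) := by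
  have hf' : PT fun p : (γ × ℕ) × ℕ => f p.1.1 p.1.2 p.2 :=
    hf.comp (f := fun p : (γ × ℕ) × ℕ => (p.1.1, p.1.2, p.2)) (by fun_prop)
  unfold Complexity.mkMat
  fun_prop

/-- The combination of matrices occurring in the Faddeev–LeVerrier iteration. -/
def flCombine (n k : ℕ) (A : List (List ℤ)) (t : ℤ) : List (List ℤ) :=
  mkMat n fun i j => k * entry A i j - bif decide (i = j) then t else 0

/-- The product of two matrices given as lists of rows. -/
def mulList (n : ℕ) (L L' : List (List ℤ)) : List (List ℤ) := mkMat n (mulEntry n L L')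

/-- The identity matrix. -/
def oneList (n : ℕ) : List (List ℤ) := mkMat n fun i j => bif decide (i = j) then 1 else 0

/-- One step of the Faddeev–LeVerrier iteration. -/
def flStep (B : List (List ℤ)) (s : ℕ × List (List ℤ)) : ℕ × List (List ℤ) :=
  (s.1 + 1, flCombine B.length (s.1 + 1) (mulList B.length s.2 B)
    (traceList B.length (mulList B.length s.2 B)))

/-- The result of the Faddeev–LeVerrier iteration. -/
def flLast (B : List (List ℤ)) : List (List ℤ) :=
  (B.tail.foldl (fun s _ => flStep B s) (0, oneList B.length)).2

/-- A multiple of the determinant of a matrix. -/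
def scaledDet (B : List (List ℤ)) : ℤ := traceList B.length (mulList B.length (flLast B) B)

/-- The first component of the solution of a linear system, multiplied by `scaledDet`. -/
def scaledSol (B : List (List ℤ)) (b : List ℤ) : ℤ :=
  B.length * ((List.range B.length).map fun j => entry (flLast B) 0 j * b.getD j 0).sum

theorem mulList_ofMatrix {n : ℕ} (A : Matrix (Fin n) (Fin n) ℤ) (L : List (List ℤ)) :
    mulList n (ofMatrix A) L = ofMatrix (A * toMatrix n L) := by
  rw [mulList, mkMat_eq_ofMatrix]
  congr 1
  ext i j
  exact mulEntry_ofMatrix A L i j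

theorem flStep_faddeev (B : List (List ℤ)) (k : ℕ) :
    flStep B (k, ofMatrix (faddeev (toMatrix B.length B) k)) =
      (k + 1, ofMatrix (faddeev (toMatrix B.length B) (k + 1))) := by
  rw [flStep, mulList_ofMatrix, traceList_ofMatrix, flCombine, mkMat_eq_ofMatrix]
  congr 2
  ext i j
  rw [of_apply, entry_ofMatrix, faddeev, Matrix.sub_apply, Matrix.smul_apply, Matrix.smul_apply,
    one_apply]
  by_cases h : i = j
  · simp [h]
  · simp [h, Fin.val_inj]

theorem oneList_eq (n : ℕ) : oneList n = ofMatrix (1 : Matrix (Fin n) (Fin n) ℤ) := by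
  rw [oneList, mkMat_eq_ofMatrix]
  congr 1
  ext i j
  rw [of_apply, one_apply]
  by_cases h : i = j
  · simp [h]
  · simp [h, Fin.val_inj]

omit [Enc α] in
theorem foldl_flStep (B : List (List ℤ)) (l : List α) :
    l.foldl (fun s _ => flStep B s) (0, oneList B.length) =
      (l.length, ofMatrix (faddeev (toMatrix B.length B) l.length)) := by
  induction l using List.reverseRecOn with
  | nil => rw [oneList_eq]; rfl
  | append_singleton l a ih =>
    rw [List.foldl_append, ih, List.foldl_cons, List.foldl_nil, flStep_faddeev,
      List.length_append, List.length_singleton]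

theorem flLast_eq (B : List (List ℤ)) :
    flLast B = ofMatrix (faddeev (toMatrix B.length B) (B.length - 1)) := by
  rw [flLast, foldl_flStep, List.length_tail]

theorem scaledDet_eq_zero_iff {B : List (List ℤ)} (h : B ≠ []) :
    scaledDet B = 0 ↔ (toMatrix B.length B).det = 0 := by
  have : NeZero B.length := ⟨by simpa using h⟩
  have h1 := trace_faddeev_mul (toMatrix B.length B)
  rw [Fintype.card_fin] at h1
  rw [scaledDet, flLast_eq, mulList_ofMatrix, traceList_ofMatrix, h1]
  simp [Nat.factorial_ne_zero]

theorem scaledSol_eq {B : List (List ℤ)} (h : B ≠ []) {b : List ℤ} {x : Fin B.length → ℝ}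
    (hx : ∀ i : Fin B.length, ∑ j : Fin B.length, (entry B i j : ℝ) * x j = b.getD i 0) :
    (scaledSol B b : ℝ) = scaledDet B * x ⟨0, List.length_pos_of_ne_nil h⟩ := by
  have : NeZero B.length := ⟨by simpa using h⟩
  have h1 := faddeev_mul (toMatrix B.length B)
  rw [Fintype.card_fin] at h1
  rw [scaledSol, scaledDet, flLast_eq, mulList_ofMatrix, traceList_ofMatrix, sum_map_range]
  set A := toMatrix B.length B
  set M := faddeev A (B.length - 1)
  set i : Fin B.length := ⟨0, List.length_pos_of_ne_nil h⟩
  have h2 : ∀ j, (B.length : ℝ) * ∑ k, (M i k : ℝ) * (A k j : ℝ) =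
      ((M * A).trace : ℝ) * if i = j then 1 else 0 := by
    intro j
    have := congrArg (fun z : ℤ => (z : ℝ)) (congrFun (congrFun h1 i) j)
    simp only [Matrix.smul_apply, mul_apply, one_apply, smul_eq_mul] at this
    push_cast at this
    exact this
  have h3 : ∀ k : Fin B.length, entry (ofMatrix M) 0 k = M i k := fun k => entry_ofMatrix M i k
  simp only [h3]
  push_cast
  calc (B.length : ℝ) * ∑ k : Fin B.length, (M i k : ℝ) * (b.getD k 0 : ℝ)
      = (B.length : ℝ) * ∑ k : Fin B.length, (M i k : ℝ) * ∑ j, (A k j : ℝ) * x j := by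
        congr 1
        exact Finset.sum_congr rfl fun k _ => by rw [← hx k]; rfl
    _ = ∑ j, ((B.length : ℝ) * ∑ k, (M i k : ℝ) * (A k j : ℝ)) * x j := by
        simp only [Finset.mul_sum, Finset.sum_mul]
        rw [Finset.sum_comm]
        exact Finset.sum_congr rfl fun _ _ => Finset.sum_congr rfl fun _ _ => by ring
    _ = _ := by
        simp only [h2, mul_assoc]
        rw [← Finset.mul_sum]
        simp

theorem sz_ofMatrix_le {n k : ℕ} {A : Matrix (Fin n) (Fin n) ℤ}
    (h : ∀ i j, (A i j).natAbs < 2 ^ k) :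
    sz (ofMatrix A) ≤ n * (n * (8 * k + 4) + 2) + 1 := by
  refine (sz_le_of_forall (m := n * (8 * k + 3 + 1) + 1) fun r hr => ?_).trans (by simp [mkMat, ofMatrix])
  obtain ⟨i, hi, rfl⟩ := List.mem_map.1 hr
  refine (sz_le_of_forall (m := 8 * k + 3) fun z hz => ?_).trans (by simp)
  obtain ⟨j, hj, rfl⟩ := List.mem_map.1 hz
  refine sz_int_le ?_
  dsimp only
  rw [dif_pos ⟨List.mem_range.1 hi, List.mem_range.1 hj⟩]
  exact h _ _

theorem natAbs_sum_le {n m : ℕ} {f : Fin n → ℤ} (h : ∀ i, (f i).natAbs ≤ m) :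
    (∑ i, f i).natAbs ≤ n * m := by
  refine (Int.natAbs_sum_le _ _).trans ((Finset.sum_le_card_nsmul _ _ m fun i _ => h i).trans ?_)
  simp

theorem natAbs_mul_apply_le {n m β : ℕ} {M A : Matrix (Fin n) (Fin n) ℤ}
    (hM : ∀ i j, (M i j).natAbs ≤ m) (hA : ∀ i j, (A i j).natAbs ≤ β) (i j : Fin n) :
    ((M * A) i j).natAbs ≤ n * (m * β) := by
  rw [mul_apply]
  refine natAbs_sum_le fun k => ?_
  rw [Int.natAbs_mul]
  exact Nat.mul_le_mul (hM i k) (hA k j)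

theorem natAbs_faddeev_le {n β : ℕ} {A : Matrix (Fin n) (Fin n) ℤ}
    (hA : ∀ i j, (A i j).natAbs ≤ β) {k : ℕ} (hk : k < n) (i j : Fin n) :
    (faddeev A k i j).natAbs ≤ (2 * n * n * β) ^ k := by
  induction k generalizing i j with
  | zero =>
    rw [faddeev, one_apply]
    split_ifs <;> simp
  | succ k ih =>
    have h1 := natAbs_mul_apply_le (ih (by omega)) hA
    have h2 : ((faddeev A k * A).trace).natAbs ≤ n * (n * ((2 * n * n * β) ^ k * β)) :=
      natAbs_sum_le fun i => h1 i i
    rw [faddeev, Matrix.sub_apply, Matrix.smul_apply, Matrix.smul_apply, one_apply, pow_succ]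
    refine (Int.natAbs_sub_le _ _).trans ?_
    rw [smul_eq_mul, smul_eq_mul, Int.natAbs_mul, Int.natAbs_mul]
    have h3 : (if i = j then (1 : ℤ) else 0).natAbs ≤ 1 := by split_ifs <;> simp
    calc _ ≤ n * (n * ((2 * n * n * β) ^ k * β)) + n * (n * ((2 * n * n * β) ^ k * β)) * 1 :=
          Nat.add_le_add (Nat.mul_le_mul (by simp; omega) (h1 i j)) (Nat.mul_le_mul h2 h3)
      _ = _ := by ring

theorem natAbs_entry_lt (B : List (List ℤ)) (i j : ℕ) : (entry B i j).natAbs < 2 ^ (sz B + 4) := by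
  refine (natAbs_lt_two_pow_sz _).trans_le (Nat.pow_le_pow_right two_pos ?_)
  have h1 := sz_getD_le (B.getD i []) j (0 : ℤ)
  have h2 := sz_getD_le B i []
  have h3 : sz (0 : ℤ) = 3 := by
    change sz (0 : ℕ) + sz (0 : ℕ) + 1 = 3
    rw [sz_zero]
  rw [sz_nil] at h2
  rw [entry]
  omega

/-- The intermediate results of the Faddeev–LeVerrier iteration have polynomial size. -/
theorem sz_faddeev_le (B : List (List ℤ)) {k : ℕ} (hk : k < B.length) :
    sz (ofMatrix (faddeev (toMatrix B.length B) k)) ≤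
      sz B * (sz B * (8 * ((3 * sz B + 5) * sz B + 1) + 4) + 2) + 1 := by
  have hn := length_lt_sz B
  refine (sz_ofMatrix_le (k := (3 * sz B + 5) * sz B + 1) fun i j => ?_).trans (by gcongr)
  refine (natAbs_faddeev_le (β := 2 ^ (sz B + 4)) (fun i j => (natAbs_entry_lt B i j).le) hk
    i j).trans_lt ?_
  rw [pow_succ _ ((3 * sz B + 5) * sz B), pow_mul]
  have h1 : 2 * B.length * B.length * 2 ^ (sz B + 4) ≤ 2 ^ (3 * sz B + 5) := by
    have h2 : B.length ≤ 2 ^ sz B := hn.le.trans Nat.lt_two_pow_self.le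
    calc _ ≤ 2 * 2 ^ sz B * 2 ^ sz B * 2 ^ (sz B + 4) := by gcongr
      _ = _ := by ring
  calc _ ≤ (2 ^ (3 * sz B + 5)) ^ k := Nat.pow_le_pow_left h1 k
    _ ≤ (2 ^ (3 * sz B + 5)) ^ sz B := Nat.pow_le_pow_right (by positivity) (by omega)
    _ < _ := by
      have : 0 < (2 ^ (3 * sz B + 5)) ^ sz B := by positivity
      omega

@[fun_prop]
theorem PT.mulList {B : γ → List α} {L L' : γ → List (List ℤ)} (hB : PT B) (hL : PT L)
    (hL' : PT L') : PT fun c => mulList (B c).length (L c) (L' c) := by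
  unfold Complexity.mulList
  exact PT.mkMat (f := fun c i j => Complexity.mulEntry (B c).length (L c) (L' c) i j) hB
    (PT.mulEntry (B := fun p : γ × ℕ × ℕ => B p.1) (by fun_prop) (by fun_prop) (by fun_prop)
      (by fun_prop) (by fun_prop))

@[fun_prop]
theorem PT.oneList {B : γ → List α} (hB : PT B) : PT fun c => oneList (B c).length := by
  unfold Complexity.oneList
  exact PT.mkMat hB (by fun_prop)

theorem PT.flStep : PT fun p : List (List ℤ) × ℕ × List (List ℤ) => flStep p.1 p.2 := by
  have h1 : PT fun p : List (List ℤ) × ℕ × List (List ℤ) =>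
      Complexity.mulList p.1.length p.2.2 p.1 := by fun_prop
  have h2 : PT fun p : List (List ℤ) × ℕ × List (List ℤ) =>
      Complexity.traceList p.1.length (Complexity.mulList p.1.length p.2.2 p.1) := by fun_prop
  unfold Complexity.flStep flCombine
  refine PT.prodMk (by fun_prop) (PT.mkMat (by fun_prop) ?_)
  have h3 : PT fun q : (List (List ℤ) × ℕ × List (List ℤ)) × ℕ × ℕ =>
      Complexity.entry (Complexity.mulList q.1.1.length q.1.2.2 q.1.1) q.2.1 q.2.2 := by fun_prop
  have h4 : PT fun q : (List (List ℤ) × ℕ × List (List ℤ)) × ℕ × ℕ =>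
      Complexity.traceList q.1.1.length (Complexity.mulList q.1.1.length q.1.2.2 q.1.1) := by
    fun_prop
  fun_prop

@[fun_prop]
theorem PT.flLast {B : γ → List (List ℤ)} (hB : PT B) : PT fun c => flLast (B c) := by
  have : PT fun B => Complexity.flLast B := by
    unfold Complexity.flLast
    have hs : PT fun p : List (List ℤ) × (ℕ × List (List ℤ)) × List ℤ =>
        Complexity.flStep p.1 p.2.1 :=
      PT.flStep.comp (f := fun p : List (List ℤ) × (ℕ × List (List ℤ)) × List ℤ =>
        (p.1, p.2.1)) (by fun_prop)
    refine PT.snd (PT.foldl (s := fun B s _ => Complexity.flStep B s) (by fun_prop)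
      (by fun_prop) hs (u := fun B => (4 * sz B + 1) +
        (sz B * (sz B * (8 * ((3 * sz B + 5) * sz B + 1) + 4) + 2) + 10) + 1) ?_ ?_)
    · have := PB.id (α := List (List ℤ))
      fun_prop
    · intro B l₁ l₂ e
      rw [foldl_flStep, sz_prod]
      have h1 : l₁.length ≤ B.length - 1 := by
        rw [← List.length_tail, e, List.length_append]
        omega
      have h2 : sz l₁.length ≤ 4 * sz B + 1 := sz_le_of_le_length (by omega)
      have h3 : sz (ofMatrix (faddeev (toMatrix B.length B) l₁.length)) ≤ 
          sz B * (sz B * (8 * ((3 * sz B + 5) * sz B + 1) + 4) + 2) + 10 := by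
        rcases Nat.eq_zero_or_pos B.length with h | h
        · have : ofMatrix (faddeev (toMatrix B.length B) l₁.length) = [] := by
            rw [ofMatrix, Complexity.mkMat, h]
            rfl
          rw [this, sz_nil]
          omega
        · have := sz_faddeev_le B (k := l₁.length) (by omega)
          omega
      dsimp only
      omega
  exact this.comp hB

@[fun_prop]
theorem PT.scaledDet {B : γ → List (List ℤ)} (hB : PT B) : PT fun c => scaledDet (B c) := by
  unfold Complexity.scaledDet; fun_prop

@[fun_prop]
theorem PT.scaledSol {B : γ → List (List ℤ)} {b : γ → List ℤ} (hB : PT B) (hb : PT b) :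
    PT fun c => scaledSol (B c) (b c) := by
  unfold Complexity.scaledSol; fun_prop

end Complexity

/-! ### The algorithm on codes of nets -/

namespace Complexity

open Enc

variable {α β γ δ : Type} [Enc α] [Enc β] [Enc γ] [Enc δ]

/-- The maximum of a list (`0` for the empty list). -/
def maxL (l : List ℕ) : ℕ := l.foldl max 0

theorem maxL_le_iff {l : List ℕ} {b : ℕ} : maxL l ≤ b ↔ ∀ a ∈ l, a ≤ b := by
  have : ∀ (l : List ℕ) (m : ℕ), l.foldl max m ≤ b ↔ m ≤ b ∧ ∀ a ∈ l, a ≤ b := by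
    intro l
    induction l with
    | nil => simp
    | cons a l ih => intro m; rw [List.foldl_cons, ih]; simp [and_assoc]
  rw [maxL, this]
  simp

theorem le_maxL {l : List ℕ} {a : ℕ} (h : a ∈ l) : a ≤ maxL l := maxL_le_iff.1 le_rfl a h

@[fun_prop]
theorem PT.maxL {l : γ → List ℕ} (hl : PT l) : PT fun c => maxL (l c) := by
  have hs : PT fun p : γ × ℕ × ℕ => Max.max p.2.1 p.2.2 := by fun_prop
  refine PT.foldl (s := fun _ x y => Max.max x y) hl (PT.const 0) hs (u := fun c => 4 * sz (l c) + 1)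
    (by fun_prop) fun c l₁ l₂ e => ?_
  refine sz_le_of_lt_two_pow (lt_of_le_of_lt ((maxL_le_iff (b := 2 ^ sz (l c) - 1)).2
    fun a ha => ?_) (Nat.sub_lt (by positivity) one_pos))
  have h1 := sz_mem (l := l c) (a := a) (by rw [e]; exact List.mem_append_left _ ha)
  have h2 := (lt_two_pow_sz a).trans_le (Nat.pow_le_pow_right two_pos h1.le)
  omega

/-- The code of a transition: preset, postset, numerator and denominator of the weight,
duration. -/
abbrev TransCode : Type := List Bool × List Bool × ℕ × ℕ × ℕ × Unit

/-- The code of a net: the initial and the final marking, and the list of transitions. -/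
abbrev NetCode : Type := List Bool × List Bool × List TransCode × Unit

namespace TransCode

/-- the preset -/
def pre (u : TransCode) : List Bool := u.1
/-- the postset -/
def post (u : TransCode) : List Bool := u.2.1
/-- the numerator of the weight -/
def num (u : TransCode) : ℕ := u.2.2.1
/-- the denominator of the weight -/
def den (u : TransCode) : ℕ := u.2.2.2.1
/-- the duration -/
def dur (u : TransCode) : ℕ := u.2.2.2.2.1

end TransCode

@[fun_prop]
theorem PT.pre {u : γ → TransCode} (hu : PT u) : PT fun c => (u c).pre := hu.fst
@[fun_prop]
theorem PT.post {u : γ → TransCode} (hu : PT u) : PT fun c => (u c).post := hu.snd.fst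
@[fun_prop]
theorem PT.num {u : γ → TransCode} (hu : PT u) : PT fun c => (u c).num := hu.snd.snd.fst
@[fun_prop]
theorem PT.den {u : γ → TransCode} (hu : PT u) : PT fun c => (u c).den := hu.snd.snd.snd.fst
@[fun_prop]
theorem PT.dur {u : γ → TransCode} (hu : PT u) : PT fun c => (u c).dur := hu.snd.snd.snd.snd.fst

/-- The code of a transition with empty preset and postset, used as a default value. -/
def dummy : TransCode := ([], [], 0, 0, 0, ())

/-- The maximal entry of a state on a set of places. States list the entries of a timestamp, with
`0` for `⊥` and `k + 1` for `k`. -/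
def supVal (y : List ℕ) (s : List Bool) : ℕ :=
  maxL ((List.range y.length).map fun k => bif s.getD k false then y.getD k 0 else 0)

/-- Whether all places of a set are marked. -/
def isEnabled (y : List ℕ) (s : List Bool) : Bool :=
  (List.range y.length).all fun k => !s.getD k false || !decide (y.getD k 0 = 0)

/-- Whether two sets of places have a common element. -/
def meets (y : List ℕ) (s s' : List Bool) : Bool :=
  (List.range y.length).any fun k => s.getD k false && s'.getD k false

/-- The conflict set of a transition. -/
def confl (L : List TransCode) (y : List ℕ) (u : TransCode) : List TransCode :=
  L.filter fun v => isEnabled y u.pre && (isEnabled y v.pre && meets y u.pre v.pre)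

/-- The starting time (plus one) of a set of transitions. -/
def startVal (C : List TransCode) (y : List ℕ) : ℕ := maxL (C.map fun v => supVal y v.pre)

/-- The enabled transitions whose conflict sets have the earliest starting time. -/
def earliest (L : List TransCode) (y : List ℕ) : List TransCode :=
  L.filter fun u => isEnabled y u.pre && L.all fun v =>
    !isEnabled y v.pre || decide (startVal (confl L y u) y ≤ startVal (confl L y v) y)

/-- A conflict set with the earliest starting time (empty if there is none). -/
def choice (L : List TransCode) (y : List ℕ) : List TransCode :=
  confl L y ((earliest L y).headD dummy)

/-- The abstract successor of a state. -/
def succState (y : List ℕ) (u : TransCode) : List ℕ :=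
  (List.range y.length).map fun k =>
    bif u.post.getD k false then u.dur + 1
    else bif u.pre.getD k false || decide (y.getD k 0 = 0) then 0
    else max 1 (y.getD k 0 - (supVal y u.pre - 1))

/-- Equality of states with the same number of entries. -/
def eqState (y z : List ℕ) : Bool :=
  (List.range y.length).all fun k => decide (y.getD k 0 = z.getD k 0)

/-- The successors of a list of states that are not in the list. -/
def newStates (L : List TransCode) (S : List (List ℕ)) : List (List ℕ) :=
  (S.flatMap fun y => (choice L y).map fun u => succState y u).filter fun z =>
    !S.any fun y => eqState y z

/-- Extends a list of states by at most one successor. -/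
def explore (L : List TransCode) (S : List (List ℕ)) : List (List ℕ) :=
  bif (newStates L S).isEmpty then S else S ++ [(newStates L S).headD []]

/-- The state of the initial marking. -/
def initState (s : List Bool) : List ℕ := s.map fun b => bif b then 1 else 0

/-- The states found by as many exploration steps as the second argument has elements. -/
def exploreAll (N : NetCode) (clock : List Unit) : List (List ℕ) :=
  clock.foldl (fun S _ => explore N.2.2.1 S) [initState N.1]

/-- Whether exactly the places of a set are marked. -/
def isFinal (o : List Bool) (y : List ℕ) : Bool :=
  (List.range y.length).all fun k => xor (o.getD k false) (decide (y.getD k 0 = 0))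

/-- The total weight of a list of transitions with integral weights. -/
def totalWeight (C : List TransCode) : ℤ := (C.map fun u => (u.num : ℤ)).sum

/-- The coefficients of the linear system, multiplied by the total weight of the conflict set. -/
def coeff (L : List TransCode) (o : List Bool) (y z : List ℕ) : ℤ :=
  bif isFinal o y then bif eqState y z then 1 else 0
  else (bif eqState y z then totalWeight (choice L y) else 0) -
    ((choice L y).map fun u => bif eqState (succState y u) z then (u.num : ℤ) else 0).sum

/-- The right-hand sides of the linear system. -/
def rhs (L : List TransCode) (o : List Bool) (y : List ℕ) : ℤ :=
  bif isFinal o y then ((maxL y - 1 : ℕ) : ℤ)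
  else totalWeight (choice L y) * ((startVal (choice L y) y - 1 : ℕ) : ℤ)

/-- The matrix of the linear system. -/
def coeffs (N : NetCode) (S : List (List ℕ)) : List (List ℤ) :=
  S.map fun y => S.map fun z => coeff N.2.2.1 N.2.1 y z

/-- The result computed from a list of states: `nil` if the matrix is singular, else the quotient
of two natural numbers. -/
def result (N : NetCode) (S : List (List ℕ)) : Data :=
  bif decide ((scaledDet (coeffs N S)).natAbs = 0) then Data.nil
  else enc ((scaledSol (coeffs N S) (S.map fun y => rhs N.2.2.1 N.2.1 y)).natAbs,
    (scaledDet (coeffs N S)).natAbs)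

/-- The product of a list of natural numbers. -/
def prodL (l : List ℕ) : ℕ := l.foldl (fun x y => x * y) 1

/-- The weight of the `k`-th transition, multiplied by the denominators of all weights. -/
def intWeight (L : List TransCode) (k : ℕ) : ℕ :=
  (L.getD k dummy).num *
    prodL ((List.range L.length).map fun j => bif decide (j = k) then 1 else (L.getD j dummy).den)

/-- The net with integral weights proportional to the given ones. -/
def normalize (N : NetCode) : NetCode :=
  (N.1, N.2.1, (List.range N.2.2.1.length).map fun k =>
    ((N.2.2.1.getD k dummy).pre, (N.2.2.1.getD k dummy).post, intWeight N.2.2.1 k, 1,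
      (N.2.2.1.getD k dummy).dur, ()), ())

@[fun_prop]
theorem PT.supVal {y : γ → List ℕ} {s : γ → List Bool} (hy : PT y) (hs : PT s) :
    PT fun c => supVal (y c) (s c) := by unfold Complexity.supVal; fun_prop

@[fun_prop]
theorem PT.isEnabled {y : γ → List ℕ} {s : γ → List Bool} (hy : PT y) (hs : PT s) :
    PT fun c => isEnabled (y c) (s c) := by unfold Complexity.isEnabled; fun_prop

@[fun_prop]
theorem PT.meets {y : γ → List ℕ} {s s' : γ → List Bool} (hy : PT y) (hs : PT s) (hs' : PT s') :
    PT fun c => meets (y c) (s c) (s' c) := by unfold Complexity.meets; fun_prop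

@[fun_prop]
theorem PT.confl {L : γ → List TransCode} {y : γ → List ℕ} {u : γ → TransCode} (hL : PT L)
    (hy : PT y) (hu : PT u) : PT fun c => confl (L c) (y c) (u c) := by
  unfold Complexity.confl; fun_prop

@[fun_prop]
theorem PT.startVal {L : γ → List TransCode} {y : γ → List ℕ} (hL : PT L) (hy : PT y) :
    PT fun c => startVal (L c) (y c) := by unfold Complexity.startVal; fun_prop

@[fun_prop]
theorem PT.earliest {L : γ → List TransCode} {y : γ → List ℕ} (hL : PT L) (hy : PT y) :
    PT fun c => earliest (L c) (y c) := by unfold Complexity.earliest; fun_prop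

@[fun_prop]
theorem PT.choice {L : γ → List TransCode} {y : γ → List ℕ} (hL : PT L) (hy : PT y) :
    PT fun c => choice (L c) (y c) := by unfold Complexity.choice; fun_prop

@[fun_prop]
theorem PT.succState {y : γ → List ℕ} {u : γ → TransCode} (hy : PT y) (hu : PT u) :
    PT fun c => succState (y c) (u c) := by unfold Complexity.succState; fun_prop

@[fun_prop]
theorem PT.eqState {y z : γ → List ℕ} (hy : PT y) (hz : PT z) :
    PT fun c => eqState (y c) (z c) := by unfold Complexity.eqState; fun_prop

@[fun_prop]
theorem PT.newStates {L : γ → List TransCode} {S : γ → List (List ℕ)} (hL : PT L) (hS : PT S) :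
    PT fun c => newStates (L c) (S c) := by unfold Complexity.newStates; fun_prop

@[fun_prop]
theorem PT.explore {L : γ → List TransCode} {S : γ → List (List ℕ)} (hL : PT L) (hS : PT S) :
    PT fun c => explore (L c) (S c) := by unfold Complexity.explore; fun_prop

@[fun_prop]
theorem PT.initState {s : γ → List Bool} (hs : PT s) : PT fun c => initState (s c) := by
  unfold Complexity.initState; fun_prop

@[fun_prop]
theorem PT.isFinal {o : γ → List Bool} {y : γ → List ℕ} (ho : PT o) (hy : PT y) :
    PT fun c => isFinal (o c) (y c) := by unfold Complexity.isFinal; fun_prop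

@[fun_prop]
theorem PT.totalWeight {C : γ → List TransCode} (hC : PT C) : PT fun c => totalWeight (C c) := by
  unfold Complexity.totalWeight; fun_prop

@[fun_prop]
theorem PT.coeff {L : γ → List TransCode} {o : γ → List Bool} {y z : γ → List ℕ} (hL : PT L)
    (ho : PT o) (hy : PT y) (hz : PT z) : PT fun c => coeff (L c) (o c) (y c) (z c) := by
  unfold Complexity.coeff; fun_prop

@[fun_prop]
theorem PT.rhs {L : γ → List TransCode} {o : γ → List Bool} {y : γ → List ℕ} (hL : PT L)
    (ho : PT o) (hy : PT y) : PT fun c => rhs (L c) (o c) (y c) := by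
  unfold Complexity.rhs; fun_prop

@[fun_prop]
theorem PT.coeffs {N : γ → NetCode} {S : γ → List (List ℕ)} (hN : PT N) (hS : PT S) :
    PT fun c => coeffs (N c) (S c) := by unfold Complexity.coeffs; fun_prop

@[fun_prop]
theorem PT.natAbs {z : γ → ℤ} (hz : PT z) : PT fun c => (z c).natAbs :=
  (hz.toNat.add hz.intNeg.toNat).congr fun c => by omega

@[fun_prop]
theorem PT.result {N : γ → NetCode} {S : γ → List (List ℕ)} (hN : PT N) (hS : PT S) :
    PT fun c => result (N c) (S c) := by unfold Complexity.result; fun_prop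

theorem prodL_lt (l : List ℕ) : prodL l < 2 ^ sz l := by
  have : ∀ (l : List ℕ) (m : ℕ), l.foldl (fun x y => x * y) m = m * prodL l := by
    intro l
    induction l with
    | nil => simp [prodL]
    | cons a l ih =>
      intro m
      rw [prodL, List.foldl_cons, List.foldl_cons, ih, ih, mul_assoc, one_mul]
  induction l with
  | nil => exact Nat.one_lt_two_pow (n := sz ([] : List ℕ)) (sz_pos _).ne'
  | cons a l ih =>
    rw [prodL, List.foldl_cons, this, one_mul, sz_cons]
    have h1 := lt_two_pow_sz a
    calc _ < 2 ^ sz a * 2 ^ sz l := Nat.mul_lt_mul'' h1 ih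
      _ ≤ _ := by rw [← pow_add]; exact Nat.pow_le_pow_right two_pos (by omega)

@[fun_prop]
theorem PT.prodL {l : γ → List ℕ} (hl : PT l) : PT fun c => prodL (l c) := by
  have hs : PT fun p : γ × ℕ × ℕ => p.2.1 * p.2.2 := by fun_prop
  refine PT.foldl (s := fun _ x y => x * y) hl (PT.const 1) hs (u := fun c => 4 * sz (l c) + 1)
    (by fun_prop) fun c l₁ l₂ e => ?_
  refine sz_le_of_lt_two_pow ((prodL_lt l₁).trans_le (Nat.pow_le_pow_right two_pos ?_))
  rw [e]
  exact sz_sublist (List.sublist_append_left _ _)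

@[fun_prop]
theorem PT.intWeight {L : γ → List TransCode} {k : γ → ℕ} (hL : PT L) (hk : PT k) :
    PT fun c => intWeight (L c) (k c) := by unfold Complexity.intWeight; fun_prop

@[fun_prop]
theorem PT.normalize {N : γ → NetCode} (hN : PT N) : PT fun c => normalize (N c) := by
  unfold Complexity.normalize; fun_prop

/-- All states found by the exploration have the same length and small entries, and their number
grows by at most one in each step. -/
theorem explore_bounded {L : List TransCode} {S : List (List ℕ)} {a B : ℕ} (hB : 1 ≤ B)
    (hL : ∀ u ∈ L, u.dur + 1 ≤ B) (hS : ∀ y ∈ S, y.length = a ∧ ∀ v ∈ y, v ≤ B) :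
    (∀ y ∈ explore L S, y.length = a ∧ ∀ v ∈ y, v ≤ B) ∧
      (explore L S).length ≤ S.length + 1 := by
  rw [explore]
  cases h : (newStates L S) with
  | nil => exact ⟨hS, Nat.le_succ _⟩
  | cons z l =>
    refine ⟨fun y hy => ?_, by simp⟩
    rcases List.mem_append.1 hy with hy | hy
    · exact hS y hy
    · have hz : z ∈ newStates L S := by rw [h]; exact List.mem_cons_self
      have : y = z := by simpa using hy
      rw [this]
      obtain ⟨y', hy', hz⟩ := List.mem_flatMap.1 (List.mem_filter.1 hz).1
      obtain ⟨u, hu, rfl⟩ := List.mem_map.1 hz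
      have hu : u ∈ L := (List.mem_filter.1 hu).1
      refine ⟨by rw [succState, List.length_map, List.length_range, (hS y' hy').1], ?_⟩
      intro v hv
      obtain ⟨k, hk, rfl⟩ := List.mem_map.1 hv
      rw [List.mem_range] at hk
      have hyk : y'.getD k 0 ≤ B := by
        rw [List.getD_eq_getElem _ _ hk]
        exact (hS y' hy').2 _ (List.getElem_mem hk)
      have := hL u hu
      cases u.post.getD k false
      · cases u.pre.getD k false || decide (y'.getD k 0 = 0)
        · exact max_le hB ((Nat.sub_le _ _).trans hyk)
        · exact Nat.zero_le _
      · exact this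

theorem exploreAll_bounded (N : NetCode) {B : ℕ} (hB : 1 ≤ B)
    (hL : ∀ u ∈ N.2.2.1, u.dur + 1 ≤ B) (clock : List Unit) :
    (∀ y ∈ exploreAll N clock, y.length = N.1.length ∧ ∀ v ∈ y, v ≤ B) ∧
      (exploreAll N clock).length ≤ clock.length + 1 := by
  induction clock using List.reverseRecOn with
  | nil =>
    refine ⟨fun y hy => ?_, le_rfl⟩
    have : y = initState N.1 := by simpa [exploreAll] using hy
    rw [this]
    refine ⟨List.length_map _, fun v hv => ?_⟩
    obtain ⟨b, _, rfl⟩ := List.mem_map.1 hv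
    cases b
    · exact Nat.zero_le _
    · exact hB
  | append_singleton l e ih =>
    have h := explore_bounded hB hL ih.1
    rw [exploreAll, List.foldl_append, List.foldl_cons, List.foldl_nil, List.length_append,
      List.length_singleton]
    exact ⟨h.1, h.2.trans (Nat.succ_le_succ ih.2)⟩

@[fun_prop]
theorem PT.exploreAll {N : γ → NetCode} {clock : γ → List Unit} (hN : PT N) (hc : PT clock) :
    PT fun c => exploreAll (N c) (clock c) := by
  have hs : PT fun p : γ × List (List ℕ) × Unit => Complexity.explore (N p.1).2.2.1 p.2.1 := by
    have : PT fun p : γ × List (List ℕ) × Unit => N p.1 := hN.comp (by fun_prop)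
    fun_prop
  let B : γ → ℕ := fun c => Complexity.maxL ((N c).2.2.1.map fun u => u.dur) + 1
  have hB : PT B := by fun_prop
  unfold Complexity.exploreAll
  refine PT.foldl (s := fun c S _ => Complexity.explore (N c).2.2.1 S) hc (by fun_prop) hs
    (u := fun c => (sz (clock c) + 1) * ((sz (N c).1 * (4 * sz (B c) + 1 + 1) + 1) + 1) + 1)
    (by fun_prop) fun c l₁ l₂ e => ?_
  obtain ⟨h1, h2⟩ := exploreAll_bounded (N c) (B := B c) (Nat.le_add_left _ _)
    (fun u hu => Nat.succ_le_succ (le_maxL (List.mem_map_of_mem hu))) l₁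
  refine (sz_le_of_forall (m := sz (N c).1 * (4 * sz (B c) + 1 + 1) + 1) fun y hy => ?_).trans ?_
  · obtain ⟨h3, h4⟩ := h1 y hy
    refine (sz_le_of_forall (m := 4 * sz (B c) + 1) fun v hv => sz_mono_nat (h4 v hv)).trans ?_
    rw [h3]
    gcongr
    exact (length_lt_sz _).le
  · refine Nat.succ_le_succ (Nat.mul_le_mul_right _ (h2.trans (Nat.succ_le_succ ?_)))
    have h5 := length_lt_sz (clock c)
    have h6 := congrArg List.length e
    rw [List.length_append] at h6
    omega

end Complexity

/-! ### Correctness of the operations on codes -/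

namespace Complexity

open Enc TPWN

variable {P T : Type*} [Fintype P] [DecidableEq P] [Fintype T] {a b : ℕ}

/-- The code of a set of places. -/
def setCode (eP : Fin a ≃ P) (A : Finset P) : List Bool := List.ofFn fun k => decide (eP k ∈ A)

/-- The code of an entry of a timestamp: `0` for `⊥` and `k + 1` for `k`. -/
def entryCode : WithBot ℕ → ℕ := WithBot.recBotCoe 0 fun k => k + 1

/-- The code of a timestamp. -/
def stateCode (eP : Fin a ≃ P) (x : P → WithBot ℕ) : List ℕ :=
  List.ofFn fun k => entryCode (x (eP k))

/-- The code of a transition with a given integral weight. -/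
def transCode (W : TPWN P T) (eP : Fin a ≃ P) (c : T → ℕ) (t : T) : TransCode :=
  (setCode eP (W.pre t), setCode eP (W.post t), c t, 1, W.dur t, ())

/-- The codes of the transitions in a set. -/
def transList (W : TPWN P T) (eP : Fin a ≃ P) (eT : Fin b ≃ T) (c : T → ℕ) (C : Finset T) :
    List TransCode := by
  classical exact ((List.ofFn eT).filter fun t => decide (t ∈ C)).map (transCode W eP c)

/-- The code of a net with given integral weights. -/
def netCode (W : TPWN P T) (eP : Fin a ≃ P) (eT : Fin b ≃ T) (c : T → ℕ) : NetCode :=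
  (setCode eP {W.i}, setCode eP {W.o}, transList W eP eT c Finset.univ, ())

theorem entryCode_le_iff {v : WithBot ℕ} {m : ℕ} : entryCode v ≤ m ↔ v < WithBot.some m := by
  induction v with
  | bot => simp [entryCode]
  | coe k => rw [WithBot.coe_lt_coe]; exact Nat.succ_le_iff

theorem entryCode_eq_zero_iff {v : WithBot ℕ} : entryCode v = 0 ↔ v = ⊥ := by
  induction v with
  | bot => simp [entryCode]
  | coe k => simp [entryCode]

theorem entryCode_injective : Function.Injective entryCode := by
  intro v w h
  induction v with
  | bot =>
    exact (entryCode_eq_zero_iff.1 h.symm).symm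
  | coe k =>
    induction w with
    | bot => exact entryCode_eq_zero_iff.1 h
    | coe l => exact congrArg _ (Nat.succ.inj h)

theorem entryCode_of_ne_bot {v : WithBot ℕ} (h : v ≠ ⊥) : entryCode v = v.unbotD 0 + 1 := by
  induction v with
  | bot => exact absurd rfl h
  | coe k => rfl

omit [Fintype P] [DecidableEq P] in
theorem length_stateCode (eP : Fin a ≃ P) (x : P → WithBot ℕ) : (stateCode eP x).length = a :=
  List.length_ofFn

theorem getD_ofFn {α : Type*} (f : Fin a → α) (k : Fin a) (d : α) :
    (List.ofFn f).getD k d = f k := by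
  rw [List.getD_eq_getElem _ _ (by simp), List.getElem_ofFn]

omit [Fintype P] in
theorem getD_setCode (eP : Fin a ≃ P) (A : Finset P) (k : Fin a) :
    (setCode eP A).getD k false = decide (eP k ∈ A) := getD_ofFn _ _ _

omit [Fintype P] [DecidableEq P] in
theorem getD_stateCode (eP : Fin a ≃ P) (x : P → WithBot ℕ) (k : Fin a) :
    (stateCode eP x).getD k 0 = entryCode (x (eP k)) := getD_ofFn _ _ _

omit [Fintype P] [DecidableEq P] in
theorem all_places (eP : Fin a ≃ P) (x : P → WithBot ℕ) (f : ℕ → Bool) {Q : P → Prop}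
    (h : ∀ k : Fin a, f k = true ↔ Q (eP k)) :
    (List.range (stateCode eP x).length).all f = true ↔ ∀ p, Q p := by
  rw [length_stateCode, List.all_eq_true]
  refine ⟨fun h' p => ?_, fun h' k hk => (h ⟨k, List.mem_range.1 hk⟩).2 (h' _)⟩
  have := (h (eP.symm p)).1 (h' _ (List.mem_range.2 (eP.symm p).2))
  rwa [Equiv.apply_symm_apply] at this

theorem isEnabled_code (eP : Fin a ≃ P) (x : P → WithBot ℕ) (A : Finset P) :
    isEnabled (stateCode eP x) (setCode eP A) = true ↔ A ⊆ supp x := by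
  rw [isEnabled, all_places eP x _ (Q := fun p => p ∈ A → p ∈ supp x)]
  · rfl
  · intro k
    rw [getD_setCode, getD_stateCode, mem_supp, ne_eq, ← entryCode_eq_zero_iff]
    simp [imp_iff_not_or]

omit [Fintype P] in
theorem meets_code (eP : Fin a ≃ P) (x : P → WithBot ℕ) (A A' : Finset P) :
    meets (stateCode eP x) (setCode eP A) (setCode eP A') = true ↔ ¬ Disjoint A A' := by
  rw [← not_iff_not, not_not, Finset.disjoint_left, Bool.not_eq_true, meets,
    List.any_eq_not_all_not, Bool.not_eq_false']
  rw [all_places eP x _ (Q := fun p => p ∈ A → p ∉ A')]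
  intro k
  rw [getD_setCode, getD_setCode]
  simp [imp_iff_not_or]

omit [Fintype P] in
theorem supVal_code (eP : Fin a ≃ P) (x : P → WithBot ℕ) (A : Finset P) :
    supVal (stateCode eP x) (setCode eP A) = entryCode (A.sup x) := by
  refine eq_of_forall_ge_iff fun m => ?_
  rw [supVal, maxL_le_iff, entryCode_le_iff, Finset.sup_lt_iff (WithBot.bot_lt_coe m)]
  simp only [List.mem_map, List.mem_range, length_stateCode, forall_exists_index, and_imp,
    forall_apply_eq_imp_iff₂]
  constructor
  · intro h p hp
    have := h (eP.symm p) (eP.symm p).2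
    rw [getD_setCode, getD_stateCode, Equiv.apply_symm_apply, decide_eq_true hp] at this
    exact entryCode_le_iff.1 this
  · intro h k hk
    have h1 := getD_setCode eP A ⟨k, hk⟩
    have h2 := getD_stateCode eP x ⟨k, hk⟩
    dsimp only at h1 h2
    rw [h1, h2]
    by_cases hp : eP ⟨k, hk⟩ ∈ A
    · rw [decide_eq_true hp]
      exact entryCode_le_iff.2 (h _ hp)
    · rw [decide_eq_false hp]
      exact Nat.zero_le _

omit [Fintype P] [DecidableEq P] in
theorem eqState_code (eP : Fin a ≃ P) (x z : P → WithBot ℕ) :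
    eqState (stateCode eP x) (stateCode eP z) = true ↔ x = z := by
  rw [eqState, all_places eP x _ (Q := fun p => x p = z p), funext_iff]
  intro k
  rw [getD_stateCode, getD_stateCode, decide_eq_true_iff, entryCode_injective.eq_iff]

theorem isFinal_code (eP : Fin a ≃ P) (x : P → WithBot ℕ) (A : Finset P) :
    isFinal (setCode eP A) (stateCode eP x) = true ↔ supp x = A := by
  rw [isFinal, all_places eP x _ (Q := fun p => p ∈ supp x ↔ p ∈ A), Finset.ext_iff]
  intro k
  rw [getD_stateCode, getD_setCode, mem_supp, ne_eq, ← entryCode_eq_zero_iff]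
  by_cases h1 : eP k ∈ A <;> by_cases h2 : entryCode (x (eP k)) = 0 <;> simp [h1, h2]

omit [DecidableEq P] in
theorem maxL_code (eP : Fin a ≃ P) (x : P → WithBot ℕ) :
    maxL (stateCode eP x) = entryCode (Finset.univ.sup x) := by
  refine eq_of_forall_ge_iff fun m => ?_
  rw [maxL_le_iff, entryCode_le_iff, Finset.sup_lt_iff (WithBot.bot_lt_coe m)]
  simp only [stateCode, List.mem_ofFn, forall_exists_index, forall_apply_eq_imp_iff,
    entryCode_le_iff, Finset.mem_univ, true_imp_iff]
  exact ⟨fun h p => by simpa using h (eP.symm p), fun h k => h _⟩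

omit [Fintype P] in
theorem initState_code (W : TPWN P T) (eP : Fin a ≃ P) :
    initState (setCode eP {W.i}) = stateCode eP W.timestampInit := by
  rw [initState, setCode, stateCode, List.map_ofFn]
  congr 1
  funext k
  rw [Function.comp_apply, timestampInit]
  by_cases h : eP k = W.i
  · rw [h, decide_eq_true (Finset.mem_singleton_self _), if_pos rfl]
    rfl
  · simp [h, entryCode]

theorem succState_code (W : TPWN P T) (eP : Fin a ≃ P) (c : T → ℕ) {x : P → WithBot ℕ} {t : T}
    (ht : W.pre t ⊆ supp x) :
    succState (stateCode eP x) (transCode W eP c t) = stateCode eP (W.absStep x t) := by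
  have hs := sup_pre_ne_bot' ht
  have h : ∀ k : Fin a, (bif (transCode W eP c t).post.getD k false
      then (transCode W eP c t).dur + 1
      else bif (transCode W eP c t).pre.getD k false || decide ((stateCode eP x).getD k 0 = 0)
      then 0
      else max 1 ((stateCode eP x).getD k 0 - (supVal (stateCode eP x)
        (transCode W eP c t).pre - 1))) = entryCode (W.absStep x t (eP k)) := by
    intro k
    change (bif (setCode eP (W.post t)).getD k false then W.dur t + 1
      else bif (setCode eP (W.pre t)).getD k false || decide ((stateCode eP x).getD k 0 = 0)
      then 0
      else max 1 ((stateCode eP x).getD k 0 - (supVal (stateCode eP x)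
        (setCode eP (W.pre t)) - 1))) = _
    rw [getD_setCode, getD_setCode, getD_stateCode, supVal_code, entryCode_of_ne_bot hs, absStep,
      upd]
    obtain ⟨s, hs⟩ := WithBot.ne_bot_iff_exists.1 hs
    rw [← hs]
    by_cases h1 : eP k ∈ W.post t
    · rw [if_pos h1, decide_eq_true h1]
      change W.dur t + 1 = s + W.dur t - s + 1
      omega
    rw [if_neg h1, decide_eq_false h1]
    by_cases h2 : eP k ∈ W.pre t
    · rw [if_pos h2, decide_eq_true h2]
      rfl
    rw [if_neg h2, decide_eq_false h2]
    generalize x (eP k) = v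
    induction v with
    | bot => rfl
    | coe v =>
      change max 1 (v + 1 - (s + 1 - 1)) = v - s + 1
      omega
  have hlen := length_stateCode eP x
  refine List.ext_getElem ?_ fun i h1 h2 => ?_
  · rw [succState, List.length_map, List.length_range, hlen, length_stateCode]
  · rw [length_stateCode] at h2
    simp only [succState, List.getElem_map, List.getElem_range]
    exact (h ⟨i, h2⟩).trans (by simp [stateCode])

omit [Fintype P] in
theorem mem_transList {W : TPWN P T} {eP : Fin a ≃ P} {eT : Fin b ≃ T} {c : T → ℕ}
    {C : Finset T} {u : TransCode} :
    u ∈ transList W eP eT c C ↔ ∃ t ∈ C, transCode W eP c t = u := by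
  classical
  rw [transList, List.mem_map]
  refine exists_congr fun t => ?_
  rw [List.mem_filter, decide_eq_true_iff, List.mem_ofFn]
  simp [eT.surjective t]

omit [Fintype P] in
theorem filter_transList {W : TPWN P T} {eP : Fin a ≃ P} {eT : Fin b ≃ T} {c : T → ℕ}
    {C D : Finset T} {f : TransCode → Bool}
    (h : ∀ t ∈ C, f (transCode W eP c t) = true ↔ t ∈ D) (hD : D ⊆ C) :
    (transList W eP eT c C).filter f = transList W eP eT c D := by
  classical
  rw [transList, transList, List.filter_map, List.filter_filter]
  congr 1
  refine List.filter_congr fun t _ => ?_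
  by_cases ht : t ∈ C
  · rw [decide_eq_true ht, Bool.and_true, Function.comp_apply, Bool.eq_iff_iff, h t ht,
      decide_eq_true_iff]
  · rw [decide_eq_false ht, Bool.and_false, decide_eq_false fun h' => ht (hD h')]

omit [Fintype P] in
theorem sum_transList (W : TPWN P T) (eP : Fin a ≃ P) (eT : Fin b ≃ T) (c : T → ℕ)
    (C : Finset T) (f : TransCode → ℤ) :
    ((transList W eP eT c C).map f).sum = ∑ t ∈ C, f (transCode W eP c t) := by
  classical
  rw [transList, List.map_map, ← List.sum_toFinset]
  · refine Finset.sum_congr ?_ fun _ _ => rfl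
    ext t
    rw [List.mem_toFinset, List.mem_filter, decide_eq_true_iff, List.mem_ofFn]
    simp [eT.surjective t]
  · exact (List.nodup_ofFn.2 eT.injective).filter _

theorem confl_code (W : TPWN P T) (eP : Fin a ≃ P) (eT : Fin b ≃ T) (c : T → ℕ)
    (x : P → WithBot ℕ) (t : T) :
    confl (transList W eP eT c Finset.univ) (stateCode eP x) (transCode W eP c t) =
      transList W eP eT c (W.conflictSet t (supp x)) := by
  refine filter_transList (fun u _ => ?_) (Finset.subset_univ _)
  rw [Bool.and_eq_true, Bool.and_eq_true, mem_conflictSet]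
  exact and_congr (isEnabled_code _ _ _) (and_congr (isEnabled_code _ _ _) (meets_code _ _ _ _))

omit [Fintype P] in
theorem startVal_code (W : TPWN P T) (eP : Fin a ≃ P) (eT : Fin b ≃ T) (c : T → ℕ)
    (x : P → WithBot ℕ) (C : Finset T) :
    startVal (transList W eP eT c C) (stateCode eP x) =
      entryCode ((C.biUnion W.pre).sup x) := by
  refine eq_of_forall_ge_iff fun m => ?_
  rw [startVal, maxL_le_iff, entryCode_le_iff, Finset.sup_biUnion,
    Finset.sup_lt_iff (WithBot.bot_lt_coe m)]
  simp only [List.mem_map, forall_exists_index, and_imp, forall_apply_eq_imp_iff₂, mem_transList]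
  refine forall₂_congr fun t _ => ?_
  rw [← entryCode_le_iff, ← supVal_code]
  rfl

theorem startVal_code_of_mem (W : TPWN P T) (eP : Fin a ≃ P) (eT : Fin b ≃ T) (c : T → ℕ)
    {x : P → WithBot ℕ} {C : Finset T} (hC : C ∈ W.conflictSets (supp x)) :
    startVal (transList W eP eT c C) (stateCode eP x) = W.startTime x C + 1 := by
  rw [startVal_code, entryCode_of_ne_bot, startTime]
  obtain ⟨t, ht⟩ := nonempty_of_mem_conflictSets hC
  intro h
  refine sup_pre_ne_bot' (pre_subset_of_mem hC ht) (le_bot_iff.1 (le_trans ?_ h.le))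
  exact Finset.sup_mono (Finset.subset_biUnion_of_mem _ ht)

/-- The conflict sets chosen by the algorithm constitute an earliest-first choice. -/
theorem exists_earliestFirst (W : TPWN P T) (eP : Fin a ≃ P) (eT : Fin b ≃ T) (c : T → ℕ) :
    ∃ γ, W.EarliestFirst γ ∧ ∀ x,
      choice (transList W eP eT c Finset.univ) (stateCode eP x) = transList W eP eT c (γ x) := by
  classical
  have key : ∀ x : P → WithBot ℕ, ∃ C : Finset T, ((W.conflictSets (supp x) = ∅ ∧ C = ∅) ∨
      (C ∈ W.conflictSets (supp x) ∧
        ∀ D ∈ W.conflictSets (supp x), W.startTime x C ≤ W.startTime x D)) ∧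
      choice (transList W eP eT c Finset.univ) (stateCode eP x) = transList W eP eT c C := by
    intro x
    set Q : Finset T := Finset.univ.filter fun t => W.pre t ⊆ supp x ∧ ∀ u, W.pre u ⊆ supp x →
      W.startTime x (W.conflictSet t (supp x)) ≤ W.startTime x (W.conflictSet u (supp x)) with hQ
    have h1 : earliest (transList W eP eT c Finset.univ) (stateCode eP x) =
        transList W eP eT c Q := by
      refine filter_transList (fun t _ => ?_) (Finset.subset_univ _)
      rw [Bool.and_eq_true, hQ, Finset.mem_filter, and_iff_right (Finset.mem_univ t),
        List.all_eq_true]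
      refine and_congr_left' (isEnabled_code _ _ _) |>.trans (and_congr_right fun ht => ?_)
      have : ∀ u : T, ((!isEnabled (stateCode eP x) (transCode W eP c u).pre ||
          decide (startVal (confl (transList W eP eT c Finset.univ) (stateCode eP x)
            (transCode W eP c t)) (stateCode eP x) ≤
            startVal (confl (transList W eP eT c Finset.univ) (stateCode eP x)
            (transCode W eP c u)) (stateCode eP x))) = true) ↔ (W.pre u ⊆ supp x →
          W.startTime x (W.conflictSet t (supp x)) ≤ W.startTime x (W.conflictSet u (supp x))) := by
        intro u
        rw [Bool.or_eq_true, Bool.not_eq_true', ← Bool.not_eq_true, decide_eq_true_iff,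
          ← imp_iff_not_or]
        refine imp_congr_ctx (isEnabled_code _ _ _) fun hu => ?_
        rw [confl_code, confl_code, startVal_code_of_mem W eP eT c ⟨t, ht, rfl⟩,
          startVal_code_of_mem W eP eT c ⟨u, hu, rfl⟩]
        exact Nat.succ_le_succ_iff
      constructor
      · exact fun h u => (this u).1 (h _ (mem_transList.2 ⟨u, Finset.mem_univ _, rfl⟩))
      · intro h v hv
        obtain ⟨u, _, rfl⟩ := mem_transList.1 hv
        exact (this u).2 (h u)
    rw [choice, h1]
    by_cases hne : ∃ t, W.pre t ⊆ supp x
    · obtain ⟨t, ht, hmin⟩ := Finset.exists_min_image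
        (Finset.univ.filter fun t => W.pre t ⊆ supp x)
        (fun t => W.startTime x (W.conflictSet t (supp x)))
        (by obtain ⟨t, ht⟩ := hne; exact ⟨t, by simpa using ht⟩)
      have htQ : t ∈ Q := by
        rw [hQ, Finset.mem_filter]
        exact ⟨Finset.mem_univ _, by simpa using ht, fun u hu => hmin u (by simpa using hu)⟩
      have hm : transCode W eP c t ∈ transList W eP eT c Q := mem_transList.2 ⟨t, htQ, rfl⟩
      cases hl : transList W eP eT c Q with
      | nil => rw [hl] at hm; cases hm
      | cons v l =>
        obtain ⟨u, hu, rfl⟩ := mem_transList.1 (show v ∈ transList W eP eT c Q by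
          rw [hl]; exact List.mem_cons_self)
        rw [hQ, Finset.mem_filter] at hu
        refine ⟨_, Or.inr ⟨⟨u, hu.2.1, rfl⟩, ?_⟩, confl_code W eP eT c x u⟩
        rintro D ⟨v, hv, rfl⟩
        exact hu.2.2 v hv
    · have hQe : Q = ∅ := Finset.filter_eq_empty_iff.2 fun t _ h => hne ⟨t, h.1⟩
      refine ⟨∅, Or.inl ⟨?_, rfl⟩, ?_⟩
      · exact Set.eq_empty_of_forall_notMem fun D ⟨t, ht, _⟩ => hne ⟨t, ht⟩
      · have h0 : transList W eP eT c ∅ = [] := by simp [transList]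
        rw [hQe, h0]
        exact List.filter_eq_nil_iff.2 fun v _ => by simp [meets, dummy, TransCode.pre]
  choose γ hγ using key
  exact ⟨γ, fun x => (hγ x).1, fun x => (hγ x).2⟩

end Complexity

/-! ### Correctness of the exploration -/

namespace Complexity

open Enc TPWN

variable {P T : Type*} [Fintype P] [DecidableEq P] [Fintype T] {a b : ℕ}

/-- A list of states represents distinct abstraction states, the first of which is the initial
one. -/
def Represents (W : TPWN P T) (γ : (P → WithBot ℕ) → Finset T) (eP : Fin a ≃ P)
    (S : List (List ℕ)) (σ : List (P → WithBot ℕ)) : Prop :=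
  S = σ.map (stateCode eP) ∧ σ.Nodup ∧ (∀ x ∈ σ, W.AbsReachable γ x) ∧
    ∃ σ', σ = W.timestampInit :: σ'

theorem mem_newStates {W : TPWN P T} {eP : Fin a ≃ P} {eT : Fin b ≃ T} {c : T → ℕ}
    {γ : (P → WithBot ℕ) → Finset T} (hγ : W.EarliestFirst γ)
    (hc : ∀ x, choice (transList W eP eT c Finset.univ) (stateCode eP x) =
      transList W eP eT c (γ x)) {σ : List (P → WithBot ℕ)} {z : List ℕ} :
    z ∈ newStates (transList W eP eT c Finset.univ) (σ.map (stateCode eP)) ↔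
      ∃ x ∈ σ, ∃ t ∈ γ x, W.absStep x t ∉ σ ∧ stateCode eP (W.absStep x t) = z := by
  have h0 : ∀ y : P → WithBot ℕ, (!(σ.map (stateCode eP)).any fun y' =>
      eqState y' (stateCode eP y)) = true ↔ y ∉ σ := by
    intro y
    rw [Bool.not_eq_true', ← Bool.not_eq_true, not_iff_not, List.any_eq_true]
    constructor
    · rintro ⟨y', hy', h⟩
      obtain ⟨x, hx, rfl⟩ := List.mem_map.1 hy'
      rwa [← (eqState_code _ _ _).1 h]
    · exact fun h => ⟨_, List.mem_map_of_mem h, (eqState_code _ _ _).2 rfl⟩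
  rw [newStates, List.mem_filter, List.mem_flatMap]
  constructor
  · rintro ⟨⟨y, hy, hz⟩, hn⟩
    obtain ⟨x, hx, rfl⟩ := List.mem_map.1 hy
    rw [hc] at hz
    obtain ⟨u, hu, rfl⟩ := List.mem_map.1 hz
    obtain ⟨t, ht, rfl⟩ := mem_transList.1 hu
    rw [succState_code W eP c (pre_subset_of_mem (hγ.mem ht) ht)] at hn ⊢
    exact ⟨x, hx, t, ht, (h0 _).1 hn, rfl⟩
  · rintro ⟨x, hx, t, ht, hn, rfl⟩
    refine ⟨⟨_, List.mem_map_of_mem hx, ?_⟩, (h0 _).2 hn⟩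
    rw [hc, ← succState_code W eP c (pre_subset_of_mem (hγ.mem ht) ht)]
    exact List.mem_map_of_mem (mem_transList.2 ⟨t, ht, rfl⟩)

/-- After `m` exploration steps, either all abstraction states have been found, or there are more
than `m` of them. -/
theorem exists_represents {W : TPWN P T} {eP : Fin a ≃ P} {eT : Fin b ≃ T} {c : T → ℕ}
    {γ : (P → WithBot ℕ) → Finset T} (hγ : W.EarliestFirst γ)
    (hc : ∀ x, choice (transList W eP eT c Finset.univ) (stateCode eP x) =
      transList W eP eT c (γ x)) (clock : List Unit) :
    ∃ σ, Represents W γ eP (exploreAll (netCode W eP eT c) clock) σ ∧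
      ((∀ x ∈ σ, ∀ t ∈ γ x, W.absStep x t ∈ σ) ∨ σ.length = clock.length + 1) := by
  induction clock using List.reverseRecOn with
  | nil =>
    refine ⟨[W.timestampInit], ⟨?_, List.nodup_singleton _, ?_, [], rfl⟩, Or.inr rfl⟩
    · rw [List.map_singleton, ← initState_code]
      rfl
    · intro x hx
      rw [List.mem_singleton.1 hx]
      exact AbsReachable.init
  | append_singleton l e ih =>
    obtain ⟨σ, ⟨h1, h2, h3, σ', h4⟩, h5⟩ := ih
    have hstep : exploreAll (netCode W eP eT c) (l ++ [e]) =
        explore (transList W eP eT c Finset.univ) (exploreAll (netCode W eP eT c) l) := by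
      rw [exploreAll, List.foldl_append]
      rfl
    rw [hstep, h1, explore]
    have hmem := @mem_newStates _ _ _ _ _ _ _ W eP eT c γ hγ hc σ
    cases h : newStates (transList W eP eT c Finset.univ) (σ.map (stateCode eP)) with
    | nil =>
      refine ⟨σ, ⟨rfl, h2, h3, σ', h4⟩, Or.inl fun x hx t ht => ?_⟩
      by_contra hn
      have := hmem.2 ⟨x, hx, t, ht, hn, rfl⟩
      rw [h] at this
      cases this
    | cons z zs =>
      obtain ⟨x, hx, t, ht, hn, hz⟩ := hmem.1 (by rw [h]; exact List.mem_cons_self)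
      refine ⟨σ ++ [W.absStep x t], ⟨?_, ?_, ?_, σ' ++ [W.absStep x t], by rw [h4]; rfl⟩,
        Or.inr ?_⟩
      · rw [List.map_append, List.map_singleton, hz]
        rfl
      · exact List.nodup_append.2 ⟨h2, List.nodup_singleton _, fun y hy y' hy' => by
          rw [List.mem_singleton.1 hy']
          rintro rfl
          exact hn hy⟩
      · intro y hy
        rcases List.mem_append.1 hy with hy | hy
        · exact h3 y hy
        · rw [List.mem_singleton.1 hy]
          exact AbsReachable.step x t (h3 x hx) ht
      · rcases h5 with h5 | h5
        · exact absurd (h5 x hx t ht) hn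
        · rw [List.length_append, List.length_append, h5]
          rfl

omit [Fintype P] in
theorem mem_of_absReachable {W : TPWN P T} {γ : (P → WithBot ℕ) → Finset T}
    {σ : List (P → WithBot ℕ)} (h0 : W.timestampInit ∈ σ)
    (h : ∀ x ∈ σ, ∀ t ∈ γ x, W.absStep x t ∈ σ) {x : P → WithBot ℕ} (hx : W.AbsReachable γ x) :
    x ∈ σ := by
  induction hx with
  | init => exact h0
  | step x t _ ht ih => exact h x ih t ht

/-- The number of abstraction states is at most exponential. -/
theorem length_le_of_absReachable {W : TPWN P T} {γ : (P → WithBot ℕ) → Finset T}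
    {σ : List (P → WithBot ℕ)} (hn : σ.Nodup) (h : ∀ x ∈ σ, W.AbsReachable γ x) :
    σ.length ≤ (W.maxDur + 2) ^ Fintype.card P := by
  classical
  have hlt : ∀ x : P → WithBot ℕ, W.AbsReachable γ x → ∀ p, entryCode (x p) < W.maxDur + 2 :=
    fun x hx p => Nat.lt_succ_of_le (entryCode_le_iff.2 ((hx.le_maxDur p).trans_lt
      (WithBot.coe_lt_coe.2 (Nat.lt_succ_self _))))
  let f : {x // x ∈ σ.toFinset} → P → Fin (W.maxDur + 2) := fun x p =>
    ⟨entryCode (x.1 p), hlt x.1 (h _ (List.mem_toFinset.1 x.2)) p⟩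
  have hf : Function.Injective f := fun x y hxy => Subtype.ext (funext fun p =>
    entryCode_injective (congrArg Fin.val (congrFun hxy p)))
  have := Fintype.card_le_of_injective f hf
  rwa [Fintype.card_coe, List.toFinset_card_of_nodup hn, Fintype.card_fun, Fintype.card_fin] at this

/-! ### Correctness of the linear system -/

/-- The rows of the integral linear system. -/
theorem sum_coeff {W : TPWN P T} {eP : Fin a ≃ P} {eT : Fin b ≃ T} {c : T → ℕ}
    {γ : (P → WithBot ℕ) → Finset T} (hγ : W.EarliestFirst γ)
    (hc : ∀ x, choice (transList W eP eT c Finset.univ) (stateCode eP x) =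
      transList W eP eT c (γ x)) {σ : List (P → WithBot ℕ)} (hn : σ.Nodup)
    {x : P → WithBot ℕ} (hx : x ∈ σ) (hcl : ∀ t ∈ γ x, W.absStep x t ∈ σ)
    (g : (P → WithBot ℕ) → ℝ) :
    (σ.map fun z => (coeff (transList W eP eT c Finset.univ) (setCode eP {W.o}) (stateCode eP x)
      (stateCode eP z) : ℝ) * g z).sum =
      if supp x = {W.o} then g x else ∑ t ∈ γ x, (c t : ℝ) * (g x - g (W.absStep x t)) := by
  classical
  rw [← List.sum_toFinset _ hn]
  have heq : ∀ y z : P → WithBot ℕ, eqState (stateCode eP y) (stateCode eP z) = decide (y = z) :=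
    fun y z => by rw [Bool.eq_iff_iff, eqState_code, decide_eq_true_iff]
  have hfin : isFinal (setCode eP {W.o}) (stateCode eP x) = decide (supp x = {W.o}) := by
    rw [Bool.eq_iff_iff, isFinal_code, decide_eq_true_iff]
  have hpick : ∀ y ∈ σ, ∀ w : ℝ, ∑ z ∈ σ.toFinset, (if y = z then w else 0) * g z = w * g y := by
    intro y hy w
    simp only [ite_mul, zero_mul]
    rw [Finset.sum_ite_eq, if_pos (List.mem_toFinset.2 hy)]
  by_cases h : supp x = {W.o}
  · rw [if_pos h, ← one_mul (g x), ← hpick x hx]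
    refine Finset.sum_congr rfl fun z _ => ?_
    rw [coeff, hfin, decide_eq_true h, heq]
    by_cases hz : x = z <;> simp [hz]
  · rw [if_neg h]
    have hcoeff : ∀ z, (coeff (transList W eP eT c Finset.univ) (setCode eP {W.o})
        (stateCode eP x) (stateCode eP z) : ℝ) = ∑ t ∈ γ x, ((if x = z then (c t : ℝ) else 0) -
          if W.absStep x t = z then (c t : ℝ) else 0) := by
      intro z
      rw [coeff, hfin, decide_eq_false h, heq, hc, cond_false, totalWeight, sum_transList,
        sum_transList, Finset.sum_sub_distrib]
      have : ∀ t ∈ γ x, (bif eqState (succState (stateCode eP x) (transCode W eP c t))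
          (stateCode eP z) then ((transCode W eP c t).num : ℤ) else 0) =
          if W.absStep x t = z then (c t : ℤ) else 0 := by
        intro t ht
        rw [succState_code W eP c (pre_subset_of_mem (hγ.mem ht) ht), heq, cond_eq_ite]
        simp only [decide_eq_true_iff]
        rfl
      rw [Finset.sum_congr rfl this]
      have h2 : ∀ t, ((transCode W eP c t).num : ℤ) = c t := fun _ => rfl
      simp only [h2]
      by_cases hz : x = z
      · simp [hz]
      · simp [hz]
    simp only [hcoeff, Finset.sum_mul, sub_mul, Finset.sum_sub_distrib]
    rw [Finset.sum_comm, Finset.sum_congr rfl fun t _ => hpick x hx _, Finset.sum_comm,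
      Finset.sum_congr rfl fun t ht => hpick _ (hcl t ht) _]
    simp only [mul_sub, Finset.sum_sub_distrib]

end Complexity

namespace Complexity

open Enc TPWN

variable {P T : Type*} [Fintype P] [DecidableEq P] [Fintype T] {a b : ℕ}

theorem sum_range_getD {α : Type*} (l : List α) (d : α) (f : α → ℝ) :
    ∑ j : Fin l.length, f (l.getD j d) = (l.map f).sum := by
  rw [← List.sum_ofFn]
  congr 1
  refine List.ext_getElem (by simp) fun i h1 h2 => ?_
  simp only [List.getElem_ofFn, List.getElem_map]
  rw [List.getD_eq_getElem _ _ (by simpa using h2)]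

theorem getD_map {α β : Type*} (f : α → β) {l : List α} {i : ℕ} (hi : i < l.length) (d : α)
    (d' : β) : (l.map f).getD i d' = f (l.getD i d) := by
  rw [List.getD_eq_getElem _ _ (by simpa using hi), List.getElem_map, List.getD_eq_getElem _ _ hi]

section

variable {W : TPWN P T} {eP : Fin a ≃ P} {eT : Fin b ≃ T} {c : T → ℕ}
  {σ : List (P → WithBot ℕ)}

omit [Fintype P] in
theorem length_coeffs : (coeffs (netCode W eP eT c) (σ.map (stateCode eP))).length = σ.length := by
  rw [coeffs, List.length_map, List.length_map]

omit [Fintype P] in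
theorem entry_coeffs (i j : Fin σ.length) (d : P → WithBot ℕ) :
    entry (coeffs (netCode W eP eT c) (σ.map (stateCode eP))) i j =
      coeff (transList W eP eT c Finset.univ) (setCode eP {W.o}) (stateCode eP (σ.getD i d))
        (stateCode eP (σ.getD j d)) := by
  simp only [entry, coeffs, List.map_map]
  rw [getD_map _ i.2 d]
  simp only [Function.comp_apply]
  rw [getD_map _ j.2 d]
  rfl

variable {γ : (P → WithBot ℕ) → Finset T} (hγ : W.EarliestFirst γ)
  (hc : ∀ x, choice (transList W eP eT c Finset.univ) (stateCode eP x) =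
    transList W eP eT c (γ x)) {D : ℝ} (hD : 0 < D) (hcw : ∀ t, (c t : ℝ) = D * W.w t)

include hcw in
omit [Fintype P] in
theorem sum_weights {C : Finset T} (hC : C.Nonempty) (f : T → ℝ) :
    ∑ t ∈ C, (c t : ℝ) * f t = D * W.weight C * ∑ t ∈ C, W.pr C t * f t := by
  have h : (W.weight C : ℝ) ≠ 0 := by exact_mod_cast (W.weight_pos hC).ne'
  rw [Finset.mul_sum]
  refine Finset.sum_congr rfl fun t _ => ?_
  rw [hcw, pr]
  push_cast
  field_simp

include hcw in
omit [Fintype P] in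
theorem sum_weights_sub {C : Finset T} (hC : C.Nonempty) (r : ℝ) (f : T → ℝ) :
    ∑ t ∈ C, (c t : ℝ) * (r - f t) = D * W.weight C * (r - ∑ t ∈ C, W.pr C t * f t) := by
  rw [sum_weights hcw hC]
  simp only [mul_sub, Finset.sum_sub_distrib]
  rw [← Finset.sum_mul, W.sum_pr hC, one_mul]

include hγ hc in
theorem sum_entry (hn : σ.Nodup) (hcl : ∀ x ∈ σ, ∀ t ∈ γ x, W.absStep x t ∈ σ)
    (g : (P → WithBot ℕ) → ℝ) (i : Fin σ.length) (d : P → WithBot ℕ) :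
    ∑ j : Fin σ.length, (entry (coeffs (netCode W eP eT c) (σ.map (stateCode eP))) i j : ℝ) *
      g (σ.getD j d) = if supp (σ.getD i d) = {W.o} then g (σ.getD i d) else
        ∑ t ∈ γ (σ.getD i d), (c t : ℝ) * (g (σ.getD i d) - g (W.absStep (σ.getD i d) t)) := by
  have hi : σ.getD i d ∈ σ := by
    rw [List.getD_eq_getElem _ _ i.2]
    exact List.getElem_mem _
  rw [← sum_coeff hγ hc hn hi (hcl _ hi) g, ← sum_range_getD σ d]
  exact Finset.sum_congr rfl fun j _ => by rw [entry_coeffs i j d]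

theorem det_eq_zero_iff_exists {n : ℕ} {B : List (List ℤ)} :
    (toMatrix n B).det = 0 ↔ ∃ v : Fin n → ℝ, v ≠ 0 ∧ ∀ i : Fin n,
      ∑ j : Fin n, (entry B i j : ℝ) * v j = 0 := by
  have h1 : (toMatrix n B).det = 0 ↔ ((toMatrix n B).map (Int.castRingHom ℝ)).det = 0 := by
    rw [← RingHom.mapMatrix_apply, ← RingHom.map_det]
    simp
  rw [h1, ← Matrix.exists_mulVec_eq_zero_iff]
  exact exists_congr fun v => and_congr_right fun _ => funext_iff

include hγ hc in
/-- If the net is unsound, then the probability of not reaching the final marking is a nontrivial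
solution of the homogeneous system. -/
theorem det_eq_zero_of_not_sound (hs : ¬ W.Sound) (hcw : ∀ t, (c t : ℝ) = D * W.w t)
    (hn : σ.Nodup) (hcl : ∀ x ∈ σ, ∀ t ∈ γ x, W.absStep x t ∈ σ)
    (hR : ∀ x ∈ σ, W.AbsReachable γ x) (h0 : W.timestampInit ∈ σ) :
    (toMatrix σ.length (coeffs (netCode W eP eT c) (σ.map (stateCode eP)))).det = 0 := by
  refine det_eq_zero_iff_exists.2
    ⟨fun j => 1 - W.hitLim (supp (σ.getD j W.timestampInit)), fun h => ?_, fun i => ?_⟩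
  · obtain ⟨k, hk, e⟩ := List.mem_iff_getElem.1 h0
    have h1 := congrFun h ⟨k, hk⟩
    dsimp only at h1
    rw [List.getD_eq_getElem _ _ hk, e, supp_timestampInit] at h1
    exact (sub_pos.2 (hitLim_init_lt_one hs)).ne' h1
  · rw [sum_entry hγ hc hn hcl (fun x => 1 - W.hitLim (supp x))]
    set x := σ.getD i W.timestampInit with hx
    have hxσ : x ∈ σ := by
      rw [hx, List.getD_eq_getElem _ _ i.2]
      exact List.getElem_mem _
    split_ifs with hf
    · rw [hf, hitLim_final, sub_self]
    · rcases hγ x with ⟨_, h⟩ | ⟨h, _⟩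
      · rw [h, Finset.sum_empty]
      · have hne := nonempty_of_mem_conflictSets h
        have h2 := hitLim_eq (hR x hxσ |>.sReach hγ) h
        simp only [sub_sub_sub_cancel_left]
        rw [← neg_eq_zero, ← Finset.sum_neg_distrib]
        simp only [← mul_neg, neg_sub]
        rw [sum_weights_sub hcw hne, h2, mul_eq_zero]
        right
        rw [sub_eq_zero]
        exact Finset.sum_congr rfl fun t ht => by rw [supp_absStep (pre_subset_of_mem h ht)]

include hγ hc hD hcw in
/-- If the net is sound, then a solution of the homogeneous system can be added to a solution of the
linear system, which is unique. -/
theorem det_ne_zero_of_sound (hs : W.Sound)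
    (hn : σ.Nodup) (hcl : ∀ x ∈ σ, ∀ t ∈ γ x, W.absStep x t ∈ σ)
    (hR : ∀ x ∈ σ, W.AbsReachable γ x) (h0 : W.timestampInit ∈ σ)
    {X : (P → WithBot ℕ) → ℝ} (hX : W.SolvesSystem γ X) :
    (toMatrix σ.length (coeffs (netCode W eP eT c) (σ.map (stateCode eP)))).det ≠ 0 := by
  classical
  intro hdet
  obtain ⟨v, hv, hBv⟩ := det_eq_zero_iff_exists.1 hdet
  set d := W.timestampInit
  -- the kernel vector, as a function of the state
  let g : (P → WithBot ℕ) → ℝ := fun x =>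
    if h : σ.idxOf x < σ.length then v ⟨σ.idxOf x, h⟩ else 0
  have hg : ∀ j : Fin σ.length, g (σ.getD j d) = v j := by
    intro j
    have : σ.idxOf (σ.getD j d) = j := by
      rw [List.getD_eq_getElem _ _ j.2]
      exact hn.idxOf_getElem _ _
    simp only [g, this, j.2, dif_pos]
  have hrow : ∀ x ∈ σ, (if supp x = {W.o} then g x else
      ∑ t ∈ γ x, (c t : ℝ) * (g x - g (W.absStep x t))) = 0 := by
    intro x hx
    obtain ⟨k, hk, rfl⟩ := List.mem_iff_getElem.1 hx
    have h1 := sum_entry hγ hc hn hcl g ⟨k, hk⟩ d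
    dsimp only at h1
    rw [List.getD_eq_getElem _ _ hk] at h1
    rw [← h1, ← hBv ⟨k, hk⟩]
    exact Finset.sum_congr rfl fun j _ => by rw [hg]
  have hY : W.SolvesSystem γ fun x => X x + g x := by
    intro x hx
    have hxσ := mem_of_absReachable h0 hcl hx
    have h1 := hrow x hxσ
    refine ⟨fun hf => ?_, fun hf => ?_⟩
    · rw [if_neg hf] at h1
      have hC := hγ.mem_of_sound hs hx hf
      have hne := nonempty_of_mem_conflictSets hC
      have hw : (W.weight (γ x) : ℝ) ≠ 0 := by exact_mod_cast (W.weight_pos hne).ne'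
      rw [sum_weights_sub hcw hne, mul_eq_zero, or_iff_right (mul_ne_zero hD.ne' hw),
        sub_eq_zero] at h1
      have h2 := (hX x hx).1 hf
      dsimp only
      rw [h2, h1]
      simp only [mul_add, Finset.sum_add_distrib, pr, add_assoc]
    · rw [if_pos hf] at h1
      dsimp only
      rw [h1, add_zero, (hX x hx).2 hf]
  refine hv (funext fun j => ?_)
  have hj : σ.getD j d ∈ σ := by
    rw [List.getD_eq_getElem _ _ j.2]
    exact List.getElem_mem _
  have := SolvesSystem.unique hs hγ hX hY (hR _ hj)
  rw [← hg]
  simpa using this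

include hγ hc hcw in
theorem rhs_eq (hs : W.Sound) {x : P → WithBot ℕ} (hx : W.AbsReachable γ x)
    {X : (P → WithBot ℕ) → ℝ} (hX : W.SolvesSystem γ X) :
    (rhs (transList W eP eT c Finset.univ) (setCode eP {W.o}) (stateCode eP x) : ℝ) =
      if supp x = {W.o} then X x else ∑ t ∈ γ x, (c t : ℝ) * (X x - X (W.absStep x t)) := by
  by_cases hf : supp x = {W.o}
  · have hfin : isFinal (setCode eP {W.o}) (stateCode eP x) = true := (isFinal_code _ _ _).2 hf
    have hne : Finset.univ.sup x ≠ ⊥ := by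
      have ho : x W.o ≠ ⊥ := mem_supp.1 (by rw [hf]; exact Finset.mem_singleton_self _)
      exact fun h => ho (le_bot_iff.1 ((Finset.le_sup (Finset.mem_univ W.o)).trans h.le))
    rw [if_pos hf, rhs, hfin, cond_true, maxL_code, entryCode_of_ne_bot hne, (hX x hx).2 hf,
      maxEntry]
    simp
  · have hfin : isFinal (setCode eP {W.o}) (stateCode eP x) = false := by
      rw [← Bool.not_eq_true, isFinal_code]
      exact hf
    have hC := hγ.mem_of_sound hs hx hf
    have hne := nonempty_of_mem_conflictSets hC
    obtain ⟨t, ht⟩ := hne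
    have h2 := (hX x hx).1 hf
    rw [if_neg hf, rhs, hfin, cond_false, hc, startVal_code_of_mem W eP eT c hC,
      sum_weights_sub hcw ⟨t, ht⟩, totalWeight, sum_transList, ← hγ.reward_eq ht]
    have h3 : X x - ∑ t ∈ γ x, W.pr (γ x) t * X (W.absStep x t) = W.reward x :=
      sub_eq_iff_eq_add.2 h2
    have h4 : D * (W.weight (γ x) : ℝ) = ∑ t ∈ γ x, (c t : ℝ) := by
      rw [weight, Rat.cast_sum, Finset.mul_sum]
      exact Finset.sum_congr rfl fun t _ => (hcw t).symm
    rw [h3, h4]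
    push_cast
    rfl

include hγ hc hD hcw in
/-- The algorithm computes the solution of the linear system if the net is sound, and detects
unsoundness. -/
theorem isOutput_result (hn : σ.Nodup) (hcl : ∀ x ∈ σ, ∀ t ∈ γ x, W.absStep x t ∈ σ)
    (hR : ∀ x ∈ σ, W.AbsReachable γ x) (h0 : ∃ σ', σ = W.timestampInit :: σ')
    {e : WithTop ℚ≥0} (he : e = ⊤ ↔ ¬ W.Sound)
    (hv : ∀ v : ℚ≥0, e = v → ∃ X, W.SolvesSystem γ X ∧ X W.timestampInit = (v : ℝ)) :
    IsOutput (result (netCode W eP eT c) (σ.map (stateCode eP))) e := by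
  obtain ⟨σ', h0⟩ := h0
  have h0' : W.timestampInit ∈ σ := by rw [h0]; exact List.mem_cons_self
  have hlen := length_coeffs (W := W) (eP := eP) (eT := eT) (c := c) (σ := σ)
  have hpos : 0 < σ.length := List.length_pos_of_mem h0'
  have hne : coeffs (netCode W eP eT c) (σ.map (stateCode eP)) ≠ [] := by
    rw [← List.length_pos_iff, hlen]
    exact hpos
  have hz := scaledDet_eq_zero_iff hne
  rw [hlen] at hz
  rw [result]
  by_cases hs : W.Sound
  · obtain ⟨v, rfl⟩ := WithTop.ne_top_iff_exists.1 fun h => he.1 h hs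
    obtain ⟨X, hX, hXv⟩ := hv v rfl
    have hdet : scaledDet (coeffs (netCode W eP eT c) (σ.map (stateCode eP))) ≠ 0 :=
      fun h => det_ne_zero_of_sound hγ hc hD hcw hs hn hcl hR h0' hX (hz.1 h)
    have hsol := scaledSol_eq hne (b := (σ.map (stateCode eP)).map fun y =>
      rhs (transList W eP eT c Finset.univ) (setCode eP {W.o}) y)
      (x := fun j => X (σ.getD j W.timestampInit)) (by
        rw [hlen]
        intro i
        have hi : σ.getD i W.timestampInit ∈ σ := by
          rw [List.getD_eq_getElem _ _ i.2]
          exact List.getElem_mem _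
        rw [sum_entry hγ hc hn hcl X, ← rhs_eq hγ hc hcw hs (hR _ hi) hX]
        rw [List.map_map, getD_map _ i.2 W.timestampInit]
        rfl)
    dsimp only at hsol
    have hx0 : σ.getD 0 W.timestampInit = W.timestampInit := by rw [h0]; rfl
    rw [hx0, hXv] at hsol
    rw [decide_eq_false (by simpa using hdet), cond_false]
    refine Or.inr ⟨_, _, by simpa using hdet, ?_, rfl⟩
    set num := scaledSol (coeffs (netCode W eP eT c) (σ.map (stateCode eP)))
      ((σ.map (stateCode eP)).map fun y =>
      rhs (transList W eP eT c Finset.univ) (setCode eP {W.o}) y) with hnum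
    set den := scaledDet (coeffs (netCode W eP eT c) (σ.map (stateCode eP)))
    change ((v : ℚ≥0) : WithTop ℚ≥0) = ((num.natAbs : ℚ≥0) / (den.natAbs : ℚ≥0) : ℚ≥0)
    congr 1
    have hden : (den.natAbs : ℚ≥0) ≠ 0 := by exact_mod_cast Int.natAbs_ne_zero.2 hdet
    rw [eq_div_iff hden]
    have h1 := congrArg abs hsol
    rw [abs_mul, abs_of_nonneg (show (0 : ℝ) ≤ (v : ℝ) from NNRat.cast_nonneg v)] at h1
    have h2 : ∀ z : ℤ, |(z : ℝ)| = (z.natAbs : ℝ) := fun z => by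
      rw [Nat.cast_natAbs, Int.cast_abs]
    rw [h2, h2] at h1
    have h3 : ((v * (den.natAbs : ℚ≥0) : ℚ≥0) : ℝ) = ((num.natAbs : ℚ≥0) : ℝ) := by
      push_cast
      rw [h1, mul_comm]
    exact_mod_cast h3
  · have hdet := hz.2 (det_eq_zero_of_not_sound hγ hc hs hcw hn hcl hR h0')
    rw [decide_eq_true (by rw [hdet]; rfl), cond_true]
    exact Or.inl ⟨he.2 hs, rfl⟩

end

end Complexity

/-! ### The program and its running time -/

namespace Complexity

open Enc TPWN

/-- The elements of this list count the doubling steps that lead to a list longer than the number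
of abstraction states. -/
def exponents (N : NetCode) : List Bool :=
  N.1.flatMap fun _ => true :: true :: N.2.2.1.flatMap fun u => u.dur.bits

/-- A list of exponential length. -/
def clock (N : NetCode) : List Unit := (exponents N).foldl (fun r _ => r ++ r) [()]

theorem PT.exponents : PT exponents := by unfold Complexity.exponents; fun_prop

theorem foldl_double (l : List Bool) :
    l.foldl (fun r _ => r ++ r) [()] = List.replicate (2 ^ l.length) () := by
  induction l using List.reverseRecOn with
  | nil => rfl
  | append_singleton l e ih =>
    rw [List.foldl_append, ih, List.foldl_cons, List.foldl_nil, List.replicate_append_replicate,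
      List.length_append, List.length_singleton, pow_succ, mul_two]

theorem sz_clock (N : NetCode) : sz (clock N) = 2 * 2 ^ (exponents N).length + 1 := by
  rw [clock, foldl_double, sz_replicate_unit]

/-- The result for the code of a net. -/
def output (N : NetCode) : Data :=
  result (normalize N) (exploreAll (normalize N) (clock N))

/-- There is a program that computes the result in single exponential time. -/
theorem exists_prog : ∃ (prog : Prog) (poly : Polynomial ℕ), ∀ N : NetCode,
    ∃ n, Runs prog (enc N) (output N) n ∧ n ≤ 2 ^ poly.eval (sz N) := by
  obtain ⟨pc, k, hpc⟩ := PT.exists_runs_foldl (s := fun _ (r : List Unit) _ => r ++ r)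
    PT.exponents (PT.const [()]) (by fun_prop)
  have hF : PT fun p : NetCode × List Unit =>
    result (normalize p.1) (exploreAll (normalize p.1) p.2) := by fun_prop
  obtain ⟨pf, m, hpf⟩ := hF
  obtain ⟨j, hj⟩ := PT.exponents.pb
  refine ⟨Prog.seq (Prog.cons Prog.id pc) pf,
    (Polynomial.X + (Polynomial.X + 1) ^ j + 3) * Polynomial.C (k + m) + 3, fun N => ?_⟩
  set E := (exponents N).length with hE
  set s := sz N with hs
  obtain ⟨n₁, h1, h1'⟩ := hpc N (2 * 2 ^ E + 1) fun l₁ l₂ e => by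
    rw [foldl_double, sz_replicate_unit]
    have : l₁.length ≤ E := by rw [hE, e, List.length_append]; omega
    have := Nat.pow_le_pow_right two_pos this
    omega
  obtain ⟨⟨n₂, h2, h2'⟩, -⟩ := hpf (N, clock N)
  refine ⟨_, Runs.seq (Runs.cons (Runs.id _) h1) h2, ?_⟩
  rw [sz_prod] at h2'
  dsimp only at h2'
  rw [sz_clock, ← hE] at h2'
  have hEs : E ≤ (s + 1) ^ j := (length_lt_sz _).le.trans (hj N)
  have hb : s + (2 * 2 ^ E + 1) + 2 ≤ 2 ^ (s + (s + 1) ^ j + 3) := by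
    have e1 : s ≤ 2 ^ s := Nat.lt_two_pow_self.le
    have e2 : 2 ^ E ≤ 2 ^ ((s + 1) ^ j) := Nat.pow_le_pow_right two_pos hEs
    have e3 : 1 ≤ 2 ^ s := Nat.one_le_two_pow
    have e4 : 1 ≤ 2 ^ ((s + 1) ^ j) := Nat.one_le_two_pow
    rw [pow_add, pow_add]
    nlinarith
  have hk : k ≤ k + m := by omega
  have hm : m ≤ k + m := by omega
  have b1 : n₁ ≤ 2 ^ ((s + (s + 1) ^ j + 3) * (k + m)) := by
    rw [pow_mul]
    exact h1'.trans ((Nat.pow_le_pow_left hb k).trans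
      (Nat.pow_le_pow_right (by positivity) hk))
  have b2 : n₂ ≤ 2 ^ ((s + (s + 1) ^ j + 3) * (k + m)) := by
    rw [pow_mul]
    refine h2'.trans ((Nat.pow_le_pow_left (le_trans (by omega) hb) m).trans
      (Nat.pow_le_pow_right (by positivity) hm))
  have b3 : 1 ≤ 2 ^ ((s + (s + 1) ^ j + 3) * (k + m)) := Nat.one_le_two_pow
  have e : Polynomial.eval s ((Polynomial.X + (Polynomial.X + 1) ^ j + 3) *
      Polynomial.C (k + m) + 3) = (s + (s + 1) ^ j + 3) * (k + m) + 3 := by simp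
  rw [e, pow_add]
  omega

/-! ### The code of the input -/

variable {P T : Type*} [Fintype P] [DecidableEq P] [Fintype T] {a b : ℕ}

/-- The code of a net as an input of the program. -/
def inputCode (W : TPWN P T) (eP : Fin a ≃ P) (eT : Fin b ≃ T) : NetCode :=
  (setCode eP {W.i}, setCode eP {W.o}, List.ofFn fun k => (setCode eP (W.pre (eT k)),
    setCode eP (W.post (eT k)), (W.w (eT k)).num.toNat, (W.w (eT k)).den, W.dur (eT k), ()), ())

omit [Fintype P] in
theorem enc_setCode (eP : Fin a ≃ P) (A : Finset P) : enc (setCode eP A) = encodeSet eP A := by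
  change Data.ofList ((setCode eP A).map Data.ofBool) = _
  rw [setCode, List.map_ofFn]
  rfl

omit [Fintype P] in
theorem enc_inputCode (W : TPWN P T) (eP : Fin a ≃ P) (eT : Fin b ≃ T) :
    enc (inputCode W eP eT) = W.encode eP eT := by
  have h : ∀ k, enc ((setCode eP (W.pre (eT k)), setCode eP (W.post (eT k)),
      (W.w (eT k)).num.toNat, (W.w (eT k)).den, W.dur (eT k), ()) : TransCode) =
      W.encodeTransition eP (eT k) := by
    intro k
    rw [encodeTransition, ← enc_setCode, ← enc_setCode]
    rfl
  have h' : enc (List.ofFn fun k => ((setCode eP (W.pre (eT k)), setCode eP (W.post (eT k)),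
      (W.w (eT k)).num.toNat, (W.w (eT k)).den, W.dur (eT k), ()) : TransCode)) =
      Data.ofList (List.ofFn fun k => W.encodeTransition eP (eT k)) := by
    change Data.ofList (List.map enc _) = _
    rw [List.map_ofFn]
    congr 2
    funext k
    exact h k
  rw [encode, ← enc_setCode, ← enc_setCode, ← h']
  rfl

/-- The integral weights computed by the algorithm. -/
def normWeight (W : TPWN P T) (eP : Fin a ≃ P) (eT : Fin b ≃ T) (t : T) : ℕ :=
  intWeight (inputCode W eP eT).2.2.1 (eT.symm t)

theorem prodL_eq_prod (l : List ℕ) : prodL l = l.prod := List.prod_eq_foldl.symm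

omit [Fintype P] in
theorem normWeight_eq (W : TPWN P T) (eP : Fin a ≃ P) (eT : Fin b ≃ T) (t : T) :
    (normWeight W eP eT t : ℝ) = (∏ u, ((W.w u).den : ℝ)) * W.w t := by
  classical
  have hlen : (inputCode W eP eT).2.2.1.length = b := List.length_ofFn
  have hget : ∀ k : Fin b, (inputCode W eP eT).2.2.1.getD k dummy =
      (setCode eP (W.pre (eT k)), setCode eP (W.post (eT k)),
      (W.w (eT k)).num.toNat, (W.w (eT k)).den, W.dur (eT k), ()) := fun k => getD_ofFn _ _ _
  rw [normWeight, intWeight, hget, Equiv.apply_symm_apply, prodL_eq_prod, hlen]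
  have h1 : ((List.range b).map fun j => bif decide (j = (eT.symm t : ℕ)) then 1 else
      ((inputCode W eP eT).2.2.1.getD j dummy).den).prod =
      ∏ u : T, if u = t then 1 else (W.w u).den := by
    change ∏ j ∈ Finset.range b, (bif decide (j = (eT.symm t : ℕ)) then 1 else
      ((inputCode W eP eT).2.2.1.getD j dummy).den) = _
    rw [Finset.prod_range, ← Equiv.prod_comp eT]
    refine Finset.prod_congr rfl fun k _ => ?_
    rw [hget, cond_eq_ite]
    simp only [decide_eq_true_iff, Fin.val_inj, Equiv.eq_symm_apply]
    rfl
  rw [h1]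
  have h2 : (∏ u, ((W.w u).den : ℝ)) =
      (W.w t).den * ∏ u : T, if u = t then 1 else ((W.w u).den : ℝ) := by
    rw [← Finset.mul_prod_erase _ _ (Finset.mem_univ t),
      ← Finset.mul_prod_erase Finset.univ (fun u => if u = t then 1 else ((W.w u).den : ℝ))
        (Finset.mem_univ t), if_pos rfl, one_mul]
    congr 1
    exact Finset.prod_congr rfl fun u hu => (if_neg (Finset.ne_of_mem_erase hu)).symm
  have h3 : ((W.w t).num.toNat : ℝ) = (W.w t).den * W.w t := by
    have h4 : (((W.w t).num.toNat : ℤ) : ℚ) = (W.w t).den * W.w t := by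
      rw [Int.toNat_of_nonneg (Rat.num_nonneg.2 (W.w_pos t).le), mul_comm, Rat.mul_den_eq_num]
    exact_mod_cast congrArg (fun q : ℚ => (q : ℝ)) h4
  rw [h2]
  change (((W.w t).num.toNat * _ : ℕ) : ℝ) = _
  push_cast
  rw [h3]
  ring

omit [Fintype P] in
theorem normalize_inputCode (W : TPWN P T) (eP : Fin a ≃ P) (eT : Fin b ≃ T) :
    normalize (inputCode W eP eT) = netCode W eP eT (normWeight W eP eT) := by
  classical
  have hlen : (inputCode W eP eT).2.2.1.length = b := List.length_ofFn
  have hL : transList W eP eT (normWeight W eP eT) Finset.univ =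
      List.ofFn fun k => transCode W eP (normWeight W eP eT) (eT k) := by
    rw [transList]
    simp only [Finset.mem_univ, decide_true, List.filter_true, List.map_ofFn]
    rfl
  rw [normalize, netCode, hL]
  refine congrArg₂ Prod.mk rfl (congrArg₂ Prod.mk rfl (congrArg₂ Prod.mk ?_ rfl))
  refine List.ext_getElem (by simp [hlen]) fun i h1 h2 => ?_
  have hi : i < b := by simpa using h2
  have hget : (inputCode W eP eT).2.2.1.getD i dummy = _ := getD_ofFn _ ⟨i, hi⟩ _
  simp only [List.getElem_map, List.getElem_range, List.getElem_ofFn, hget]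
  rw [transCode, normWeight, Equiv.symm_apply_apply]
  rfl

/-- The clock is longer than the number of functions from the places to `{⊥, 0, …, maxDur}`: for each
place it is doubled twice and once for every binary digit of a duration. -/
theorem pow_le_length_clock (W : TPWN P T) (eP : Fin a ≃ P) (eT : Fin b ≃ T) :
    (W.maxDur + 2) ^ Fintype.card P ≤ (clock (inputCode W eP eT)).length := by
  set Db := (inputCode W eP eT).2.2.1.flatMap fun u => u.dur.bits with hDb
  have hE : (exponents (inputCode W eP eT)).length = (2 + Db.length) * a := by
    have h1 : (inputCode W eP eT).1.length = a := List.length_ofFn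
    rw [exponents, List.length_flatMap, ← hDb]
    simp [h1, mul_comm]
    omega
  have hdur : W.maxDur < 2 ^ Db.length := by
    rw [maxDur, Finset.sup_lt_iff (by positivity)]
    intro t _
    rw [← Nat.size_le, ← Nat.size_eq_bits_len]
    refine List.Sublist.length_le (List.sublist_flatten_of_mem (List.mem_map.2
      ⟨_, (List.mem_ofFn.2 ⟨eT.symm t, rfl⟩), ?_⟩))
    rw [Equiv.apply_symm_apply]
    rfl
  rw [clock, foldl_double, List.length_replicate, hE, pow_mul, ← Fintype.card_congr eP,
    Fintype.card_fin]
  refine Nat.pow_le_pow_left ?_ a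
  rw [pow_add]
  omega

/-- The program computes the expected time. -/
theorem isOutput_output (W : TPWN P T) (eP : Fin a ≃ P) (eT : Fin b ≃ T) {e : WithTop ℚ≥0}
    (he : e = ⊤ ↔ ¬ W.Sound)
    (hv : ∀ γ, W.EarliestFirst γ → ∀ v : ℚ≥0, e = v →
      ∃ X, W.SolvesSystem γ X ∧ X W.timestampInit = (v : ℝ)) :
    IsOutput (output (inputCode W eP eT)) e := by
  obtain ⟨γ, hγ, hc⟩ := exists_earliestFirst W eP eT (normWeight W eP eT)
  obtain ⟨σ, ⟨h1, h2, h3, h4⟩, h5⟩ := exists_represents hγ hc (clock (inputCode W eP eT))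
  rw [output, normalize_inputCode, h1]
  have hcl : ∀ x ∈ σ, ∀ t ∈ γ x, W.absStep x t ∈ σ := by
    refine h5.resolve_right fun h => ?_
    have := (length_le_of_absReachable h2 h3).trans (pow_le_length_clock W eP eT)
    omega
  exact isOutput_result hγ hc (D := ∏ u, ((W.w u).den : ℝ))
    (Finset.prod_pos fun u _ => by exact_mod_cast (W.w u).den_pos)
    (normWeight_eq W eP eT) h2 hcl h3 h4 he (hv γ hγ)

end Complexity

/-! ### The expected time -/

namespace TPWN

variable {P T : Type*} [Fintype P] [DecidableEq P] [Fintype T]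

/-- All earliest-first choices yield the same rational number, which is the expected time under
every scheduler. -/
theorem exists_value {W : TPWN P T} (hs : W.Sound) : ∃ v : ℚ≥0,
    (∀ S : W.mdp.Scheduler, W.expectedTime S = ((v : ℝ≥0) : ℝ≥0∞)) ∧
    ∀ γ, W.EarliestFirst γ → ∃ X, W.SolvesSystem γ X ∧ X W.timestampInit = (v : ℝ) := by
  obtain ⟨γ₀, hγ₀, -⟩ := Complexity.exists_earliestFirst W (Fintype.equivFin P).symm
    (Fintype.equivFin T).symm fun _ => 1
  obtain ⟨X₀, hX₀⟩ := exists_rat_solution hs hγ₀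
  have h0 : 0 ≤ X₀ W.timestampInit := by
    exact_mod_cast SolvesSystem.nonneg hs hγ₀ hX₀ AbsReachable.init
  lift X₀ W.timestampInit to ℚ≥0 using h0 with v hv
  have hv' : ((X₀ W.timestampInit : ℚ) : ℝ) = (v : ℝ) := by rw [← hv]; simp
  refine ⟨v, fun S => ?_, fun γ hγ => ?_⟩
  · rw [expectedTime_eq hs hγ₀ hX₀, hv', show (v : ℝ) = ((v : ℝ≥0) : ℝ) from rfl, ENNReal.ofReal_coe_nnreal]
  · obtain ⟨X, hX⟩ := exists_rat_solution hs hγ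
    refine ⟨_, hX, ?_⟩
    obtain ⟨S⟩ : Nonempty W.mdp.Scheduler := inferInstance
    have h1 := (expectedTime_eq hs hγ hX S).symm.trans (expectedTime_eq hs hγ₀ hX₀ S)
    rw [ENNReal.ofReal_eq_ofReal_iff (SolvesSystem.nonneg hs hγ hX AbsReachable.init)
      (SolvesSystem.nonneg hs hγ₀ hX₀ AbsReachable.init)] at h1
    rw [h1, hv']

end TPWN

end

theorem mainTheorem3 :
    ∃ (prog : Prog) (poly : Polynomial ℕ),
      ∀ (P T : Type*) [Fintype P] [DecidableEq P] [Fintype T] (W : TPWN P T),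
        ∃ e : WithTop ℚ≥0,
          -- the expected time is `e`, whatever the scheduler: it is `∞` or a rational number
          (∀ S : W.mdp.Scheduler, W.expectedTime S = extRatToENNReal e) ∧
          -- it is infinite exactly for unsound nets
          (e = ⊤ ↔ ¬ W.Sound) ∧
          -- for sound nets it is given by the linear system over the finite abstraction
          (W.Sound → ∀ γ, W.EarliestFirst γ →
            (∀ x, W.AbsReachable γ x → ∀ p, x p ≤ (W.maxDur : WithBot ℕ)) ∧
            ∃ X : (P → WithBot ℕ) → ℝ, W.SolvesSystem γ X ∧
              (∀ Y, W.SolvesSystem γ Y → ∀ x, W.AbsReachable γ x → Y x = X x) ∧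
              ∃ v : ℚ≥0, e = (v : WithTop ℚ≥0) ∧ X W.timestampInit = (v : ℝ)) ∧
          -- it is computed by one program in single exponential time
          (∀ (a b : ℕ) (eP : Fin a ≃ P) (eT : Fin b ≃ T), ∃ (out : Data) (n : ℕ),
            Runs prog (W.encode eP eT) out n ∧ IsOutput out e ∧
              n ≤ 2 ^ poly.eval (W.encode eP eT).size) := by
  obtain ⟨prog, poly, hprog⟩ := Complexity.exists_prog
  refine ⟨prog, poly, fun P T _ _ _ W => ?_⟩
  have hrun : ∀ e : WithTop ℚ≥0, (e = ⊤ ↔ ¬ W.Sound) → (∀ γ, W.EarliestFirst γ → ∀ v : ℚ≥0,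
      e = v → ∃ X, W.SolvesSystem γ X ∧ X W.timestampInit = (v : ℝ)) →
      ∀ (a b : ℕ) (eP : Fin a ≃ P) (eT : Fin b ≃ T), ∃ (out : Data) (n : ℕ),
        Runs prog (W.encode eP eT) out n ∧ IsOutput out e ∧
          n ≤ 2 ^ poly.eval (W.encode eP eT).size := by
    intro e he hv a b eP eT
    obtain ⟨n, h1, h2⟩ := hprog (Complexity.inputCode W eP eT)
    rw [Complexity.enc_inputCode] at h1
    rw [Complexity.sz, Complexity.enc_inputCode] at h2
    exact ⟨_, n, h1, Complexity.isOutput_output W eP eT he hv, h2⟩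
  by_cases hs : W.Sound
  · obtain ⟨v, hv, hX⟩ := TPWN.exists_value hs
    have he : ((v : WithTop ℚ≥0) = ⊤ ↔ ¬ W.Sound) :=
      ⟨fun h => absurd h WithTop.coe_ne_top, fun h => absurd hs h⟩
    refine ⟨v, hv, he, fun _ γ hγ => ⟨fun x hx => hx.le_maxDur, ?_⟩,
      hrun _ he fun γ hγ v' hv' => ?_⟩
    · obtain ⟨X, h1, h2⟩ := hX γ hγ
      exact ⟨X, h1, fun Y hY x hx => TPWN.SolvesSystem.unique hs hγ h1 hY hx, v, rfl, h2⟩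
    · rw [← WithTop.coe_injective hv']
      exact hX γ hγ
  · refine ⟨⊤, fun S => TPWN.expectedTime_of_not_sound hs S, ⟨fun _ => hs, fun _ => rfl⟩,
      fun h => absurd h hs, hrun _ ⟨fun _ => hs, fun _ => rfl⟩ fun γ hγ v h => ?_⟩
    exact absurd h.symm WithTop.coe_ne_top
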